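/- **Setting.** Anti-de Sitter 3-space is $\mathrm{SL}(2,\mathbb R)$ with the bi-invariant Lorentz metric defined by $q(X)=-\det X$ on $\mathfrak{sl}(2,\mathbb R)$. Let $I\subset\mathbb R$ be an open interval. A smooth curve $\gamma:I\to \mathrm{SL}(2,\mathbb R)$ is *null* if $\det(\gamma^{-1}\gamma')\equiv0$, and has no flex points if $\gamma'$ and its covariant derivative are linearly independent everywhere. A *spinor frame* along $\gamma$ is a smooth pair $(\Gamma_+,\Gamma_-):I\to \mathrm{SL}(2,\mathbb R)^2$ with $\gamma=\Gamma_+\Gamma_-^{-1}$ and $$\Gamma_\pm^{-1}d\Gamma_\pm=\begin{pmatrix}0&1\\ k\pm1&0\end{pmatrix}\omega ,$$ where the 1-form $\omega$ vanishes nowhere (the canonical arc element) and $k$ is a smooth function (the curvature). Null curves without flex points are considered with their spinor frames; $\gamma$ is parametrized by the natural parameter if $\omega=ds$. An *extremal trajectory* with multiplier $m\in\mathbb R$ is a null curve without flex points, parametrized by the natural parameter, with non-constant curvature $k$, that is a critical point of $\int(m+k)\,\omega$ under compactly supported variations through null curves without flex points. Its *reduced curvature* is $h=\frac12(k-\frac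 m3)$. Curves $\gamma:I\to \mathrm{SL}(2,\mathbb R)$ and $\tilde\gamma:\tilde I\to \mathrm{SL}(2,\mathbb R)$ are *equivalent* if $\tilde\gamma(s)=A\gamma(s+c)B^{-1}$ for all $s\in\tilde I$, for some $c\in\mathbb R$ and $A,B\in \mathrm{SL}(2,\mathbb R)$. A *potential* with invariants $g_2,g_3\in\mathbb R$ is a non-constant smooth $h:I\to\mathbb R$ with $(h')^2=P(h)$, $P(t)=4t^3-g_2t-g_3$ (multiple roots of $P$ are allowed). Let $\sigma$ be the odd entire function with $\sigma'(0)=1$ such that $\wp=-\zeta'$, $\zeta=\sigma'/\sigma$, satisfies $(\wp')^2=4\wp^3-g_2\wp-g_3$. Let $c\in\mathbb R$, $s_0\in I$, $h(s_0)\ne c$, $\mu=\frac12\sqrt{P(c)}\in\mathbb C$, $r=\sqrt{h-c}$ (principal square roots), and let $\phi(s)=\int_{s_0}^s\frac{\mu\,du}{h(u)-c}$ if $\mu\neq0$ and $\phi(s)=\int_{s_0}^s\frac{du}{h(u)-c}$ if $\mu=0$. Put $$R=\frac1{2\mu}\begin{pmatrix}-\frac{h'-2\mu}{2r}&-r\\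 \frac{h'+2\mu}{2r}&r\end{pmatrix},\quad D=\begin{pmatrix}e^{-\phi}&0\\0&e^{\phi}\end{pmatrix}\quad(\mu\ne0),$$ $$R=\begin{pmatrix}1&0\\ \frac{h'}{2r}&r\end{pmatrix},\quad D=\begin{pmatrix}\frac1r&\phi\\0&1\end{pmatrix}\quad(\mu=0).$$ Let $\Gamma^c$ be the real-analytic map on $I$ with $\Gamma^c(s)=R(s_0)^{-1}D(s_0)^{-1}D(s)R(s)$ for all $s\in I$ such that $h-c$ has no zero between $s_0$ and $s$. For $m\in\mathbb R$ and $s_0\in I$ with $h(s_0)\neq\frac m3\pm1$, let $\Gamma_\pm=\Gamma^{m/3\pm1}$ and $\gamma(m,h,s_0)=\Gamma_+\Gamma_-^{-1}$. **Theorem A.** 1. For all real $g_2,g_3$ the function $\sigma$ exists and is unique. For every potential $h$, every $c\in\mathbb R$ and every $s_0\in I$ with $h(s_0)\ne c$, the map $\Gamma^c$ exists and is unique. There is $\alpha\in\mathbb C$ with $h(s)=\wp(s+\alpha)$ on $I$, and there is $w\in\mathbb C$ with $\wp(w)=c$, $\wp'(w)=2\mu$ unless $c$ is a multiple root of $P$.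 For all such $\alpha,w$, as long as $h-c$ has no zero between $s_0$ and $s$: * if $\mu\neq0$, then $e^{2\phi(s)}=Q(s)/Q(s_0)$, where $Q(s)=\frac{\sigma(s+\alpha-w)}{\sigma(s+\alpha+w)}e^{2(s+\alpha)\zeta(w)}$; * if $c$ is a simple root of $P$, then $\phi(s)=Z(s)-Z(s_0)$, where $Z(s)=\frac{-1}{3c^2-g_2/4}\{\zeta(s+\alpha+w)+c\,(s+\alpha)\}$; * if $c\ne0$ is a double root of $P$, then $\phi(s)=N(s)-N(s_0)$, where $N(s)=-\frac1{12c}\left\{\frac{h'(s)}{(h(s)-c)^2}+2s\right\}$; * if $g_2=g_3=c=0$, then $\phi(s)=\frac13(s+\alpha)^3-\frac13(s_0+\alpha)^3$. In the last two cases $h\ne c$ on all of $I$. In the first two cases $\Gamma^c(s)=R(s_0)^{-1}D(s_0)^{-1}D(s)R(s)$ holds at every $s\in I$ with $h(s)\neq c$, if in $D(s)$ and $R(s)$ one inserts a suitable value of $\phi(s)$ with $e^{2\phi(s)}=Q(s)/Q(s_0)$ (resp. the value $Z(s)-Z(s_0)$) and a suitable square root $r$ of $h(s)-c$. 2. For every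 $m\in\mathbb R$, every potential $h$ and every $s_0\in I$ with $h(s_0)\neq\frac m3\pm1$, the curve $\gamma(m,h,s_0)$ takes values in $\mathrm{SL}(2,\mathbb R)$ and is an extremal trajectory with multiplier $m$ and reduced curvature $h$. 3. Every extremal trajectory with multiplier $m$ is equivalent to a curve $\gamma(m,h,s_0)$ of this form. -/

import Mathlib

open Set

noncomputable section

/-! ### The Weierstrass functions with given real invariants -/

/-- The zeta function `σ' / σ` belonging to a sigma function. -/
def wZeta (σ : ℂ → ℂ) (z : ℂ) : ℂ := deriv σ z / σ z

/-- The function `℘ = -ζ'` belonging to a sigma function. -/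
def wP (σ : ℂ → ℂ) (z : ℂ) : ℂ := -deriv (wZeta σ) z

/-- `σ` is the Weierstrass sigma function with invariants `g₂, g₃` (the degenerate cases
`g₂ ^ 3 = 27 * g₃ ^ 2` included): the odd entire function with `σ'(0) = 1` for which
`℘ = -(log σ)''` satisfies `℘'² = 4 ℘³ - g₂ ℘ - g₃`. -/
structure IsWeierstrassSigma (g₂ g₃ : ℝ) (σ : ℂ → ℂ) : Prop where
  entire : Differentiable ℂ σ
  odd : ∀ z, σ (-z) = -σ z
  deriv_zero : deriv σ 0 = 1
  ode : ∀ z, σ z ≠ 0 →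
    deriv (wP σ) z ^ 2 = 4 * wP σ z ^ 3 - (g₂ : ℂ) * wP σ z - (g₃ : ℂ)

/-! ### Potentials and the explicit frames -/

/-- The cubic polynomial `P(t; g₂, g₃) = 4 t³ - g₂ t - g₃`. -/
def cubicP (g₂ g₃ t : ℝ) : ℝ := 4 * t ^ 3 - g₂ * t - g₃

/-- `h : I → ℝ` is a (smooth, non-constant) potential with invariants `g₂, g₃`. -/
structure IsPotential (I : Set ℝ) (g₂ g₃ : ℝ) (h : ℝ → ℝ) : Prop where
  smooth : ContDiffOn ℝ (⊤ : ℕ∞) h I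
  ode : ∀ s ∈ I, deriv h s ^ 2 = cubicP g₂ g₃ (h s)
  nonconst : ∃ s₁ ∈ I, ∃ s₂ ∈ I, h s₁ ≠ h s₂

/-- The principal square root of a real number: `√x`, or `i √|x|` if `x < 0`. -/
def csqrt (x : ℝ) : ℂ := (x : ℂ) ^ (1 / 2 : ℂ)

/-- `μ = ½ √P(c)`. -/
def muC (g₂ g₃ c : ℝ) : ℂ := 1 / 2 * csqrt (cubicP g₂ g₃ c)

open Classical in
/-- The phase `φ(s) = ∫_{s₀}^s μ / (h - c)` if `μ ≠ 0`, and `∫_{s₀}^s 1 / (h - c)` if `μ = 0`. -/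
def phase (g₂ g₃ : ℝ) (h : ℝ → ℝ) (c s₀ s : ℝ) : ℂ :=
  ∫ u in s₀..s, (if muC g₂ g₃ c = 0 then 1 else muC g₂ g₃ c) / ((h u - c : ℝ) : ℂ)

open Classical in
/-- The matrix `R`, as a function of `μ`, of the value `h'` of the derivative and of a square
root `r` of `h - c`. -/
def matR (μ h' r : ℂ) : Matrix (Fin 2) (Fin 2) ℂ :=
  if μ = 0 then !![1, 0; h' / (2 * r), r]
  else (1 / (2 * μ)) • !![-((h' - 2 * μ) / (2 * r)), -r; (h' + 2 * μ) / (2 * r), r]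

open Classical in
/-- The matrix `D`, as a function of `μ`, of the phase `φ` and of a square root `r` of `h - c`. -/
def matD (μ φ r : ℂ) : Matrix (Fin 2) (Fin 2) ℂ :=
  if μ = 0 then !![1 / r, φ; 0, 1]
  else !![Complex.exp (-φ), 0; 0, Complex.exp φ]

/-- `R(s₀)⁻¹ D(s₀)⁻¹ D(s) R(s)`, where the value `φ` of the phase and the value `r` of the square
root of `h - c` at `s` are still to be inserted. At `s₀` the phase is `0` and the square root is
the principal one. -/
def frameFormula (g₂ g₃ : ℝ) (h : ℝ → ℝ) (c s₀ s : ℝ) (φ r : ℂ) : Matrix (Fin 2) (Fin 2) ℂ :=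
  (matR (muC g₂ g₃ c) ((deriv h s₀ : ℝ) : ℂ) (csqrt (h s₀ - c)))⁻¹ *
    (matD (muC g₂ g₃ c) 0 (csqrt (h s₀ - c)))⁻¹ *
    matD (muC g₂ g₃ c) φ r * matR (muC g₂ g₃ c) ((deriv h s : ℝ) : ℂ) r

/-- `Γ` is the explicit frame of `h` for the constant `c`, normalized at `s₀`: it is given by the
formula `R(s₀)⁻¹ D(s₀)⁻¹ D(s) R(s)` as long as `h - c` has no zero between `s₀` and `s`, and it is
continued analytically to all of `I`. -/
structure IsExplicitFrame (I : Set ℝ) (g₂ g₃ : ℝ) (h : ℝ → ℝ) (c s₀ : ℝ)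
    (Γ : ℝ → Matrix (Fin 2) (Fin 2) ℂ) : Prop where
  analytic : ∀ i j, AnalyticOnNhd ℝ (fun s => Γ s i j) I
  formula : ∀ s ∈ I, (∀ u ∈ uIcc s₀ s, h u ≠ c) →
    Γ s = frameFormula g₂ g₃ h c s₀ s (phase g₂ g₃ h c s₀ s) (csqrt (h s - c))

/-- `h(s) = ℘(s + α)` on `I`. -/
def IsShift (I : Set ℝ) (h : ℝ → ℝ) (σ : ℂ → ℂ) (α : ℂ) : Prop :=
  ∀ s ∈ I, σ ((s : ℂ) + α) ≠ 0 ∧ ((h s : ℝ) : ℂ) = wP σ ((s : ℂ) + α)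

/-- `℘(w) = c` and `℘'(w) = 2 μ`. -/
def IsSpectralPoint (g₂ g₃ : ℝ) (σ : ℂ → ℂ) (c : ℝ) (w : ℂ) : Prop :=
  σ w ≠ 0 ∧ wP σ w = (c : ℂ) ∧ deriv (wP σ) w = 2 * muC g₂ g₃ c

/-- `σ(z - w) / σ(z + w) * exp (2 z ζ(w))`. -/
def sigmaQuotient (σ : ℂ → ℂ) (w z : ℂ) : ℂ :=
  σ (z - w) / σ (z + w) * Complex.exp (2 * z * wZeta σ w)

/-- `-1 / (3 c² - g₂ / 4) * (ζ(z + w) + c z)`. -/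
def zetaPrimitive (g₂ c : ℝ) (σ : ℂ → ℂ) (w z : ℂ) : ℂ :=
  -1 / (3 * (c : ℂ) ^ 2 - (g₂ : ℂ) / 4) * (wZeta σ (z + w) + (c : ℂ) * z)

/-- The expression of the phase and of the frame through the Weierstrass functions. -/
structure HasWeierstrassForm (I : Set ℝ) (g₂ g₃ : ℝ) (h : ℝ → ℝ) (c s₀ : ℝ) (σ : ℂ → ℂ) (α : ℂ)
    (Γ : ℝ → Matrix (Fin 2) (Fin 2) ℂ) : Prop where
  /-- The point `w` exists unless `c` is a multiple root of `P`. -/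
  exists_point : cubicP g₂ g₃ c ≠ 0 ∨ 3 * c ^ 2 - g₂ / 4 ≠ 0 → ∃ w, IsSpectralPoint g₂ g₃ σ c w
  /-- `μ ≠ 0`: the phase is half a logarithm of a quotient of sigma functions. -/
  phase_sigma : cubicP g₂ g₃ c ≠ 0 → ∀ w, IsSpectralPoint g₂ g₃ σ c w →
    ∀ s ∈ I, (∀ u ∈ uIcc s₀ s, h u ≠ c) →
      Complex.exp (2 * phase g₂ g₃ h c s₀ s) =
        sigmaQuotient σ w ((s : ℂ) + α) / sigmaQuotient σ w ((s₀ : ℂ) + α)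
  /-- `μ ≠ 0`: with suitable values of the logarithm and of the square root, the formula for the
  frame holds at all points where `h ≠ c`. -/
  frame_sigma : cubicP g₂ g₃ c ≠ 0 → ∀ w, IsSpectralPoint g₂ g₃ σ c w →
    ∀ s ∈ I, h s ≠ c →
      σ ((s : ℂ) + α - w) ≠ 0 ∧ σ ((s : ℂ) + α + w) ≠ 0 ∧
      ∃ φ r : ℂ, r ^ 2 = ((h s - c : ℝ) : ℂ) ∧
        Complex.exp (2 * φ) =
          sigmaQuotient σ w ((s : ℂ) + α) / sigmaQuotient σ w ((s₀ : ℂ) + α) ∧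
        Γ s = frameFormula g₂ g₃ h c s₀ s φ r
  /-- `μ = 0` and `c` a simple root of `P`: the phase through the zeta function. -/
  phase_zeta : cubicP g₂ g₃ c = 0 → 3 * c ^ 2 - g₂ / 4 ≠ 0 → ∀ w, IsSpectralPoint g₂ g₃ σ c w →
    ∀ s ∈ I, (∀ u ∈ uIcc s₀ s, h u ≠ c) →
      phase g₂ g₃ h c s₀ s =
        zetaPrimitive g₂ c σ w ((s : ℂ) + α) - zetaPrimitive g₂ c σ w ((s₀ : ℂ) + α)
  /-- `μ = 0` and `c` a simple root of `P`: the frame at all points where `h ≠ c`. -/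
  frame_zeta : cubicP g₂ g₃ c = 0 → 3 * c ^ 2 - g₂ / 4 ≠ 0 → ∀ w, IsSpectralPoint g₂ g₃ σ c w →
    ∀ s ∈ I, h s ≠ c →
      σ ((s : ℂ) + α + w) ≠ 0 ∧
      ∃ r : ℂ, r ^ 2 = ((h s - c : ℝ) : ℂ) ∧
        Γ s = frameFormula g₂ g₃ h c s₀ s
          (zetaPrimitive g₂ c σ w ((s : ℂ) + α) - zetaPrimitive g₂ c σ w ((s₀ : ℂ) + α)) r
  /-- `c ≠ 0` a double root of `P`. -/
  phase_node : cubicP g₂ g₃ c = 0 → 3 * c ^ 2 - g₂ / 4 = 0 → c ≠ 0 → ∀ s ∈ I,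
    h s ≠ c ∧ phase g₂ g₃ h c s₀ s =
      ((-1 / (12 * c) * ((deriv h s / (h s - c) ^ 2 + 2 * s) -
        (deriv h s₀ / (h s₀ - c) ^ 2 + 2 * s₀)) : ℝ) : ℂ)
  /-- `c = 0` a triple root of `P`. -/
  phase_cusp : cubicP g₂ g₃ c = 0 → g₂ = 0 → g₃ = 0 → ∀ s ∈ I,
    h s ≠ c ∧ phase g₂ g₃ h c s₀ s = ((s : ℂ) + α) ^ 3 / 3 - ((s₀ : ℂ) + α) ^ 3 / 3

/-! ### Null curves in anti-de Sitter space `SL(2, ℝ)` and extremal trajectories -/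

/-- The special linear group `SL(2, ℝ)`. -/
abbrev SL2R := Matrix.SpecialLinearGroup (Fin 2) ℝ

/-- `γ⁻¹ γ'`. -/
def logVelocity (γ : ℝ → SL2R) (s : ℝ) : Matrix (Fin 2) (Fin 2) ℝ :=
  (γ s)⁻¹.1 * Matrix.of fun i j => deriv (fun t => (γ t).1 i j) s

/-- A null curve without flex points. For the bi-invariant metric the covariant derivative of
`γ' = γ X` along `γ` is `γ X'`. -/
structure IsNullCurve (I : Set ℝ) (γ : ℝ → SL2R) : Prop where
  smooth : ∀ i j, ContDiffOn ℝ (⊤ : ℕ∞) (fun s => (γ s).1 i j) I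
  null : ∀ s ∈ I, (logVelocity γ s).det = 0
  noFlex : ∀ s ∈ I, LinearIndependent ℝ
    ![logVelocity γ s, Matrix.of fun i j => deriv (fun t => logVelocity γ t i j) s]

/-- `(Γp, Γm)` is a spinor frame field along `γ = Γp Γm⁻¹`, with canonical arc element `ω ds` and
curvature function `k`: `Γp⁻¹ Γp' = ω (0, 1; k + 1, 0)` and `Γm⁻¹ Γm' = ω (0, 1; k - 1, 0)`. -/
structure IsSpinorFrame (I : Set ℝ) (γ Γp Γm : ℝ → SL2R) (k ω : ℝ → ℝ) : Prop where
  smooth_p : ∀ i j, ContDiffOn ℝ (⊤ : ℕ∞) (fun s => (Γp s).1 i j) I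
  smooth_m : ∀ i j, ContDiffOn ℝ (⊤ : ℕ∞) (fun s => (Γm s).1 i j) I
  smooth_k : ContDiffOn ℝ (⊤ : ℕ∞) k I
  smooth_ω : ContDiffOn ℝ (⊤ : ℕ∞) ω I
  ω_ne : ∀ s ∈ I, ω s ≠ 0
  proj : ∀ s ∈ I, γ s = Γp s * (Γm s)⁻¹
  deriv_p : ∀ s ∈ I, ∀ i j, HasDerivAt (fun t => (Γp t).1 i j)
    (((Γp s).1 * (ω s • !![0, 1; k s + 1, 0])) i j) s
  deriv_m : ∀ s ∈ I, ∀ i j, HasDerivAt (fun t => (Γm t).1 i j)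
    (((Γm s).1 * (ω s • !![0, 1; k s - 1, 0])) i j) s

/-- A smooth variation through null curves without flex points, `-ε < t < ε`, of the curve with
spinor frame `(Γp, Γm)`, given with the spinor frames `Vp t, Vm t`, the curvatures `k t` and
the arc elements `ω t ds`; the curves `Vp t (Vm t)⁻¹` agree with the given one off `[a, b]`. -/
structure IsVariation (I : Set ℝ) (Γp Γm : ℝ → SL2R) (a b ε : ℝ)
    (Vp Vm : ℝ → ℝ → SL2R) (k ω : ℝ → ℝ → ℝ) : Prop where
  smooth_p : ∀ i j, ContDiffOn ℝ (⊤ : ℕ∞) (fun x : ℝ × ℝ => (Vp x.1 x.2).1 i j)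
    (Ioo (-ε) ε ×ˢ I)
  smooth_m : ∀ i j, ContDiffOn ℝ (⊤ : ℕ∞) (fun x : ℝ × ℝ => (Vm x.1 x.2).1 i j)
    (Ioo (-ε) ε ×ˢ I)
  smooth_k : ContDiffOn ℝ (⊤ : ℕ∞) (fun x : ℝ × ℝ => k x.1 x.2) (Ioo (-ε) ε ×ˢ I)
  smooth_ω : ContDiffOn ℝ (⊤ : ℕ∞) (fun x : ℝ × ℝ => ω x.1 x.2) (Ioo (-ε) ε ×ˢ I)
  frame : ∀ t ∈ Ioo (-ε) ε,
    IsSpinorFrame I (fun s => Vp t s * (Vm t s)⁻¹) (Vp t) (Vm t) (k t) (ω t)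
  initial : ∀ s ∈ I, Vp 0 s = Γp s ∧ Vm 0 s = Γm s
  support : ∀ t ∈ Ioo (-ε) ε, ∀ s ∈ I, s ∉ Icc a b →
    Vp t s * (Vm t s)⁻¹ = Γp s * (Γm s)⁻¹

/-- `γ : I → SL(2, ℝ)` is an extremal trajectory with multiplier `m` and curvature function `k`: a
null curve without flex points, parametrized by the natural parameter, with non-constant
curvature `k`, which is a critical point of `∫ (m + k) ω` under compactly supported variations. -/
structure IsExtremalTrajectory (m : ℝ) (I : Set ℝ) (γ : ℝ → SL2R) (k : ℝ → ℝ) : Prop where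
  nullCurve : IsNullCurve I γ
  nonconst : ∃ s₁ ∈ I, ∃ s₂ ∈ I, k s₁ ≠ k s₂
  critical : ∃ Γp Γm : ℝ → SL2R, IsSpinorFrame I γ Γp Γm k (fun _ => 1) ∧
    ∀ (a b ε : ℝ) (Vp Vm : ℝ → ℝ → SL2R) (κ ω : ℝ → ℝ → ℝ),
      a ∈ I → b ∈ I → a < b → 0 < ε → IsVariation I Γp Γm a b ε Vp Vm κ ω →
      HasDerivAt (fun t => ∫ s in a..b, (m + κ t s) * ω t s) 0 0

/-- Equivalence of `γ : I → SL(2, ℝ)` and `γ' : I' → SL(2, ℝ)`. -/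
def EquivalentCurves (I I' : Set ℝ) (γ γ' : ℝ → SL2R) : Prop :=
  ∃ (c : ℝ) (A B : SL2R), ∀ s ∈ I', s + c ∈ I ∧ γ' s = A * γ (s + c) * B⁻¹

/-- The explicit curve `γ(m, h, s₀) = Γ₊ Γ₋⁻¹`, a priori with values in complex matrices. -/
def IsExplicitCurve (m : ℝ) (I : Set ℝ) (g₂ g₃ : ℝ) (h : ℝ → ℝ) (s₀ : ℝ)
    (g : ℝ → Matrix (Fin 2) (Fin 2) ℂ) : Prop :=
  ∃ Γp Γm : ℝ → Matrix (Fin 2) (Fin 2) ℂ,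
    IsExplicitFrame I g₂ g₃ h (m / 3 + 1) s₀ Γp ∧
    IsExplicitFrame I g₂ g₃ h (m / 3 - 1) s₀ Γm ∧
    ∀ s ∈ I, g s = Γp s * (Γm s)⁻¹

/-- A matrix in `SL(2, ℝ)` regarded as a complex matrix. -/
def toComplexMatrix (x : SL2R) : Matrix (Fin 2) (Fin 2) ℂ := x.1.map (fun y : ℝ => (y : ℂ))

end

/-! ### Analytic preliminaries -/

/-! Frames. If Γ' = Γ (0, 1; κ, 0), each entry y of the second column satisfies y'' = κ y. With k =
2 h + m / 3 and c = m / 3 ± 1 one has k ± 1 = 2 h + c, so that this is Lamé's equation y'' = (2 h +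
c) y. When h'² = P(h) it is solved by e^φ √(h - c) and e^(-φ) √(h - c) if μ ≠ 0, and by √(h - c) and
φ √(h - c) if μ = 0 (`lame_of_hasDerivAt`). Up to constant factors the product D R is the Wronskian
matrix of such a pair, hence R(s₀)⁻¹ D(s₀)⁻¹ D R solves the frame equation with value 1 at s₀. At a
zero of h - c the formula breaks down, but the solutions do not: they are the functions σ(z ∓ w) /
σ(z) exp(± z ζ(w)), analytic wherever h is finite, and for μ = 0 a variant with σ'
(`exists_explicitFrame_of_ne`, `exists_explicitFrame_of_eq`). The equation is real and the initial
value is 1, so the frame lies in SL(2, ℝ).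

Weierstrass functions. Multiple roots of P are allowed, so no lattice is used. A germ of σ comes
from the power series of ℘. The addition theorem holds for the germ, since it says that a mixed
logarithmic derivative vanishes (`addition_of_bilinear`), and the duplication formula contained in
it extends the germ to an entire function (`exists_entire_sigma`). The same formula bounds the
growth of σ by exp(C |z|²). If ℘ omitted x, then σ² (℘ - x) would be a zero-free entire function of
that growth, thus the exponential of a quadratic polynomial, and this makes x a multiple root of P
(`exists_wP_eq`). A potential never meets a multiple root, so some ℘(s + α) has the same initial
data and agrees with h.

Variations. For a variation with frames V± the matrices V±⁻¹ ∂V±/∂t satisfy linear equations driven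
by the variations of ω and k. Integration by parts turns the derivative of ∫ (m + k) ω into the
integral of E · d, where E = `eulerLagrange` and d is the difference of the upper right entries of
the two matrices (`IsVariation.hasDerivAt_integral`). Every compactly supported d occurs
(`exists_variation`), so extremality means E = 0. In terms of h this is h''' = 12 h h', which
integrates twice to h'² = P(h). A given extremal trajectory and the explicit curve of its reduced
curvature therefore have frames solving the same linear equations, and these differ by constant left
factors. -/

theorem eq_zero_of_continuousAt_of_punctured {Φ : ℂ → ℂ} {r : ℝ} (hr : 0 < r)
    (hc : ContinuousAt Φ 0) (h : ∀ z ∈ Metric.ball (0 : ℂ) r, z ≠ 0 → Φ z = 0) : Φ 0 = 0 := by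
  have h1 : Filter.Tendsto Φ (nhdsWithin 0 {0}ᶜ) (nhds (Φ 0)) := hc.tendsto.mono_left nhdsWithin_le_nhds
  have h2 : Filter.Tendsto Φ (nhdsWithin 0 {0}ᶜ) (nhds 0) := by
    refine Filter.Tendsto.congr' ?_ tendsto_const_nhds
    filter_upwards [mem_nhdsWithin_of_mem_nhds (Metric.ball_mem_nhds (0 : ℂ) hr),
      self_mem_nhdsWithin] with z hz hz0
    exact (h z hz hz0).symm
  exact tendsto_nhds_unique h1 h2

/-- Two holomorphic functions with vanishing Wronskian are proportional. -/
theorem proportional_of_wronskian_eq_zero {U : Set ℂ} (hU : IsOpen U) (hc : IsPreconnected U)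
    {u v : ℂ → ℂ} (hu : DifferentiableOn ℂ u U) (hv : DifferentiableOn ℂ v U)
    (hW : ∀ z ∈ U, deriv u z * v z = u z * deriv v z) {q : ℂ} (hq : q ∈ U) (hvq : v q ≠ 0) :
    ∀ p ∈ U, u p * v q = u q * v p := by
  have hua := hu.analyticOnNhd hU
  have hva := hv.analyticOnNhd hU
  -- v may vanish elsewhere in U, so the quotient u / v is used near q only; the identity theorem
  -- does the rest.
  have hloc : (fun p => u p * v q) =ᶠ[nhds q] fun p => u q * v p := by
    have h1 : ∀ᶠ z in nhds q, v z ≠ 0 := (hva q hq).continuousAt.eventually_ne hvq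
    obtain ⟨ε, hε, hb⟩ := Metric.eventually_nhds_iff_ball.1 (h1.and (hU.mem_nhds hq))
    have hconst : ∀ z ∈ Metric.ball q ε, u z / v z = u q / v q := by
      intro z hz
      refine (convex_ball q ε).is_const_of_fderivWithin_eq_zero (𝕜 := ℂ) (f := fun z => u z / v z)
        ?_ ?_ hz (Metric.mem_ball_self hε)
      · intro y hy
        exact ((hua y (hb y hy).2).differentiableAt.div (hva y (hb y hy).2).differentiableAt
          (hb y hy).1).differentiableWithinAt
      · intro y hy
        have hd := (hua y (hb y hy).2).differentiableAt.hasDerivAt.fun_div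
          (hva y (hb y hy).2).differentiableAt.hasDerivAt (hb y hy).1
        rw [hW y (hb y hy).2, sub_self, zero_div] at hd
        have := hd.hasFDerivAt.hasFDerivWithinAt (s := Metric.ball q ε)
        rw [this.fderivWithin (Metric.isOpen_ball.uniqueDiffWithinAt hy)]
        ext; simp
    filter_upwards [Metric.ball_mem_nhds q hε] with z hz
    have := hconst z hz
    rwa [div_eq_div_iff (hb z hz).1 hvq] at this
  intro p hp
  exact AnalyticOnNhd.eqOn_of_preconnected_of_eventuallyEq
    (hua.mul analyticOnNhd_const) (analyticOnNhd_const.mul hva) hc hq hloc hp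

/-! ### Derivatives of the functions belonging to a sigma function -/

/-- `σ² ℘`, as a differential polynomial in `σ`. -/
noncomputable def sigmaA (σ : ℂ → ℂ) (z : ℂ) : ℂ := deriv σ z ^ 2 - σ z * deriv (deriv σ) z

/-- `σ³ ℘'`, as a differential polynomial in `σ`. -/
noncomputable def sigmaB (σ : ℂ → ℂ) (z : ℂ) : ℂ :=
  -(σ z ^ 2 * deriv (deriv (deriv σ)) z) + 3 * σ z * deriv σ z * deriv (deriv σ) z
    - 2 * deriv σ z ^ 3

section basics
variable {σ : ℂ → ℂ} {z : ℂ}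

theorem analyticAt_sigmaA (h : AnalyticAt ℂ σ z) : AnalyticAt ℂ (sigmaA σ) z :=
  (h.deriv.pow 2).sub (h.mul h.deriv.deriv)

theorem analyticAt_sigmaB (h : AnalyticAt ℂ σ z) : AnalyticAt ℂ (sigmaB σ) z :=
  ((((h.pow 2).mul h.deriv.deriv.deriv).neg).add (((analyticAt_const (v := (3 : ℂ))).mul h |>.mul
    h.deriv).mul h.deriv.deriv)).sub (analyticAt_const.mul (h.deriv.pow 3))

theorem hasDerivAt_sigmaA (h : AnalyticAt ℂ σ z) : HasDerivAt (sigmaA σ)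
    (deriv σ z * deriv (deriv σ) z - σ z * deriv (deriv (deriv σ)) z) z := by
  have h0 := h.differentiableAt.hasDerivAt
  have h1 := h.deriv.differentiableAt.hasDerivAt
  have h2 := h.deriv.deriv.differentiableAt.hasDerivAt
  refine ((h1.fun_pow 2).fun_sub (h0.fun_mul h2)).congr_deriv ?_
  ring

theorem hasDerivAt_wZeta' (h : AnalyticAt ℂ σ z) (h0 : σ z ≠ 0) :
    HasDerivAt (wZeta σ) (-(sigmaA σ z / σ z ^ 2)) z := by
  refine (h.deriv.differentiableAt.hasDerivAt.fun_div h.differentiableAt.hasDerivAt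
    h0).congr_deriv ?_
  unfold sigmaA
  ring

theorem wP_eq (h : AnalyticAt ℂ σ z) (h0 : σ z ≠ 0) : wP σ z = sigmaA σ z / σ z ^ 2 := by
  unfold wP
  rw [(hasDerivAt_wZeta' h h0).deriv, neg_neg]

theorem hasDerivAt_wZeta (h : AnalyticAt ℂ σ z) (h0 : σ z ≠ 0) :
    HasDerivAt (wZeta σ) (-wP σ z) z := by
  rw [wP_eq h h0]; exact hasDerivAt_wZeta' h h0

theorem hasDerivAt_sigma (h : AnalyticAt ℂ σ z) (h0 : σ z ≠ 0) :
    HasDerivAt σ (wZeta σ z * σ z) z := by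
  unfold wZeta
  rw [div_mul_cancel₀ _ h0]
  exact h.differentiableAt.hasDerivAt

theorem wP_eventuallyEq (h : AnalyticAt ℂ σ z) (h0 : σ z ≠ 0) :
    wP σ =ᶠ[nhds z] fun u => sigmaA σ u / σ u ^ 2 := by
  filter_upwards [h.eventually_analyticAt, h.continuousAt.eventually_ne h0] with u hu hu0
  exact wP_eq hu hu0

theorem analyticAt_wP (h : AnalyticAt ℂ σ z) (h0 : σ z ≠ 0) : AnalyticAt ℂ (wP σ) z :=
  ((analyticAt_sigmaA h).div (h.pow 2) (pow_ne_zero 2 h0)).congr (wP_eventuallyEq h h0).symm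

theorem hasDerivAt_wP (h : AnalyticAt ℂ σ z) (h0 : σ z ≠ 0) :
    HasDerivAt (wP σ) (deriv (wP σ) z) z :=
  (analyticAt_wP h h0).differentiableAt.hasDerivAt

theorem deriv_wP_eq (h : AnalyticAt ℂ σ z) (h0 : σ z ≠ 0) :
    deriv (wP σ) z = sigmaB σ z / σ z ^ 3 := by
  rw [(wP_eventuallyEq h h0).deriv_eq]
  have := (hasDerivAt_sigmaA h).fun_div (h.differentiableAt.hasDerivAt.fun_pow 2) (pow_ne_zero 2 h0)
  rw [this.deriv]
  unfold sigmaA sigmaB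
  field_simp
  push_cast
  ring

end basics

/-! ### Local sigma functions and the addition theorem -/

/-- `σ` has the defining properties of a sigma function with complex invariants on the disc of
radius `r`, in which it has no zero but the origin. -/
structure IsSigmaOn (g₂ g₃ : ℂ) (r : ℝ) (σ : ℂ → ℂ) : Prop where
  pos : 0 < r
  diff : DifferentiableOn ℂ σ (Metric.ball 0 r)
  ne_zero : ∀ z ∈ Metric.ball (0 : ℂ) r, z ≠ 0 → σ z ≠ 0
  odd : ∀ z ∈ Metric.ball (0 : ℂ) r, σ (-z) = -σ z
  deriv_zero : deriv σ 0 = 1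
  ode : ∀ z ∈ Metric.ball (0 : ℂ) r, z ≠ 0 →
    deriv (wP σ) z ^ 2 = 4 * wP σ z ^ 3 - g₂ * wP σ z - g₃
  ode₂ : ∀ z ∈ Metric.ball (0 : ℂ) r, z ≠ 0 → deriv (deriv (wP σ)) z = 6 * wP σ z ^ 2 - g₂ / 2

/-- Put F(z, w) = f(z) g(w) - g(z) f(w). The hypothesis `hbil` is (F_zz - F_ww) F = F_z² - F_w². In
the coordinates p = z + w, q = z - w it becomes G G_pq = G_p G_q: the mixed derivative of log G
vanishes and G is a function of p times a function of q. On the diagonal p = q, that is w = 0, one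
has F = σ², which identifies both factors with σ. -/
theorem addition_of_bilinear {r : ℝ} (hr : 0 < r) {σ f g : ℂ → ℂ}
    (hσ : AnalyticOnNhd ℂ σ (Metric.ball 0 r))
    (hf : AnalyticOnNhd ℂ f (Metric.ball 0 r)) (hg : AnalyticOnNhd ℂ g (Metric.ball 0 r))
    (hfσ : ∀ z ∈ Metric.ball (0 : ℂ) r, f z = σ z ^ 2)
    (hσ0 : σ 0 = 0) (hσne : ∀ z ∈ Metric.ball (0 : ℂ) r, z ≠ 0 → σ z ≠ 0)
    (hg0 : g 0 = 1) (hg1 : deriv g 0 = 0)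
    (hbil : ∀ z ∈ Metric.ball (0 : ℂ) r, ∀ w ∈ Metric.ball (0 : ℂ) r,
      (deriv (deriv f) z * g w - deriv (deriv g) z * f w - f z * deriv (deriv g) w
        + g z * deriv (deriv f) w) * (f z * g w - g z * f w) =
      (deriv f z * g w - deriv g z * f w) ^ 2 - (f z * deriv g w - g z * deriv f w) ^ 2) :
    ∀ z ∈ Metric.ball (0 : ℂ) (r / 2), ∀ w ∈ Metric.ball (0 : ℂ) (r / 2),
      σ (z + w) * σ (z - w) = f z * g w - g z * f w := by
  have hB : IsPreconnected (Metric.ball (0 : ℂ) r) := (convex_ball _ _).isPreconnected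
  have h0 : (0 : ℂ) ∈ Metric.ball (0 : ℂ) r := Metric.mem_ball_self hr
  have hf' : ∀ z ∈ Metric.ball (0 : ℂ) r, deriv f z = 2 * σ z * deriv σ z := by
    intro z hz
    have : f =ᶠ[nhds z] fun z => σ z ^ 2 := by
      filter_upwards [Metric.isOpen_ball.mem_nhds hz] with u hu using hfσ u hu
    rw [this.deriv_eq, ((hσ z hz).differentiableAt.hasDerivAt.fun_pow 2).deriv]
    simp
  have hmem : ∀ p ∈ Metric.ball (0 : ℂ) r, ∀ q ∈ Metric.ball (0 : ℂ) r,
      (p + q) / 2 ∈ Metric.ball (0 : ℂ) r ∧ (p - q) / 2 ∈ Metric.ball (0 : ℂ) r := by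
    intro p hp q hq
    simp only [mem_ball_zero_iff] at *
    constructor <;> rw [norm_div] <;> simp only [RCLike.norm_ofNat]
    · linarith [norm_add_le p q]
    · linarith [norm_sub_le p q]
  have hd : ∀ F : ℂ → ℂ, AnalyticOnNhd ℂ F (Metric.ball 0 r) → ∀ z ∈ Metric.ball (0 : ℂ) r,
      HasDerivAt F (deriv F z) z := fun F hF z hz => (hF z hz).differentiableAt.hasDerivAt
  -- derivatives in `p` and `q`
  have hp1 : ∀ F : ℂ → ℂ, AnalyticOnNhd ℂ F (Metric.ball 0 r) →
      ∀ p ∈ Metric.ball (0 : ℂ) r, ∀ q ∈ Metric.ball (0 : ℂ) r,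
      HasDerivAt (fun p => F ((p + q) / 2)) (deriv F ((p + q) / 2) * (1 / 2)) p ∧
      HasDerivAt (fun p => F ((p - q) / 2)) (deriv F ((p - q) / 2) * (1 / 2)) p ∧
      HasDerivAt (fun q => F ((p + q) / 2)) (deriv F ((p + q) / 2) * (1 / 2)) q ∧
      HasDerivAt (fun q => F ((p - q) / 2)) (deriv F ((p - q) / 2) * (-1 / 2)) q := by
    intro F hF p hp q hq
    have a1 := hd F hF _ (hmem p hp q hq).1
    have a2 := hd F hF _ (hmem p hp q hq).2
    exact ⟨a1.comp p (((hasDerivAt_id p).add_const q).div_const 2),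
      a2.comp p (((hasDerivAt_id p).sub_const q).div_const 2),
      a1.comp q (((hasDerivAt_id q).const_add p).div_const 2),
      a2.comp q (((hasDerivAt_id q).const_sub p).div_const 2)⟩
  -- The expression multiplied by σ(q) is 2 G_q. Since G_q / G does not depend on p, it may be
  -- evaluated at p = q.
  have key1 : ∀ q ∈ Metric.ball (0 : ℂ) r, q ≠ 0 → ∀ p ∈ Metric.ball (0 : ℂ) r,
      ((deriv f ((p + q) / 2) * g ((p - q) / 2) - deriv g ((p + q) / 2) * f ((p - q) / 2)) -
        (f ((p + q) / 2) * deriv g ((p - q) / 2) - g ((p + q) / 2) * deriv f ((p - q) / 2))) * σ q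
      = 2 * deriv σ q * (f ((p + q) / 2) * g ((p - q) / 2) - g ((p + q) / 2) * f ((p - q) / 2)) := by
    intro q hq hq0 p hp
    set N : ℂ → ℂ := fun p =>
      ((deriv f ((p + q) / 2) * g ((p - q) / 2) - deriv g ((p + q) / 2) * f ((p - q) / 2)) -
        (f ((p + q) / 2) * deriv g ((p - q) / 2) - g ((p + q) / 2) * deriv f ((p - q) / 2))) with hN
    set G : ℂ → ℂ := fun p =>
      (f ((p + q) / 2) * g ((p - q) / 2) - g ((p + q) / 2) * f ((p - q) / 2)) with hG
    have hNd : ∀ p ∈ Metric.ball (0 : ℂ) r, HasDerivAt N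
        ((deriv (deriv f) ((p + q) / 2) * g ((p - q) / 2)
          - deriv (deriv g) ((p + q) / 2) * f ((p - q) / 2)
          - f ((p + q) / 2) * deriv (deriv g) ((p - q) / 2)
          + g ((p + q) / 2) * deriv (deriv f) ((p - q) / 2)) * (1 / 2)) p := by
      intro p hp
      have f0 := hp1 f hf p hp q hq
      have g0 := hp1 g hg p hp q hq
      have f1 := hp1 _ hf.deriv p hp q hq
      have g1 := hp1 _ hg.deriv p hp q hq
      refine HasDerivAt.congr_deriv (((f1.1.fun_mul g0.2.1).fun_sub (g1.1.fun_mul f0.2.1)).fun_sub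
        ((f0.1.fun_mul g1.2.1).fun_sub (g0.1.fun_mul f1.2.1))) ?_
      ring
    have hGd : ∀ p ∈ Metric.ball (0 : ℂ) r, HasDerivAt G
        (((deriv f ((p + q) / 2) * g ((p - q) / 2) - deriv g ((p + q) / 2) * f ((p - q) / 2)) +
        (f ((p + q) / 2) * deriv g ((p - q) / 2) - g ((p + q) / 2) * deriv f ((p - q) / 2)))
          * (1 / 2)) p := by
      intro p hp
      have f0 := hp1 f hf p hp q hq
      have g0 := hp1 g hg p hp q hq
      refine HasDerivAt.congr_deriv ((f0.1.fun_mul g0.2.1).fun_sub (g0.1.fun_mul f0.2.1)) ?_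
      ring
    have hGq : G q = σ q ^ 2 := by
      simp only [hG]
      rw [show (q + q) / 2 = q by ring, sub_self, zero_div, hg0, hfσ 0 h0, hσ0, hfσ q hq]
      ring
    have hNq : N q = 2 * σ q * deriv σ q := by
      simp only [hN]
      rw [show (q + q) / 2 = q by ring, sub_self, zero_div, hg0, hfσ 0 h0, hσ0, hf' 0 h0, hσ0,
        hf' q hq, hg1]
      ring
    have := proportional_of_wronskian_eq_zero Metric.isOpen_ball hB (u := N) (v := G)
      (fun p hp => (hNd p hp).differentiableAt.differentiableWithinAt)
      (fun p hp => (hGd p hp).differentiableAt.differentiableWithinAt)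
      (by
        intro p hp
        rw [(hNd p hp).deriv, (hGd p hp).deriv]
        have := hbil _ (hmem p hp q hq).1 _ (hmem p hp q hq).2
        simp only [hN, hG]
        linear_combination (1 / 2) * this) hq (by rw [hGq]; exact pow_ne_zero 2 (hσne q hq hq0)) p hp
    rw [hGq, hNq] at this
    have hne := hσne q hq hq0
    apply mul_left_cancel₀ hne
    linear_combination this
  -- For fixed p the functions G(p, ·) and σ have the same logarithmic derivative; the constant of
  -- proportionality is read off at q = p.
  have key2 : ∀ p ∈ Metric.ball (0 : ℂ) r, p ≠ 0 → ∀ q ∈ Metric.ball (0 : ℂ) r,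
      f ((p + q) / 2) * g ((p - q) / 2) - g ((p + q) / 2) * f ((p - q) / 2) = σ p * σ q := by
    intro p hp hp0 q hq
    set G : ℂ → ℂ := fun q =>
      (f ((p + q) / 2) * g ((p - q) / 2) - g ((p + q) / 2) * f ((p - q) / 2)) with hG
    have hGd : ∀ q ∈ Metric.ball (0 : ℂ) r, HasDerivAt G
        (((deriv f ((p + q) / 2) * g ((p - q) / 2) - deriv g ((p + q) / 2) * f ((p - q) / 2)) -
        (f ((p + q) / 2) * deriv g ((p - q) / 2) - g ((p + q) / 2) * deriv f ((p - q) / 2)))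
          * (1 / 2)) q := by
      intro q hq
      have f0 := hp1 f hf p hp q hq
      have g0 := hp1 g hg p hp q hq
      refine HasDerivAt.congr_deriv ((f0.2.2.1.fun_mul g0.2.2.2).fun_sub (g0.2.2.1.fun_mul f0.2.2.2)) ?_
      ring
    have hGp : G p = σ p ^ 2 := by
      simp only [hG]
      rw [show (p + p) / 2 = p by ring, sub_self, zero_div, hg0, hfσ 0 h0, hσ0, hfσ p hp]
      ring
    have := proportional_of_wronskian_eq_zero Metric.isOpen_ball hB (u := G) (v := σ)
      (fun p hp => (hGd p hp).differentiableAt.differentiableWithinAt)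
      (fun p hp => (hσ p hp).differentiableAt.differentiableWithinAt)
      (by
        intro q hq
        rw [(hGd q hq).deriv]
        by_cases hq0 : q = 0
        · subst hq0
          simp only [hG, add_zero, sub_zero, hσ0]
          ring
        · have := key1 q hq hq0 p hp
          simp only [hG]
          linear_combination (1 / 2) * this) hp (hσne p hp hp0) q hq
    rw [hGp] at this
    apply mul_right_cancel₀ (hσne p hp hp0)
    linear_combination this
  have key3 : ∀ p ∈ Metric.ball (0 : ℂ) r, ∀ q ∈ Metric.ball (0 : ℂ) r,
      f ((p + q) / 2) * g ((p - q) / 2) - g ((p + q) / 2) * f ((p - q) / 2) = σ p * σ q := by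
    intro p hp q hq
    -- The normalization at q = p degenerates for p = 0, where σ vanishes; continuity in p fills the
    -- gap.
    by_cases hp0 : p = 0
    · subst hp0
      have f0 := hp1 f hf 0 h0 q hq
      have g0 := hp1 g hg 0 h0 q hq
      have := eq_zero_of_continuousAt_of_punctured (Φ := fun p =>
        f ((p + q) / 2) * g ((p - q) / 2) - g ((p + q) / 2) * f ((p - q) / 2) - σ p * σ q) hr
        (((f0.1.fun_mul g0.2.1).fun_sub (g0.1.fun_mul f0.2.1)).continuousAt.sub
          ((hσ 0 h0).continuousAt.mul continuousAt_const))
        (fun p hp hp0 => sub_eq_zero.2 (key2 p hp hp0 q hq))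
      exact sub_eq_zero.1 this
    · exact key2 p hp hp0 q hq
  intro z hz w hw
  simp only [mem_ball_zero_iff] at hz hw
  have := key3 (z + w) (by simp only [mem_ball_zero_iff]; linarith [norm_add_le z w]) (z - w)
    (by simp only [mem_ball_zero_iff]; linarith [norm_sub_le z w])
  rw [← this]
  ring_nf

theorem deriv_deriv_zero_of_odd {σ : ℂ → ℂ} (h : ∀ᶠ z in nhds 0, σ (-z) = -σ z) :
    deriv (deriv σ) 0 = 0 := by
  have h1 : ∀ᶠ z in nhds (0 : ℂ), deriv σ (-z) = deriv σ z := by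
    filter_upwards [h.eventually_nhds] with z hz
    have := Filter.EventuallyEq.deriv_eq (f₁ := fun z => σ (-z)) (f := fun z => -σ z) hz
    rw [deriv_comp_neg, deriv.fun_neg] at this
    exact neg_injective this
  have := Filter.EventuallyEq.deriv_eq (f₁ := fun z => deriv σ (-z)) (f := fun z => deriv σ z) h1
  rw [deriv_comp_neg, neg_zero] at this
  exact self_eq_neg.1 this.symm

namespace IsSigmaOn
variable {g₂ g₃ : ℂ} {r : ℝ} {σ : ℂ → ℂ}

theorem analyticOnNhd (h : IsSigmaOn g₂ g₃ r σ) : AnalyticOnNhd ℂ σ (Metric.ball 0 r) :=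
  h.diff.analyticOnNhd Metric.isOpen_ball

theorem zero_mem (h : IsSigmaOn g₂ g₃ r σ) : (0 : ℂ) ∈ Metric.ball (0 : ℂ) r :=
  Metric.mem_ball_self h.pos

theorem map_zero (h : IsSigmaOn g₂ g₃ r σ) : σ 0 = 0 := by
  have := h.odd 0 h.zero_mem
  rw [neg_zero] at this
  exact self_eq_neg.1 this

theorem deriv_deriv_zero (h : IsSigmaOn g₂ g₃ r σ) : deriv (deriv σ) 0 = 0 :=
  deriv_deriv_zero_of_odd (by
    filter_upwards [Metric.ball_mem_nhds (0 : ℂ) h.pos] with z hz using h.odd z hz)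

/-- The addition theorem for a local sigma function. -/
theorem addition (h : IsSigmaOn g₂ g₃ r σ) :
    ∀ z ∈ Metric.ball (0 : ℂ) (r / 2), ∀ w ∈ Metric.ball (0 : ℂ) (r / 2),
      σ (z + w) * σ (z - w) = σ z ^ 2 * sigmaA σ w - sigmaA σ z * σ w ^ 2 := by
  have hσ := h.analyticOnNhd
  have hf : AnalyticOnNhd ℂ (fun z => σ z ^ 2) (Metric.ball 0 r) := hσ.pow 2
  have hg : AnalyticOnNhd ℂ (sigmaA σ) (Metric.ball 0 r) := fun z hz => analyticAt_sigmaA (hσ z hz)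
  -- the derivatives on the punctured disc
  have hU : IsOpen (Metric.ball (0 : ℂ) r ∩ {0}ᶜ) := Metric.isOpen_ball.inter isOpen_compl_singleton
  have dσ : ∀ z ∈ Metric.ball (0 : ℂ) r ∩ {0}ᶜ, HasDerivAt σ (wZeta σ z * σ z) z :=
    fun z hz => hasDerivAt_sigma (hσ z hz.1) (h.ne_zero z hz.1 hz.2)
  have dζ : ∀ z ∈ Metric.ball (0 : ℂ) r ∩ {0}ᶜ, HasDerivAt (wZeta σ) (-wP σ z) z :=
    fun z hz => hasDerivAt_wZeta (hσ z hz.1) (h.ne_zero z hz.1 hz.2)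
  have dx : ∀ z ∈ Metric.ball (0 : ℂ) r ∩ {0}ᶜ, HasDerivAt (wP σ) (deriv (wP σ) z) z :=
    fun z hz => hasDerivAt_wP (hσ z hz.1) (h.ne_zero z hz.1 hz.2)
  have dy : ∀ z ∈ Metric.ball (0 : ℂ) r ∩ {0}ᶜ,
      HasDerivAt (deriv (wP σ)) (6 * wP σ z ^ 2 - g₂ / 2) z := by
    intro z hz
    rw [← h.ode₂ z hz.1 hz.2]
    exact (analyticAt_wP (hσ z hz.1) (h.ne_zero z hz.1 hz.2)).deriv.differentiableAt.hasDerivAt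
  have ef1 : ∀ z ∈ Metric.ball (0 : ℂ) r ∩ {0}ᶜ,
      deriv (fun z => σ z ^ 2) z = 2 * wZeta σ z * σ z ^ 2 := by
    intro z hz
    rw [((dσ z hz).fun_pow 2).deriv]
    push_cast
    ring
  have ef2 : ∀ z ∈ Metric.ball (0 : ℂ) r ∩ {0}ᶜ, deriv (deriv (fun z => σ z ^ 2)) z =
      (4 * wZeta σ z ^ 2 - 2 * wP σ z) * σ z ^ 2 := by
    intro z hz
    have : deriv (fun z => σ z ^ 2) =ᶠ[nhds z] fun z => 2 * wZeta σ z * σ z ^ 2 := by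
      filter_upwards [hU.mem_nhds hz] with u hu using ef1 u hu
    rw [this.deriv_eq, (((dζ z hz).const_mul 2).fun_mul ((dσ z hz).fun_pow 2)).deriv]
    push_cast
    ring
  have eg0 : ∀ z ∈ Metric.ball (0 : ℂ) r ∩ {0}ᶜ, sigmaA σ z = wP σ z * σ z ^ 2 := by
    intro z hz
    have h0 := h.ne_zero z hz.1 hz.2
    rw [wP_eq (hσ z hz.1) h0]
    field_simp
  have eg1 : ∀ z ∈ Metric.ball (0 : ℂ) r ∩ {0}ᶜ, deriv (sigmaA σ) z =
      (deriv (wP σ) z + 2 * wZeta σ z * wP σ z) * σ z ^ 2 := by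
    intro z hz
    have : sigmaA σ =ᶠ[nhds z] fun z => wP σ z * σ z ^ 2 := by
      filter_upwards [hU.mem_nhds hz] with u hu using eg0 u hu
    rw [this.deriv_eq, ((dx z hz).fun_mul ((dσ z hz).fun_pow 2)).deriv]
    push_cast
    ring
  have eg2 : ∀ z ∈ Metric.ball (0 : ℂ) r ∩ {0}ᶜ, deriv (deriv (sigmaA σ)) z =
      ((4 * wZeta σ z ^ 2 - 2 * wP σ z) * wP σ z + 4 * wZeta σ z * deriv (wP σ) z
        + 6 * wP σ z ^ 2 - g₂ / 2) * σ z ^ 2 := by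
    intro z hz
    have : deriv (sigmaA σ) =ᶠ[nhds z] fun z =>
        (deriv (wP σ) z + 2 * wZeta σ z * wP σ z) * σ z ^ 2 := by
      filter_upwards [hU.mem_nhds hz] with u hu using eg1 u hu
    rw [this.deriv_eq, (((dy z hz).fun_add (((dζ z hz).const_mul 2).fun_mul (dx z hz))).fun_mul
      ((dσ z hz).fun_pow 2)).deriv]
    push_cast
    ring
  -- Here f = σ² and g = σ² ℘. Once ℘'' is replaced by 6 ℘² - g₂ / 2, the bilinear identity is σ(z)⁴
  -- σ(w)⁴ times the difference of the first-order equations at w and at z.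
  have hbil : ∀ z ∈ Metric.ball (0 : ℂ) r, z ≠ 0 → ∀ w ∈ Metric.ball (0 : ℂ) r, w ≠ 0 →
      (deriv (deriv (fun z => σ z ^ 2)) z * sigmaA σ w - deriv (deriv (sigmaA σ)) z * σ w ^ 2
        - σ z ^ 2 * deriv (deriv (sigmaA σ)) w
        + sigmaA σ z * deriv (deriv (fun z => σ z ^ 2)) w)
          * (σ z ^ 2 * sigmaA σ w - sigmaA σ z * σ w ^ 2) =
      (deriv (fun z => σ z ^ 2) z * sigmaA σ w - deriv (sigmaA σ) z * σ w ^ 2) ^ 2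
        - (σ z ^ 2 * deriv (sigmaA σ) w - sigmaA σ z * deriv (fun z => σ z ^ 2) w) ^ 2 := by
    intro z hz hz0 w hw hw0
    rw [ef1 z ⟨hz, hz0⟩, ef2 z ⟨hz, hz0⟩, eg0 z ⟨hz, hz0⟩, eg1 z ⟨hz, hz0⟩, eg2 z ⟨hz, hz0⟩,
      ef1 w ⟨hw, hw0⟩, ef2 w ⟨hw, hw0⟩, eg0 w ⟨hw, hw0⟩, eg1 w ⟨hw, hw0⟩, eg2 w ⟨hw, hw0⟩]
    linear_combination σ z ^ 4 * σ w ^ 4 * (h.ode w hw hw0 - h.ode z hz hz0)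
  -- The punctures are removed one variable at a time: both sides are polynomials in σ and its
  -- derivatives, hence continuous at 0.
  have hbil1 : ∀ z ∈ Metric.ball (0 : ℂ) r, ∀ w ∈ Metric.ball (0 : ℂ) r, w ≠ 0 →
      (deriv (deriv (fun z => σ z ^ 2)) z * sigmaA σ w - deriv (deriv (sigmaA σ)) z * σ w ^ 2
        - σ z ^ 2 * deriv (deriv (sigmaA σ)) w
        + sigmaA σ z * deriv (deriv (fun z => σ z ^ 2)) w)
          * (σ z ^ 2 * sigmaA σ w - sigmaA σ z * σ w ^ 2) =
      (deriv (fun z => σ z ^ 2) z * sigmaA σ w - deriv (sigmaA σ) z * σ w ^ 2) ^ 2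
        - (σ z ^ 2 * deriv (sigmaA σ) w - sigmaA σ z * deriv (fun z => σ z ^ 2) w) ^ 2 := by
    intro z hz w hw hw0
    by_cases hz0 : z = 0
    · subst hz0
      have c0 := (hf 0 hz).continuousAt
      have c1 := (hf 0 hz).deriv.continuousAt
      have c2 := (hf 0 hz).deriv.deriv.continuousAt
      have d0 := (hg 0 hz).continuousAt
      have d1 := (hg 0 hz).deriv.continuousAt
      have d2 := (hg 0 hz).deriv.deriv.continuousAt
      refine sub_eq_zero.1 (eq_zero_of_continuousAt_of_punctured h.pos ?_
        (fun z hz hz0 => sub_eq_zero.2 (hbil z hz hz0 w hw hw0)))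
      fun_prop
    · exact hbil z hz hz0 w hw hw0
  refine addition_of_bilinear h.pos hσ hf hg (fun z _ => rfl) h.map_zero h.ne_zero ?_ ?_ ?_
  · simp [sigmaA, h.map_zero, h.deriv_zero]
  · rw [(hasDerivAt_sigmaA (hσ 0 h.zero_mem)).deriv, h.map_zero, h.deriv_deriv_zero]
    ring
  · intro z hz w hw
    by_cases hw0 : w = 0
    · subst hw0
      have c0 := (hf 0 hw).continuousAt
      have c1 := (hf 0 hw).deriv.continuousAt
      have c2 := (hf 0 hw).deriv.deriv.continuousAt
      have d0 := (hg 0 hw).continuousAt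
      have d1 := (hg 0 hw).deriv.continuousAt
      have d2 := (hg 0 hw).deriv.deriv.continuousAt
      refine sub_eq_zero.1 (eq_zero_of_continuousAt_of_punctured h.pos ?_
        (fun w hw hw0 => sub_eq_zero.2 (hbil1 z hz w hw hw0)))
      fun_prop
    · exact hbil1 z hz w hw hw0

/-- The duplication formula for a local sigma function. -/
theorem duplication (h : IsSigmaOn g₂ g₃ r σ) :
    ∀ z ∈ Metric.ball (0 : ℂ) (r / 2), σ (2 * z) = -(σ z * sigmaB σ z) := by
  intro z hz
  have hσ := h.analyticOnNhd
  have hz' : ‖z‖ < r / 2 := by simpa using hz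
  have hzr : z ∈ Metric.ball (0 : ℂ) r := by
    simp only [mem_ball_zero_iff]; linarith [h.pos]
  have h2z : z + z ∈ Metric.ball (0 : ℂ) r := by
    simp only [mem_ball_zero_iff]; linarith [norm_add_le z z]
  -- The addition theorem is differentiated in w at w = z, where σ(z - w) vanishes with derivative
  -- -1.
  have e : (fun w => σ (z + w) * σ (z - w)) =ᶠ[nhds z]
      fun w => σ z ^ 2 * sigmaA σ w - sigmaA σ z * σ w ^ 2 := by
    filter_upwards [Metric.isOpen_ball.mem_nhds hz] with w hw using h.addition z hz w hw
  have d1 := (HasDerivAt.comp z (hσ _ h2z).differentiableAt.hasDerivAt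
    ((hasDerivAt_id z).const_add z))
  have h0 : AnalyticAt ℂ σ (z - z) := by rw [sub_self]; exact hσ 0 h.zero_mem
  have d2 := (HasDerivAt.comp z h0.differentiableAt.hasDerivAt ((hasDerivAt_id z).const_sub z))
  have d3 := ((hasDerivAt_sigmaA (hσ z hzr)).const_mul (σ z ^ 2)).fun_sub
    (((hσ z hzr).differentiableAt.hasDerivAt.fun_pow 2).const_mul (sigmaA σ z))
  have := (d1.fun_mul d2).unique (d3.congr_of_eventuallyEq e)
  simp only [Function.comp, sub_self, h.map_zero, h.deriv_zero, mul_zero, zero_add] at this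
  rw [two_mul]
  unfold sigmaA at this
  unfold sigmaB
  push_cast at this
  linear_combination -this

end IsSigmaOn

/-! ### The behaviour of `℘` at the zeros of `σ` -/

theorem exists_factor_at {σ : ℂ → ℂ} {z₀ : ℂ} (h : AnalyticAt ℂ σ z₀)
    (hne : ¬ ∀ᶠ z in nhds z₀, σ z = 0) :
    ∃ (k : ℕ) (e : ℂ → ℂ) (r : ℝ), 0 < r ∧ AnalyticOnNhd ℂ e (Metric.ball z₀ r) ∧
      (∀ z ∈ Metric.ball z₀ r, e z ≠ 0) ∧ ∀ z ∈ Metric.ball z₀ r, σ z = (z - z₀) ^ k * e z := by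
  obtain ⟨k, e, he, he0, hs⟩ := h.exists_eventuallyEq_pow_smul_nonzero_iff.2 hne
  obtain ⟨r, hr, hb⟩ := Metric.eventually_nhds_iff_ball.1
    ((he.eventually_analyticAt.and (he.continuousAt.eventually_ne he0)).and hs)
  exact ⟨k, e, r, hr, fun z hz => (hb z hz).1.1, fun z hz => (hb z hz).1.2,
    fun z hz => by simpa using (hb z hz).2⟩

theorem wP_of_factor {σ e : ℂ → ℂ} {z₀ : ℂ} {k : ℕ} {r : ℝ}
    (he : AnalyticOnNhd ℂ e (Metric.ball z₀ r)) (hne : ∀ z ∈ Metric.ball z₀ r, e z ≠ 0)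
    (hs : ∀ z ∈ Metric.ball z₀ r, σ z = (z - z₀) ^ k * e z) :
    ∀ z ∈ Metric.ball z₀ r, z ≠ z₀ →
      wZeta σ z = k / (z - z₀) + wZeta e z ∧
      wP σ z = k / (z - z₀) ^ 2 + wP e z ∧
      deriv (wP σ) z = -2 * k / (z - z₀) ^ 3 + deriv (wP e) z := by
  have hU : IsOpen (Metric.ball z₀ r ∩ {z₀}ᶜ) := Metric.isOpen_ball.inter isOpen_compl_singleton
  have e1 : ∀ z ∈ Metric.ball z₀ r ∩ {z₀}ᶜ, wZeta σ z = k / (z - z₀) + wZeta e z := by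
    intro z hz
    have hz0 : z - z₀ ≠ 0 := sub_ne_zero.2 hz.2
    have hez := hne z hz.1
    have ev : σ =ᶠ[nhds z] fun z => (z - z₀) ^ k * e z := by
      filter_upwards [Metric.isOpen_ball.mem_nhds hz.1] with u hu using hs u hu
    have hd := (((hasDerivAt_id z).sub_const z₀).fun_pow k).fun_mul
      (he z hz.1).differentiableAt.hasDerivAt
    unfold wZeta
    rw [ev.deriv_eq, hs z hz.1]
    simp only [id] at hd
    rw [hd.deriv]
    rcases k with _ | k
    · simp
    · simp only [Nat.add_sub_cancel, pow_succ]
      field_simp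
  have e2 : ∀ z ∈ Metric.ball z₀ r ∩ {z₀}ᶜ, wP σ z = k / (z - z₀) ^ 2 + wP e z := by
    intro z hz
    have hz0 : z - z₀ ≠ 0 := sub_ne_zero.2 hz.2
    have ev : wZeta σ =ᶠ[nhds z] fun z => k / (z - z₀) + wZeta e z := by
      filter_upwards [hU.mem_nhds hz] with u hu using e1 u hu
    have hd := ((hasDerivAt_const z (k : ℂ)).fun_div ((hasDerivAt_id z).sub_const z₀) hz0).fun_add
      (hasDerivAt_wZeta (he z hz.1) (hne z hz.1))
    unfold wP at hd ⊢
    rw [ev.deriv_eq]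
    simp only [id] at hd
    rw [hd.deriv]
    ring
  intro z hz hzz
  refine ⟨e1 z ⟨hz, hzz⟩, e2 z ⟨hz, hzz⟩, ?_⟩
  have hz0 : z - z₀ ≠ 0 := sub_ne_zero.2 hzz
  have ev : wP σ =ᶠ[nhds z] fun z => k / (z - z₀) ^ 2 + wP e z := by
    filter_upwards [hU.mem_nhds ⟨hz, hzz⟩] with u hu using e2 u hu
  have hd := ((hasDerivAt_const z (k : ℂ)).fun_div (((hasDerivAt_id z).sub_const z₀).fun_pow 2)
    (pow_ne_zero 2 hz0)).fun_add (hasDerivAt_wP (he z hz) (hne z hz))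
  rw [ev.deriv_eq]
  simp only [id] at hd
  rw [hd.deriv]
  field_simp
  push_cast
  ring

/-- The last identity turns σ''(0) = 0, a consequence of oddness, into e'(0) = 0. This fixes the
constant of integration of ζ in the uniqueness proof. -/
theorem exists_factor_zero {σ : ℂ → ℂ} (h : AnalyticAt ℂ σ 0) (h0 : σ 0 = 0)
    (h1 : deriv σ 0 = 1) :
    ∃ (e : ℂ → ℂ) (r : ℝ), 0 < r ∧ AnalyticOnNhd ℂ e (Metric.ball 0 r) ∧
      (∀ z ∈ Metric.ball 0 r, e z ≠ 0) ∧ (∀ z ∈ Metric.ball 0 r, σ z = z * e z) ∧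
      e 0 = 1 ∧ deriv (deriv σ) 0 = 2 * deriv e 0 := by
  have hne : ¬ ∀ᶠ z in nhds 0, σ z = 0 := by
    intro hz
    have := Filter.EventuallyEq.deriv_eq (f₁ := σ) (f := fun _ => (0 : ℂ)) hz
    rw [h1] at this
    simp at this
  obtain ⟨k, e, r, hr, he, hen, hs⟩ := exists_factor_at h hne
  simp only [sub_zero] at hs
  have hm : (0 : ℂ) ∈ Metric.ball (0 : ℂ) r := Metric.mem_ball_self hr
  have hd : ∀ z ∈ Metric.ball (0 : ℂ) r,
      HasDerivAt σ (k * z ^ (k - 1) * e z + z ^ k * deriv e z) z := by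
    intro z hz
    have ev : σ =ᶠ[nhds z] fun z => z ^ k * e z := by
      filter_upwards [Metric.isOpen_ball.mem_nhds hz] with u hu using hs u hu
    exact (((hasDerivAt_pow k z).fun_mul
      (he z hz).differentiableAt.hasDerivAt).congr_of_eventuallyEq ev)
  have hk : k = 1 := by
    rcases k with _ | _ | k
    · have := hs 0 hm
      rw [h0] at this
      simp at this
      exact absurd this.symm (hen 0 hm)
    · rfl
    · have := (hd 0 hm).deriv
      rw [h1] at this
      simp at this
  subst hk
  simp only [Nat.cast_one, Nat.sub_self, pow_zero, one_mul, pow_one] at hd hs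
  refine ⟨e, r, hr, he, hen, hs, ?_, ?_⟩
  · have := (hd 0 hm).deriv
    rw [h1] at this
    simpa using this.symm
  · have ev : deriv σ =ᶠ[nhds 0] fun z => e z + z * deriv e z := by
      filter_upwards [Metric.isOpen_ball.mem_nhds hm] with u hu using (hd u hu).deriv
    rw [ev.deriv_eq, ((he 0 hm).differentiableAt.hasDerivAt.fun_add ((hasDerivAt_id' (0 : ℂ)).fun_mul
      (he 0 hm).deriv.differentiableAt.hasDerivAt)).deriv]
    simp
    ring

/-! ### Uniqueness of germs of sigma functions -/

/-- Subtract the equations and write q₁ - q₂ = zⁿ e with e(0) ≠ 0. The terms of lowest order give (4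
n + 12) e(0) = 0, impossible for n ≥ 0. The resonant exponent -3 belongs to the translations of z⁻²
and is excluded by regularity at 0. -/
theorem regular_part_unique {g₂ g₃ : ℂ} {q₁ q₂ : ℂ → ℂ} (h₁ : AnalyticAt ℂ q₁ 0)
    (h₂ : AnalyticAt ℂ q₂ 0)
    (o₁ : ∀ᶠ z in nhdsWithin 0 {0}ᶜ, (-2 / z ^ 3 + deriv q₁ z) ^ 2 =
      4 * (1 / z ^ 2 + q₁ z) ^ 3 - g₂ * (1 / z ^ 2 + q₁ z) - g₃)
    (o₂ : ∀ᶠ z in nhdsWithin 0 {0}ᶜ, (-2 / z ^ 3 + deriv q₂ z) ^ 2 =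
      4 * (1 / z ^ 2 + q₂ z) ^ 3 - g₂ * (1 / z ^ 2 + q₂ z) - g₃) :
    q₁ =ᶠ[nhds 0] q₂ := by
  by_contra hcon
  have hd : AnalyticAt ℂ (fun z => q₁ z - q₂ z) 0 := h₁.fun_sub h₂
  have hne : ¬ ∀ᶠ z in nhds 0, (fun z => q₁ z - q₂ z) z = 0 := fun h =>
    hcon (h.mono fun z hz => sub_eq_zero.1 hz)
  obtain ⟨n, e, r, hr, he, hen, hs⟩ := exists_factor_at hd hne
  simp only [sub_zero] at hs
  have hm : (0 : ℂ) ∈ Metric.ball (0 : ℂ) r := Metric.mem_ball_self hr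
  -- The difference of the two equations, multiplied by z⁴ and divided by zⁿ, so that every term is
  -- regular at 0.
  have key : ∀ᶠ z in nhdsWithin 0 {0}ᶜ,
      (-4 * (n * e z + z * deriv e z) + z ^ 3 * (deriv q₁ z + deriv q₂ z)
        * (n * e z + z * deriv e z)) - e z * (12 + 12 * z ^ 2 * (q₁ z + q₂ z)
        + 4 * z ^ 4 * (q₁ z ^ 2 + q₁ z * q₂ z + q₂ z ^ 2) - g₂ * z ^ 4) = 0 := by
    filter_upwards [o₁, o₂, self_mem_nhdsWithin,
      mem_nhdsWithin_of_mem_nhds (Metric.isOpen_ball.mem_nhds hm),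
      mem_nhdsWithin_of_mem_nhds h₁.eventually_analyticAt,
      mem_nhdsWithin_of_mem_nhds h₂.eventually_analyticAt] with z e1 e2 hz0 hzb a1 a2
    have hz0 : z ≠ 0 := hz0
    have ev : (fun z => q₁ z - q₂ z) =ᶠ[nhds z] fun z => z ^ n * e z := by
      filter_upwards [Metric.isOpen_ball.mem_nhds hzb] with u hu using hs u hu
    have d1 := (AnalyticAt.differentiableAt a1).hasDerivAt.fun_sub
      (AnalyticAt.differentiableAt a2).hasDerivAt
    have d2 := ((hasDerivAt_pow n z).fun_mul
      (he z hzb).differentiableAt.hasDerivAt).congr_of_eventuallyEq ev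
    have hdd := d1.unique d2
    have hzn : z * (deriv q₁ z - deriv q₂ z) = z ^ n * (n * e z + z * deriv e z) := by
      rw [hdd]
      rcases n with _ | n
      · simp
      · simp only [Nat.add_sub_cancel, pow_succ]; ring
    have hsz := hs z hzb
    apply mul_left_cancel₀ (pow_ne_zero n hz0)
    field_simp at e1 e2
    have e1' := e1
    have e2' := e2
    have h6 : z ^ 2 ≠ 0 := pow_ne_zero 2 hz0
    have : z ^ 2 * ((-4 * (z * (deriv q₁ z - deriv q₂ z)) + z ^ 3 * (deriv q₁ z + deriv q₂ z)
        * (z * (deriv q₁ z - deriv q₂ z))) - (q₁ z - q₂ z) * (12 + 12 * z ^ 2 * (q₁ z + q₂ z)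
        + 4 * z ^ 4 * (q₁ z ^ 2 + q₁ z * q₂ z + q₂ z ^ 2) - g₂ * z ^ 4)) = 0 := by
      linear_combination e1 - e2
    rw [hzn, hsz] at this
    have h7 := (mul_eq_zero.1 this).resolve_left h6
    rw [mul_zero]
    linear_combination h7
  have hlim : ContinuousAt (fun z => (-4 * (n * e z + z * deriv e z)
      + z ^ 3 * (deriv q₁ z + deriv q₂ z)
        * (n * e z + z * deriv e z)) - e z * (12 + 12 * z ^ 2 * (q₁ z + q₂ z)
        + 4 * z ^ 4 * (q₁ z ^ 2 + q₁ z * q₂ z + q₂ z ^ 2) - g₂ * z ^ 4)) 0 := by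
    have c1 := (he 0 hm).continuousAt
    have c2 := (he 0 hm).deriv.continuousAt
    have c3 := h₁.continuousAt
    have c4 := h₂.continuousAt
    have c5 := h₁.deriv.continuousAt
    have c6 := h₂.deriv.continuousAt
    fun_prop
  have h0 := tendsto_nhds_unique (hlim.tendsto.mono_left nhdsWithin_le_nhds)
    (Filter.Tendsto.congr' (Filter.EventuallyEq.symm key) tendsto_const_nhds)
  simp only [zero_mul, add_zero, ne_eq, OfNat.ofNat_ne_zero, not_false_eq_true, zero_pow,
    mul_zero, sub_zero] at h0
  have hn : (4 * (n : ℂ) + 12) * e 0 = 0 := by linear_combination -h0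
  rcases mul_eq_zero.1 hn with h | h
  · have : ((4 * n + 12 : ℕ) : ℂ) = 0 := by push_cast; exact h
    rw [Nat.cast_eq_zero] at this
    omega
  · exact hen 0 hm h

/-- With σᵢ = z eᵢ, uniqueness passes from ℘ to ζ and from ζ to σ by two integrations, whose
constants are fixed by σ''(0) = 0 and σ'(0) = 1. -/
theorem sigma_germ_unique {g₂ g₃ : ℂ} {σ₁ σ₂ : ℂ → ℂ} (h₁ : AnalyticAt ℂ σ₁ 0)
    (h₂ : AnalyticAt ℂ σ₂ 0) (z₁ : σ₁ 0 = 0) (z₂ : σ₂ 0 = 0) (d₁ : deriv σ₁ 0 = 1)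
    (d₂ : deriv σ₂ 0 = 1) (dd₁ : deriv (deriv σ₁) 0 = 0) (dd₂ : deriv (deriv σ₂) 0 = 0)
    (o₁ : ∀ᶠ z in nhdsWithin 0 {0}ᶜ, deriv (wP σ₁) z ^ 2 =
      4 * wP σ₁ z ^ 3 - g₂ * wP σ₁ z - g₃)
    (o₂ : ∀ᶠ z in nhdsWithin 0 {0}ᶜ, deriv (wP σ₂) z ^ 2 =
      4 * wP σ₂ z ^ 3 - g₂ * wP σ₂ z - g₃) : σ₁ =ᶠ[nhds 0] σ₂ := by
  obtain ⟨e₁, r₁, hr₁, he₁, hn₁, hs₁, v₁, de₁⟩ := exists_factor_zero h₁ z₁ d₁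
  obtain ⟨e₂, r₂, hr₂, he₂, hn₂, hs₂, v₂, de₂⟩ := exists_factor_zero h₂ z₂ d₂
  have hm₁ : (0 : ℂ) ∈ Metric.ball (0 : ℂ) r₁ := Metric.mem_ball_self hr₁
  have hm₂ : (0 : ℂ) ∈ Metric.ball (0 : ℂ) r₂ := Metric.mem_ball_self hr₂
  have f₁ := wP_of_factor (k := 1) (z₀ := 0) (σ := σ₁) he₁ hn₁ (by simpa using hs₁)
  have f₂ := wP_of_factor (k := 1) (z₀ := 0) (σ := σ₂) he₂ hn₂ (by simpa using hs₂)
  have hq : wP e₁ =ᶠ[nhds 0] wP e₂ := by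
    refine regular_part_unique (g₂ := g₂) (g₃ := g₃) (analyticAt_wP (he₁ 0 hm₁) (hn₁ 0 hm₁))
      (analyticAt_wP (he₂ 0 hm₂) (hn₂ 0 hm₂)) ?_ ?_
    · filter_upwards [o₁, self_mem_nhdsWithin,
        mem_nhdsWithin_of_mem_nhds (Metric.isOpen_ball.mem_nhds hm₁)] with z ho hz0 hzb
      obtain ⟨-, b, c⟩ := f₁ z hzb hz0
      simp only [sub_zero, Nat.cast_one, mul_one] at b c
      rw [b, c] at ho
      exact ho
    · filter_upwards [o₂, self_mem_nhdsWithin,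
        mem_nhdsWithin_of_mem_nhds (Metric.isOpen_ball.mem_nhds hm₂)] with z ho hz0 hzb
      obtain ⟨-, b, c⟩ := f₂ z hzb hz0
      simp only [sub_zero, Nat.cast_one, mul_one] at b c
      rw [b, c] at ho
      exact ho
  obtain ⟨r, hr, hb⟩ := Metric.eventually_nhds_iff_ball.1
    ((hq.and (Metric.isOpen_ball.mem_nhds hm₁)).and (Metric.isOpen_ball.mem_nhds hm₂))
  have hm : (0 : ℂ) ∈ Metric.ball (0 : ℂ) r := Metric.mem_ball_self hr
  have hB : IsPreconnected (Metric.ball (0 : ℂ) r) := (convex_ball _ _).isPreconnected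
  have hζ : ∀ z ∈ Metric.ball (0 : ℂ) r, wZeta e₁ z - wZeta e₂ z = 0 := by
    intro z hz
    have hd : ∀ u ∈ Metric.ball (0 : ℂ) r, HasDerivAt (fun z => wZeta e₁ z - wZeta e₂ z) 0 u := by
      intro u hu
      obtain ⟨⟨a, b⟩, c⟩ := hb u hu
      refine ((hasDerivAt_wZeta (he₁ u b) (hn₁ u b)).fun_sub
        (hasDerivAt_wZeta (he₂ u c) (hn₂ u c))).congr_deriv ?_
      rw [a]; ring
    have := Metric.isOpen_ball.is_const_of_deriv_eq_zero hB
      (fun u hu => (hd u hu).differentiableAt.differentiableWithinAt)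
      (fun u hu => (hd u hu).deriv) hz hm
    rw [this]
    unfold wZeta
    rw [dd₁] at de₁
    rw [dd₂] at de₂
    have a1 : deriv e₁ 0 = 0 := by linear_combination -de₁ / 2
    have a2 : deriv e₂ 0 = 0 := by linear_combination -de₂ / 2
    rw [a1, a2]; simp
  have := proportional_of_wronskian_eq_zero Metric.isOpen_ball hB (u := e₁) (v := e₂)
    (fun u hu => (he₁ u (hb u hu).1.2).differentiableAt.differentiableWithinAt)
    (fun u hu => (he₂ u (hb u hu).2).differentiableAt.differentiableWithinAt)
    (by
      intro u hu
      have h := hζ u hu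
      have a1 := hn₁ u (hb u hu).1.2
      have a2 := hn₂ u (hb u hu).2
      unfold wZeta at h
      field_simp at h
      linear_combination h) hm (hn₂ 0 hm₂)
  filter_upwards [Metric.ball_mem_nhds (0 : ℂ) hr] with z hz
  have h3 := this z hz
  rw [v₁, v₂] at h3
  rw [hs₁ z (hb z hz).1.2, hs₂ z (hb z hz).2]
  linear_combination z * h3

/-! ### Local existence of sigma functions -/

theorem hasDerivAt_tsum_powers {a : ℕ → ℂ} {ρ : ℝ} (hρ : 0 < ρ)
    (h : Summable fun k : ℕ => ‖a k‖ * k * ρ ^ k) {t : ℂ} (ht : t ∈ Metric.ball (0 : ℂ) ρ) :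
    HasDerivAt (fun t => ∑' k, a k * t ^ k) (∑' k : ℕ, a k * (k * t ^ (k - 1))) t := by
  have hu : Summable fun k : ℕ => ‖a k‖ * k * ρ ^ (k - 1) := by
    have := h.mul_left ρ⁻¹
    refine this.congr fun k => ?_
    rcases k with _ | k
    · simp
    · simp only [Nat.add_sub_cancel, pow_succ]; field_simp
  refine hasDerivAt_tsum_of_isPreconnected (g := fun k t => a k * t ^ k)
    (g' := fun k t => a k * (k * t ^ (k - 1))) hu Metric.isOpen_ball
    (convex_ball (0 : ℂ) ρ).isPreconnected ?_ ?_ (Metric.mem_ball_self hρ) ?_ ht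
  · intro k y _
    exact (hasDerivAt_pow k y).const_mul (a k)
  · intro k y hy
    rw [norm_mul, norm_mul, norm_pow, Complex.norm_natCast, ← mul_assoc]
    have : ‖y‖ ≤ ρ := by simpa using (mem_ball_zero_iff.1 hy).le
    gcongr
  · refine summable_of_ne_finset_zero (s := {0}) fun k hk => ?_
    simp at hk
    simp [hk]

theorem mul_tsum_powers_deriv (a : ℕ → ℂ) (t : ℂ) :
    t * ∑' k : ℕ, a k * (k * t ^ (k - 1)) = ∑' k : ℕ, (a k * k) * t ^ k := by
  rw [← tsum_mul_left]
  congr 1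
  ext k
  rcases k with _ | k
  · simp
  · simp only [Nat.add_sub_cancel, pow_succ]; ring

/-- The coefficients of the regular part of `℘`: `℘(z) = z⁻² + z² ∑ bₖ z²ᵏ`. -/
noncomputable def wpCoeff (g₂ g₃ : ℂ) : ℕ → ℂ
  | 0 => g₂ / 20
  | 1 => g₃ / 28
  | k + 2 => 3 / ((2 * k + 9) * (k + 1)) *
      ∑ i : Fin (k + 1), wpCoeff g₂ g₃ i * wpCoeff g₂ g₃ (k - i)

theorem wpCoeff_add_two (g₂ g₃ : ℂ) (k : ℕ) : wpCoeff g₂ g₃ (k + 2) =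
    3 / ((2 * k + 9) * (k + 1)) *
      ∑ ij ∈ Finset.HasAntidiagonal.antidiagonal k, wpCoeff g₂ g₃ ij.1 * wpCoeff g₂ g₃ ij.2 := by
  rw [wpCoeff, Finset.Nat.sum_antidiagonal_eq_sum_range_succ
    (fun i j => wpCoeff g₂ g₃ i * wpCoeff g₂ g₃ j), Finset.sum_range]

/-- The geometric bound reproduces itself: the convolution has k + 1 terms, each at most M^(k + 4),
and the denominator of the recursion absorbs the factor k + 1 and leaves 3 / (2 k + 9) ≤ 1. -/
theorem norm_wpCoeff_le (g₂ g₃ : ℂ) (k : ℕ) :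
    ‖wpCoeff g₂ g₃ k‖ ≤ (1 + ‖g₂‖ + ‖g₃‖) ^ (k + 2) := by
  obtain ⟨M, hM⟩ : ∃ M : ℝ, M = 1 + ‖g₂‖ + ‖g₃‖ := ⟨_, rfl⟩
  rw [← hM]
  have h1 : 1 ≤ M := by rw [hM]; linarith [norm_nonneg g₂, norm_nonneg g₃]
  induction k using Nat.strong_induction_on with
  | _ k ih =>
    match k, ih with
    | 0, _ =>
      rw [wpCoeff]
      have : M ≤ M ^ (0 + 2) := le_self_pow₀ h1 (by norm_num)
      have h3 : ‖g₂ / 20‖ = ‖g₂‖ / 20 := by rw [norm_div]; simp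
      rw [h3]
      have n2 : 0 ≤ ‖g₂‖ := norm_nonneg _
      have n3 : 0 ≤ ‖g₃‖ := norm_nonneg _
      refine le_trans ?_ this
      rw [hM]
      linarith
    | 1, _ =>
      rw [wpCoeff]
      have : M ≤ M ^ (1 + 2) := le_self_pow₀ h1 (by norm_num)
      have h3 : ‖g₃ / 28‖ = ‖g₃‖ / 28 := by rw [norm_div]; simp
      rw [h3]
      have n2 : 0 ≤ ‖g₂‖ := norm_nonneg _
      have n3 : 0 ≤ ‖g₃‖ := norm_nonneg _
      refine le_trans ?_ this
      rw [hM]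
      linarith
    | k + 2, ih =>
      rw [wpCoeff_add_two, norm_mul]
      have hsum : ‖∑ ij ∈ Finset.HasAntidiagonal.antidiagonal k, wpCoeff g₂ g₃ ij.1 * wpCoeff g₂ g₃ ij.2‖ ≤
          (k + 1) * M ^ (k + 4) := by
        refine (norm_sum_le_of_le _ (f := fun ij : ℕ × ℕ => wpCoeff g₂ g₃ ij.1 * wpCoeff g₂ g₃ ij.2)
          (n := fun _ => M ^ (k + 4)) ?_).trans ?_
        · rintro ⟨i, j⟩ hij
          rw [Finset.HasAntidiagonal.mem_antidiagonal] at hij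
          simp only at hij ⊢
          rw [norm_mul, show k + 4 = (i + 2) + (j + 2) by omega, pow_add]
          exact mul_le_mul (ih i (by omega)) (ih j (by omega)) (norm_nonneg _) (by positivity)
        · simp
      have hc : ‖(3 : ℂ) / ((2 * k + 9) * (k + 1))‖ = 3 / ((2 * k + 9) * (k + 1)) := by
        have : (3 : ℂ) / ((2 * k + 9) * (k + 1)) = ((3 / ((2 * k + 9) * (k + 1)) : ℝ) : ℂ) := by
          push_cast; rfl
        rw [this, Complex.norm_real, Real.norm_of_nonneg (by positivity)]
      rw [hc]
      calc 3 / ((2 * (k : ℝ) + 9) * (k + 1)) * _ ≤ 3 / ((2 * (k : ℝ) + 9) * (k + 1)) *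
            ((k + 1) * M ^ (k + 4)) := by gcongr
        _ = 3 / (2 * (k : ℝ) + 9) * M ^ (k + 4) := by field_simp
        _ ≤ 1 * M ^ (k + 4) := by
            gcongr
            rw [div_le_one (by positivity)]
            have : (0 : ℝ) ≤ k := Nat.cast_nonneg k
            linarith
        _ = M ^ (k + 2 + 2) := by rw [one_mul]

/-- For ℘ = z⁻² + z² p(z²) and t = z², the equation ℘'' = 6 ℘² - g₂ / 2 becomes the one stated for
p. Its linear part multiplies tᵏ by 2 (2 k + 5) (k - 1). Thus k = 0 forces the coefficient g₂ / 20,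
k = 1 is free and carries g₃, and the recursion of `wpCoeff` gives the others. -/
theorem exists_regular_part (g₂ g₃ : ℂ) : ∃ (ρ : ℝ) (p : ℂ → ℂ), 0 < ρ ∧
    DifferentiableOn ℂ p (Metric.ball 0 ρ) ∧ p 0 = g₂ / 20 ∧ deriv p 0 = g₃ / 28 ∧
    ∀ t ∈ Metric.ball (0 : ℂ) ρ, 4 * t ^ 2 * deriv (deriv p) t + 10 * t * deriv p t - 10 * p t =
      6 * t ^ 2 * p t ^ 2 - g₂ / 2 := by
  set b := wpCoeff g₂ g₃ with hb
  set M : ℝ := 1 + ‖g₂‖ + ‖g₃‖ with hM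
  have h1 : 0 < M := by rw [hM]; linarith [norm_nonneg g₂, norm_nonneg g₃]
  set ρ : ℝ := 1 / (2 * M) with hρ
  have hρ0 : 0 < ρ := by positivity
  have hsum : ∀ j : ℕ, Summable fun k : ℕ => ‖b k‖ * (k : ℝ) ^ j * ρ ^ k := by
    intro j
    have hs := (summable_pow_mul_geometric_of_norm_lt_one j (r := (1 / 2 : ℝ))
      (by norm_num)).mul_left (M ^ 2)
    refine Summable.of_nonneg_of_le (fun k => by positivity) (fun k => ?_) hs
    have : M ^ (k + 2) * (k : ℝ) ^ j * ρ ^ k = M ^ 2 * ((k : ℝ) ^ j * (1 / 2) ^ k) := by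
      rw [hρ, one_div, mul_inv, mul_pow, pow_add]
      have : M ^ k * M⁻¹ ^ k = 1 := by rw [← mul_pow, mul_inv_cancel₀ h1.ne', one_pow]
      linear_combination M ^ 2 * (k : ℝ) ^ j * (2⁻¹) ^ k * this
    rw [← this]
    have := norm_wpCoeff_le g₂ g₃ k
    gcongr
  have hn : ∀ k : ℕ, ‖(k : ℂ)‖ = k := fun k => Complex.norm_natCast k
  have d0 : ∀ t ∈ Metric.ball (0 : ℂ) ρ, HasDerivAt (fun t => ∑' k, b k * t ^ k)
      (∑' k : ℕ, b k * (k * t ^ (k - 1))) t := fun t ht =>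
    hasDerivAt_tsum_powers hρ0 (by simpa using hsum 1) ht
  have d1 : ∀ t ∈ Metric.ball (0 : ℂ) ρ, HasDerivAt (fun t => ∑' k : ℕ, (b k * k) * t ^ k)
      (∑' k : ℕ, (b k * k) * (k * t ^ (k - 1))) t := fun t ht =>
    hasDerivAt_tsum_powers hρ0 (by
      refine (hsum 2).congr fun k => ?_
      rw [norm_mul, hn]; ring) ht
  set p : ℂ → ℂ := fun t => ∑' k, b k * t ^ k with hp
  have hpd : DifferentiableOn ℂ p (Metric.ball 0 ρ) := fun t ht =>
    (d0 t ht).differentiableAt.differentiableWithinAt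
  have hpa := hpd.analyticOnNhd Metric.isOpen_ball
  have e1 : ∀ t ∈ Metric.ball (0 : ℂ) ρ, ∑' k : ℕ, (b k * k) * t ^ k = t * deriv p t := by
    intro t ht
    rw [(d0 t ht).deriv, mul_tsum_powers_deriv]
  have e2 : ∀ t ∈ Metric.ball (0 : ℂ) ρ, ∑' k : ℕ, (b k * k * k) * t ^ k =
      t * deriv p t + t ^ 2 * deriv (deriv p) t := by
    intro t ht
    rw [← mul_tsum_powers_deriv]
    have ev : (fun t => ∑' k : ℕ, (b k * k) * t ^ k) =ᶠ[nhds t] fun t => t * deriv p t := by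
      filter_upwards [Metric.isOpen_ball.mem_nhds ht] with u hu using e1 u hu
    have := (((hasDerivAt_id' t).fun_mul
      (hpa t ht).deriv.differentiableAt.hasDerivAt).congr_of_eventuallyEq ev).unique (d1 t ht)
    rw [← this]
    ring
  have hm : (0 : ℂ) ∈ Metric.ball (0 : ℂ) ρ := Metric.mem_ball_self hρ0
  refine ⟨ρ, p, hρ0, hpd, ?_, ?_, ?_⟩
  · simp only [hp]
    rw [tsum_eq_single 0 (fun k hk => by simp [hk])]
    simp [hb, wpCoeff]
  · rw [(d0 0 hm).deriv, tsum_eq_single 1]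
    · simp [hb, wpCoeff]
    · intro k hk
      rcases k with _ | _ | k
      · simp
      · simp at hk
      · simp
  · intro t ht
    have hle : ‖t‖ ≤ ρ := (mem_ball_zero_iff.1 ht).le
    have hs : ∀ j : ℕ, Summable fun k : ℕ => ‖b k * (k : ℂ) ^ j * t ^ k‖ := by
      intro j
      refine Summable.of_nonneg_of_le (fun k => norm_nonneg _) (fun k => ?_) (hsum j)
      rw [norm_mul, norm_mul, norm_pow, norm_pow, hn]
      gcongr
    have s0 : Summable fun k : ℕ => b k * t ^ k := by simpa using (hs 0).of_norm
    have s0' : Summable fun k : ℕ => ‖b k * t ^ k‖ := by simpa using (hs 0)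
    have s1 : Summable fun k : ℕ => b k * k * t ^ k := by simpa using (hs 1).of_norm
    have s2 : Summable fun k : ℕ => b k * k * k * t ^ k :=
      (hs 2).of_norm.congr fun k => by ring
    have hL : 4 * t ^ 2 * deriv (deriv p) t + 10 * t * deriv p t - 10 * p t =
        ∑' k : ℕ, (4 * (b k * k * k * t ^ k) + 6 * (b k * k * t ^ k) - 10 * (b k * t ^ k)) := by
      rw [((s2.mul_left 4).add (s1.mul_left 6)).tsum_sub (s0.mul_left 10),
        (s2.mul_left 4).tsum_add (s1.mul_left 6), tsum_mul_left, tsum_mul_left, tsum_mul_left,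
        e1 t ht, e2 t ht]
      simp only [hp]
      ring
    have hsq : p t ^ 2 = ∑' k : ℕ, ∑ ij ∈ Finset.HasAntidiagonal.antidiagonal k,
        (b ij.1 * t ^ ij.1) * (b ij.2 * t ^ ij.2) := by
      rw [sq]
      exact tsum_mul_tsum_eq_tsum_sum_antidiagonal_of_summable_norm s0' s0'
    have sA := ((s2.mul_left 4).add (s1.mul_left 6)).sub (s0.mul_left 10)
    rw [hL, ← sA.sum_add_tsum_nat_add 2, hsq, ← tsum_mul_left]
    have hterm : ∀ k : ℕ, 4 * (b (k + 2) * (k + 2 : ℕ) * (k + 2 : ℕ) * t ^ (k + 2)) +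
        6 * (b (k + 2) * (k + 2 : ℕ) * t ^ (k + 2)) - 10 * (b (k + 2) * t ^ (k + 2)) =
        6 * t ^ 2 * ∑ ij ∈ Finset.HasAntidiagonal.antidiagonal k,
          (b ij.1 * t ^ ij.1) * (b ij.2 * t ^ ij.2) := by
      intro k
      have hS : ∑ ij ∈ Finset.HasAntidiagonal.antidiagonal k, (b ij.1 * t ^ ij.1) * (b ij.2 * t ^ ij.2) =
          t ^ k * ∑ ij ∈ Finset.HasAntidiagonal.antidiagonal k, b ij.1 * b ij.2 := by
        rw [Finset.mul_sum]
        refine Finset.sum_congr rfl ?_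
        rintro ⟨i, j⟩ hij
        rw [Finset.HasAntidiagonal.mem_antidiagonal] at hij
        simp only at hij ⊢
        rw [← hij, pow_add]
        ring
      rw [hS, hb, wpCoeff_add_two]
      have h9 : (2 * (k : ℂ) + 9) ≠ 0 := by
        have : ((2 * k + 9 : ℕ) : ℂ) ≠ 0 := Nat.cast_ne_zero.2 (by omega)
        push_cast at this; exact this
      have h10 : ((k : ℂ) + 1) ≠ 0 := Nat.cast_add_one_ne_zero k
      push_cast
      field_simp
      ring
    rw [tsum_congr hterm]
    simp [Finset.sum_range_succ, hb, wpCoeff]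
    ring

/-- The germ is z exp(-W), where W'' is the regular part z² p(z²) of ℘ and W, W' vanish at 0. The
second-order equation is built in. The first-order one then holds up to a constant, which the choice
p'(0) = g₃ / 28 makes zero. -/
theorem exists_isSigmaOn (g₂ g₃ : ℂ) : ∃ (r : ℝ) (σ : ℂ → ℂ), IsSigmaOn g₂ g₃ r σ := by
  obtain ⟨ρ, p, hρ, hpd, p0, p1, hode⟩ := exists_regular_part g₂ g₃
  have hpa := hpd.analyticOnNhd Metric.isOpen_ball
  set r : ℝ := min ρ 1 with hr
  have hr0 : 0 < r := lt_min hρ one_pos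
  have hm : (0 : ℂ) ∈ Metric.ball (0 : ℂ) ρ := Metric.mem_ball_self hρ
  have hsq : ∀ z ∈ Metric.ball (0 : ℂ) r, z ^ 2 ∈ Metric.ball (0 : ℂ) ρ := by
    intro z hz
    simp only [mem_ball_zero_iff, norm_pow] at *
    have h1 : ‖z‖ < 1 := hz.trans_le (min_le_right _ _)
    have h2 : ‖z‖ < ρ := hz.trans_le (min_le_left _ _)
    nlinarith [norm_nonneg z]
  -- the first integral
  have hd0 : ∀ t ∈ Metric.ball (0 : ℂ) ρ, HasDerivAt p (deriv p t) t :=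
    fun t ht => (hpa t ht).differentiableAt.hasDerivAt
  have hd1 : ∀ t ∈ Metric.ball (0 : ℂ) ρ, HasDerivAt (deriv p) (deriv (deriv p) t) t :=
    fun t ht => (hpa t ht).deriv.differentiableAt.hasDerivAt
  -- Φ(z²) is z² (℘'² - 4 ℘³ + g₂ ℘ + g₃), expressed through p.
  set Φ : ℂ → ℂ := fun t => (g₂ - 20 * p t) - 8 * (t * deriv p t) + g₃ * t
    + 4 * (t ^ 2 * (p t + t * deriv p t) ^ 2) - 12 * (t ^ 2 * p t ^ 2) - 4 * (t ^ 4 * p t ^ 3)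
    + g₂ * (t ^ 2 * p t) with hΦ
  have hΦd : ∀ t ∈ Metric.ball (0 : ℂ) ρ, HasDerivAt Φ
      (-20 * deriv p t - 8 * (deriv p t + t * deriv (deriv p) t) + g₃
        + 8 * t * (p t + t * deriv p t) ^ 2
        + 8 * t ^ 2 * (p t + t * deriv p t) * (2 * deriv p t + t * deriv (deriv p) t)
        - 24 * t * p t ^ 2 - 24 * t ^ 2 * p t * deriv p t
        - 16 * t ^ 3 * p t ^ 3 - 12 * t ^ 4 * p t ^ 2 * deriv p t
        + g₂ * (2 * t * p t + t ^ 2 * deriv p t)) t := by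
    intro t ht
    have a := hd0 t ht
    have b := hd1 t ht
    have c := hasDerivAt_id' t
    refine ((((((((a.const_mul 20).const_sub g₂).fun_sub ((c.fun_mul b).const_mul 8)).fun_add
      (c.const_mul g₃)).fun_add (((c.fun_pow 2).fun_mul ((a.fun_add (c.fun_mul b)).fun_pow
      2)).const_mul 4)).fun_sub (((c.fun_pow 2).fun_mul (a.fun_pow 2)).const_mul 12)).fun_sub
      (((c.fun_pow 4).fun_mul (a.fun_pow 3)).const_mul 4)).fun_add
      (((c.fun_pow 2).fun_mul a).const_mul g₂)).congr_deriv ?_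
    push_cast
    ring
  have hΦ0 : ∀ t ∈ Metric.ball (0 : ℂ) ρ, Φ t = 0 := by
    have hx : (((ρ / 2 : ℝ)) : ℂ) ∈ Metric.ball (0 : ℂ) ρ := by
      simp only [mem_ball_zero_iff, Complex.norm_real, Real.norm_eq_abs]
      rw [abs_of_pos (by positivity)]; linarith
    have hx0 : (((ρ / 2 : ℝ)) : ℂ) ≠ 0 := by
      rw [Complex.ofReal_ne_zero]; positivity
    -- The bracket in Φ = t (...) is a first integral, so t Φ' = Φ and Φ is a multiple of t. Its
    -- slope Φ'(0) = g₃ - 28 p'(0) vanishes.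
    have hprop := proportional_of_wronskian_eq_zero Metric.isOpen_ball
      (convex_ball (0 : ℂ) ρ).isPreconnected (u := Φ) (v := fun t => t)
      (fun t ht => (hΦd t ht).differentiableAt.differentiableWithinAt)
      differentiable_id.differentiableOn (by
        intro t ht
        rw [(hΦd t ht).deriv]
        simp only [deriv_id'', hΦ]
        linear_combination (-2 + 2 * t ^ 2 * (p t + t * deriv p t)) * hode t ht) hx hx0
    set x : ℂ := (((ρ / 2 : ℝ)) : ℂ) with hxdef
    have hev : Φ =ᶠ[nhds 0] fun t => Φ x / x * t := by
      filter_upwards [Metric.isOpen_ball.mem_nhds hm] with t ht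
      have := hprop t ht
      field_simp
      linear_combination this
    have h0 := (hΦd 0 hm).unique (((hasDerivAt_id' (0 : ℂ)).const_mul
      (Φ x / x)).congr_of_eventuallyEq hev)
    rw [p1] at h0
    have hΦx : Φ x / x = 0 := by linear_combination -h0
    have hΦx' : Φ x = 0 := by simpa [hx0] using hΦx
    intro t ht
    have := hprop t ht
    rw [hΦx', zero_mul] at this
    exact (mul_eq_zero.1 this).resolve_right hx0
  -- the regular part of `℘`
  set q : ℂ → ℂ := fun z => z ^ 2 * p (z ^ 2) with hq
  have hqd : ∀ z ∈ Metric.ball (0 : ℂ) r,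
      HasDerivAt q (2 * z * p (z ^ 2) + 2 * z ^ 3 * deriv p (z ^ 2)) z := by
    intro z hz
    refine (((hasDerivAt_id' z).fun_pow 2).fun_mul ((hd0 _ (hsq z hz)).comp z
      ((hasDerivAt_id' z).fun_pow 2))).congr_deriv ?_
    simp only [Function.comp]
    push_cast
    ring
  have hqd2 : ∀ z ∈ Metric.ball (0 : ℂ) r, HasDerivAt (deriv q) (2 * p (z ^ 2)
      + 10 * z ^ 2 * deriv p (z ^ 2) + 4 * z ^ 4 * deriv (deriv p) (z ^ 2)) z := by
    intro z hz
    have ev : deriv q =ᶠ[nhds z] fun z => 2 * z * p (z ^ 2) + 2 * z ^ 3 * deriv p (z ^ 2) := by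
      filter_upwards [Metric.isOpen_ball.mem_nhds hz] with u hu using (hqd u hu).deriv
    have c := hasDerivAt_id' z
    have a0 := (hd0 _ (hsq z hz)).comp z (c.fun_pow 2)
    have a1 := (hd1 _ (hsq z hz)).comp z (c.fun_pow 2)
    simp only [Function.comp_def] at a0 a1
    refine HasDerivAt.congr_of_eventuallyEq (HasDerivAt.congr_deriv
      (((c.const_mul 2).fun_mul a0).fun_add (((c.fun_pow 3).const_mul 2).fun_mul a1)) ?_) ev
    push_cast
    ring
  have hqdiff : DifferentiableOn ℂ q (Metric.ball 0 r) := fun z hz =>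
    (hqd z hz).differentiableAt.differentiableWithinAt
  obtain ⟨Q, hQ, hQ0⟩ : ∃ Q : ℂ → ℂ, (∀ z ∈ Metric.ball (0 : ℂ) r, HasDerivAt Q (q z) z) ∧
      Q 0 = 0 := by
    obtain ⟨Q, a, b⟩ := hqdiff.isExactOn_ball.with_val_at 0 0
    exact ⟨Q, b, a⟩
  have hQdiff : DifferentiableOn ℂ Q (Metric.ball 0 r) := fun z hz =>
    (hQ z hz).differentiableAt.differentiableWithinAt
  obtain ⟨W, hW, hW0⟩ : ∃ W : ℂ → ℂ, (∀ z ∈ Metric.ball (0 : ℂ) r, HasDerivAt W (Q z) z) ∧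
      W 0 = 0 := by
    obtain ⟨W, a, b⟩ := hQdiff.isExactOn_ball.with_val_at 0 0
    exact ⟨W, b, a⟩
  have hrm : (0 : ℂ) ∈ Metric.ball (0 : ℂ) r := Metric.mem_ball_self hr0
  set e : ℂ → ℂ := fun z => Complex.exp (-W z) with he
  have hed : ∀ z ∈ Metric.ball (0 : ℂ) r, HasDerivAt e (-Q z * e z) z := by
    intro z hz
    refine (hW z hz).fun_neg.cexp.congr_deriv ?_
    ring
  have hea : AnalyticOnNhd ℂ e (Metric.ball 0 r) :=
    DifferentiableOn.analyticOnNhd (fun z hz =>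
      (hed z hz).differentiableAt.differentiableWithinAt) Metric.isOpen_ball
  have hene : ∀ z ∈ Metric.ball (0 : ℂ) r, e z ≠ 0 := fun z _ => Complex.exp_ne_zero _
  have heζ : ∀ z ∈ Metric.ball (0 : ℂ) r, wZeta e z = -Q z := by
    intro z hz
    unfold wZeta
    rw [(hed z hz).deriv, mul_div_cancel_right₀ _ (hene z hz)]
  have heP : ∀ z ∈ Metric.ball (0 : ℂ) r, wP e z = q z := by
    intro z hz
    have ev : wZeta e =ᶠ[nhds z] fun z => -Q z := by
      filter_upwards [Metric.isOpen_ball.mem_nhds hz] with u hu using heζ u hu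
    unfold wP
    rw [ev.deriv_eq, (hQ z hz).fun_neg.deriv, neg_neg]
  have heP1 : ∀ z ∈ Metric.ball (0 : ℂ) r, deriv (wP e) z = deriv q z := by
    intro z hz
    have ev : wP e =ᶠ[nhds z] q := by
      filter_upwards [Metric.isOpen_ball.mem_nhds hz] with u hu using heP u hu
    exact ev.deriv_eq
  have hfac := wP_of_factor (σ := fun z => z * e z) (z₀ := 0) (k := 1) hea hene (by simp)
  simp only [sub_zero, Nat.cast_one, mul_one] at hfac
  have hσd : ∀ z ∈ Metric.ball (0 : ℂ) r, HasDerivAt (fun z => z * e z) (e z - z * Q z * e z) z := by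
    intro z hz
    refine ((hasDerivAt_id' z).fun_mul (hed z hz)).congr_deriv ?_
    ring
  have hneg : ∀ z ∈ Metric.ball (0 : ℂ) r, -z ∈ Metric.ball (0 : ℂ) r := by
    intro z hz; simpa using hz
  have hQodd : ∀ z ∈ Metric.ball (0 : ℂ) r, Q (-z) = -Q z := by
    intro z hz
    have hd : ∀ u ∈ Metric.ball (0 : ℂ) r, HasDerivAt (fun z => Q (-z) + Q z) 0 u := by
      intro u hu
      refine (((hQ _ (hneg u hu)).comp u (hasDerivAt_neg u)).add (hQ u hu)).congr_deriv ?_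
      simp only [hq]
      ring_nf
    have := Metric.isOpen_ball.is_const_of_deriv_eq_zero (convex_ball (0 : ℂ) r).isPreconnected
      (fun u hu => (hd u hu).differentiableAt.differentiableWithinAt)
      (fun u hu => (hd u hu).deriv) hz hrm
    simp only [neg_zero, hQ0, add_zero] at this
    exact eq_neg_of_add_eq_zero_left this
  have hWeven : ∀ z ∈ Metric.ball (0 : ℂ) r, W (-z) = W z := by
    intro z hz
    have hd : ∀ u ∈ Metric.ball (0 : ℂ) r, HasDerivAt (fun z => W (-z) - W z) 0 u := by
      intro u hu
      refine (((hW _ (hneg u hu)).comp u (hasDerivAt_neg u)).sub (hW u hu)).congr_deriv ?_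
      rw [hQodd u hu]
      ring
    have := Metric.isOpen_ball.is_const_of_deriv_eq_zero (convex_ball (0 : ℂ) r).isPreconnected
      (fun u hu => (hd u hu).differentiableAt.differentiableWithinAt)
      (fun u hu => (hd u hu).deriv) hz hrm
    simp only [neg_zero, hW0, sub_zero] at this
    exact sub_eq_zero.1 this
  refine ⟨r, fun z => z * e z, hr0, fun z hz => (hσd z hz).differentiableAt.differentiableWithinAt,
    fun z hz hz0 => mul_ne_zero hz0 (hene z hz), ?_, ?_, ?_, ?_⟩
  · intro z hz
    simp only [he, hWeven z hz]
    ring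
  · rw [(hσd 0 hrm).deriv]
    simp [he, hW0]
  · intro z hz hz0
    obtain ⟨-, h1, h2⟩ := hfac z hz hz0
    rw [h1, h2, heP z hz, heP1 z hz, (hqd z hz).deriv]
    have := hΦ0 _ (hsq z hz)
    simp only [hΦ] at this
    simp only [hq]
    field_simp
    linear_combination z ^ 4 * this
  · intro z hz hz0
    obtain ⟨-, h1, -⟩ := hfac z hz hz0
    have ev : deriv (wP fun z => z * e z) =ᶠ[nhds z] fun z => -2 / z ^ 3 + deriv q z := by
      filter_upwards [Metric.isOpen_ball.mem_nhds hz, isOpen_compl_singleton.mem_nhds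
        (show z ∈ ({0}ᶜ : Set ℂ) from hz0)] with u hu hu0
      rw [(hfac u hu hu0).2.2, heP1 u hu]
    rw [ev.deriv_eq, (((hasDerivAt_const z (-2 : ℂ)).fun_div ((hasDerivAt_id' z).fun_pow 3)
      (pow_ne_zero 3 hz0)).fun_add (hqd2 z hz)).deriv, h1, heP z hz]
    have := hode _ (hsq z hz)
    simp only [hq]
    push_cast
    field_simp
    linear_combination 2 * z ^ 4 * this

/-! ### Existence and uniqueness of the sigma function -/

/-- By the identity theorem any two of the functions agree on the smaller of their discs, so they
glue. -/
theorem exists_entire_of_germs {r : ℝ} (hr : 0 < r) {F : ℕ → ℂ → ℂ}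
    (hF : ∀ n, DifferentiableOn ℂ (F n) (Metric.ball 0 (2 ^ n * r)))
    (hg : ∀ n, F n =ᶠ[nhds 0] F 0) :
    ∃ f : ℂ → ℂ, Differentiable ℂ f ∧ f =ᶠ[nhds 0] F 0 := by
  have hpos : ∀ n : ℕ, 0 < 2 ^ n * r := fun n => by positivity
  have hle : ∀ m n : ℕ, m ≤ n → ∀ z ∈ Metric.ball (0 : ℂ) (2 ^ m * r), F n z = F m z := by
    intro m n hmn z hz
    have hsub : Metric.ball (0 : ℂ) (2 ^ m * r) ⊆ Metric.ball (0 : ℂ) (2 ^ n * r) :=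
      Metric.ball_subset_ball (by gcongr; norm_num)
    exact AnalyticOnNhd.eqOn_of_preconnected_of_eventuallyEq
      (((hF n).mono hsub).analyticOnNhd Metric.isOpen_ball)
      ((hF m).analyticOnNhd Metric.isOpen_ball) (convex_ball _ _).isPreconnected
      (Metric.mem_ball_self (hpos m)) ((hg n).trans (hg m).symm) hz
  have hex : ∀ z : ℂ, ∃ n : ℕ, z ∈ Metric.ball (0 : ℂ) (2 ^ n * r) := by
    intro z
    obtain ⟨n, hn⟩ := pow_unbounded_of_one_lt (‖z‖ / r) (one_lt_two (α := ℝ))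
    refine ⟨n, ?_⟩
    rw [mem_ball_zero_iff]
    rwa [div_lt_iff₀ hr] at hn
  choose N hN using hex
  have hf : ∀ n, ∀ z ∈ Metric.ball (0 : ℂ) (2 ^ n * r), F (N z) z = F n z := by
    intro n z hz
    rcases le_total n (N z) with h | h
    · exact hle _ _ h z hz
    · exact (hle _ _ h z (hN z)).symm
  refine ⟨fun z => F (N z) z, fun z => ?_, ?_⟩
  · have ev : (fun z => F (N z) z) =ᶠ[nhds z] F (N z) := by
      filter_upwards [Metric.isOpen_ball.mem_nhds (hN z)] with u hu using hf _ u hu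
    exact ((hF (N z)).differentiableAt (Metric.isOpen_ball.mem_nhds (hN z))).congr_of_eventuallyEq ev
  · filter_upwards [Metric.ball_mem_nhds (0 : ℂ) (hpos 0)] with u hu using hf 0 u hu

theorem sigmaA_congr {σ τ : ℂ → ℂ} {z : ℂ} (h : σ =ᶠ[nhds z] τ) :
    sigmaA σ =ᶠ[nhds z] sigmaA τ := by
  filter_upwards [h, h.deriv, h.deriv.deriv] with u h0 h1 h2
  simp only [sigmaA, h0, h1, h2]

theorem sigmaB_congr {σ τ : ℂ → ℂ} {z : ℂ} (h : σ =ᶠ[nhds z] τ) :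
    sigmaB σ =ᶠ[nhds z] sigmaB τ := by
  filter_upwards [h, h.deriv, h.deriv.deriv, h.deriv.deriv.deriv] with u h0 h1 h2 h3
  simp only [sigmaB, h0, h1, h2, h3]

/-- The right-hand side of the duplication formula. -/
noncomputable def sigmaDouble (σ : ℂ → ℂ) (z : ℂ) : ℂ := -(σ (z / 2) * sigmaB σ (z / 2))

theorem sigmaDouble_congr {σ τ : ℂ → ℂ} (h : σ =ᶠ[nhds 0] τ) :
    sigmaDouble σ =ᶠ[nhds 0] sigmaDouble τ := by
  have ht : Filter.Tendsto (fun z : ℂ => z / 2) (nhds 0) (nhds 0) := by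
    have : ContinuousAt (fun z : ℂ => z / 2) 0 := by fun_prop
    simpa using this.tendsto
  filter_upwards [ht.eventually h, ht.eventually (sigmaB_congr h)] with u h0 h1
  simp only [sigmaDouble, h0, h1]

theorem differentiableOn_sigmaDouble {σ : ℂ → ℂ} {r : ℝ}
    (h : DifferentiableOn ℂ σ (Metric.ball 0 r)) :
    DifferentiableOn ℂ (sigmaDouble σ) (Metric.ball 0 (2 * r)) := by
  intro z hz
  have hz2 : z / 2 ∈ Metric.ball (0 : ℂ) r := by
    simp only [mem_ball_zero_iff, norm_div, RCLike.norm_ofNat] at *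
    linarith
  have ha := h.analyticOnNhd Metric.isOpen_ball _ hz2
  have hd : DifferentiableAt ℂ (fun z : ℂ => z / 2) z := by fun_prop
  exact ((ha.differentiableAt.comp z hd).mul
    ((analyticAt_sigmaB ha).differentiableAt.comp z hd)).neg.differentiableWithinAt

/-- The duplication formula expresses σ on a disc through σ and its derivatives on the disc of half
the radius. Each application of `sigmaDouble` therefore doubles the domain without changing the germ
at 0. -/
theorem exists_entire_sigma {g₂ g₃ : ℂ} {r : ℝ} {τ : ℂ → ℂ} (h : IsSigmaOn g₂ g₃ r τ) :
    ∃ σ : ℂ → ℂ, Differentiable ℂ σ ∧ σ =ᶠ[nhds 0] τ := by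
  have hdup : sigmaDouble τ =ᶠ[nhds 0] τ := by
    filter_upwards [Metric.ball_mem_nhds (0 : ℂ) h.pos] with z hz
    have hz2 : z / 2 ∈ Metric.ball (0 : ℂ) (r / 2) := by
      simp only [mem_ball_zero_iff, norm_div, RCLike.norm_ofNat] at *
      linarith
    have := h.duplication _ hz2
    rw [show 2 * (z / 2) = z by ring] at this
    exact this.symm
  refine exists_entire_of_germs h.pos (F := fun n => sigmaDouble^[n] τ) (fun n => ?_) (fun n => ?_)
  · induction n with
    | zero => simpa using h.diff
    | succ n ih =>
      rw [Function.iterate_succ_apply', pow_succ', mul_assoc]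
      exact differentiableOn_sigmaDouble ih
  · induction n with
    | zero => exact Filter.EventuallyEq.rfl
    | succ n ih =>
      rw [Function.iterate_succ_apply']
      exact (sigmaDouble_congr ih).trans hdup

theorem entire_analytic {f : ℂ → ℂ} (h : Differentiable ℂ f) : AnalyticOnNhd ℂ f univ :=
  fun z _ => h.analyticAt z

theorem exists_isWeierstrassSigma (g₂ g₃ : ℝ) : ∃ σ : ℂ → ℂ, IsWeierstrassSigma g₂ g₃ σ := by
  obtain ⟨r, τ, h⟩ := exists_isSigmaOn (g₂ : ℂ) (g₃ : ℂ)
  obtain ⟨σ, hσ, hev⟩ := exists_entire_sigma h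
  have hA : AnalyticOnNhd ℂ (sigmaA σ) univ := fun z _ => analyticAt_sigmaA (hσ.analyticAt z)
  have hB : AnalyticOnNhd ℂ (sigmaB σ) univ := fun z _ => analyticAt_sigmaB (hσ.analyticAt z)
  -- Cleared of denominators, the first-order equation is an identity between entire functions; it
  -- suffices to know it near 0.
  have key : ∀ z, sigmaB σ z ^ 2 =
      4 * sigmaA σ z ^ 3 - g₂ * sigmaA σ z * σ z ^ 4 - g₃ * σ z ^ 6 := by
    intro z
    have hfun : (fun z => sigmaB σ z ^ 2) = fun z =>
        4 * sigmaA σ z ^ 3 - g₂ * sigmaA σ z * σ z ^ 4 - g₃ * σ z ^ 6 := by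
      refine AnalyticOnNhd.eq_of_frequently_eq (z₀ := 0) (hB.pow 2) ?_ ?_
      · exact ((analyticOnNhd_const.mul (hA.pow 3)).sub ((analyticOnNhd_const.mul hA).mul
          ((entire_analytic hσ).pow 4))).sub (analyticOnNhd_const.mul ((entire_analytic hσ).pow 6))
      · refine Filter.Eventually.frequently ?_
        filter_upwards [mem_nhdsWithin_of_mem_nhds hev, mem_nhdsWithin_of_mem_nhds (sigmaA_congr hev),
          mem_nhdsWithin_of_mem_nhds (sigmaB_congr hev), self_mem_nhdsWithin,
          mem_nhdsWithin_of_mem_nhds (Metric.ball_mem_nhds (0 : ℂ) h.pos)] with z h0 h1 h2 hz0 hz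
        have h0 : σ z = τ z := h0
        have h1 : sigmaA σ z = sigmaA τ z := h1
        have h2 : sigmaB σ z = sigmaB τ z := h2
        rw [h0, h1, h2]
        have hne := h.ne_zero z hz hz0
        have := h.ode z hz hz0
        rw [wP_eq (h.analyticOnNhd z hz) hne, deriv_wP_eq (h.analyticOnNhd z hz) hne] at this
        field_simp at this
        linear_combination this
    exact congrFun hfun z
  refine ⟨σ, hσ, ?_, ?_, ?_⟩
  · have hfun : (fun z => σ (-z)) = fun z => -σ z := by
      refine AnalyticOnNhd.eq_of_eventuallyEq (z₀ := 0)
        (entire_analytic (hσ.comp differentiable_neg)) (entire_analytic hσ.neg) ?_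
      have ht : Filter.Tendsto (fun z : ℂ => -z) (nhds 0) (nhds 0) := by
        simpa using (continuous_neg (G := ℂ)).tendsto 0
      filter_upwards [hev, ht.eventually hev, Metric.ball_mem_nhds (0 : ℂ) h.pos] with z h0 h1 hz
      rw [h0, h1, h.odd z hz]
    exact fun z => congrFun hfun z
  · rw [hev.deriv_eq, h.deriv_zero]
  · intro z hz
    rw [wP_eq (hσ.analyticAt z) hz, deriv_wP_eq (hσ.analyticAt z) hz]
    field_simp
    linear_combination key z

namespace IsWeierstrassSigma
variable {g₂ g₃ : ℝ} {σ : ℂ → ℂ}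

theorem analyticAt (h : IsWeierstrassSigma g₂ g₃ σ) (z : ℂ) : AnalyticAt ℂ σ z :=
  h.entire.analyticAt z

theorem map_zero (h : IsWeierstrassSigma g₂ g₃ σ) : σ 0 = 0 := by
  have := h.odd 0
  rw [neg_zero] at this
  exact self_eq_neg.1 this

theorem deriv_deriv_zero (h : IsWeierstrassSigma g₂ g₃ σ) : deriv (deriv σ) 0 = 0 :=
  deriv_deriv_zero_of_odd (Filter.Eventually.of_forall h.odd)

theorem sigmaA_zero (h : IsWeierstrassSigma g₂ g₃ σ) : sigmaA σ 0 = 1 := by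
  simp [sigmaA, h.map_zero, h.deriv_zero]

theorem sigmaB_zero (h : IsWeierstrassSigma g₂ g₃ σ) : sigmaB σ 0 = -2 := by
  simp [sigmaB, h.map_zero, h.deriv_zero]

theorem exists_ball_ne_zero (h : IsWeierstrassSigma g₂ g₃ σ) :
    ∃ r > 0, ∀ z ∈ Metric.ball (0 : ℂ) r, z ≠ 0 → σ z ≠ 0 := by
  obtain ⟨e, r, hr, -, hne, hs, -, -⟩ := exists_factor_zero (h.analyticAt 0) h.map_zero h.deriv_zero
  refine ⟨r, hr, fun z hz hz0 => ?_⟩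
  rw [hs z hz]
  exact mul_ne_zero hz0 (hne z hz)

/-- Differentiating the first-order equation yields the second-order one multiplied by ℘'. To cancel
℘' at its zeros too, denominators are cleared: a product of entire functions vanishes only if one
factor does. -/
theorem deriv_deriv_wP (h : IsWeierstrassSigma g₂ g₃ σ) {z : ℂ} (hz : σ z ≠ 0) :
    deriv (deriv (wP σ)) z = 6 * wP σ z ^ 2 - g₂ / 2 := by
  have hσ := entire_analytic h.entire
  have hA : AnalyticOnNhd ℂ (sigmaA σ) univ := fun z _ => analyticAt_sigmaA (h.analyticAt z)
  have hB : AnalyticOnNhd ℂ (sigmaB σ) univ := fun z _ => analyticAt_sigmaB (h.analyticAt z)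
  have d2 : ∀ z, σ z ≠ 0 → deriv (deriv (wP σ)) z =
      (deriv (sigmaB σ) z * σ z - 3 * sigmaB σ z * deriv σ z) / σ z ^ 4 := by
    intro z hz
    have ev : deriv (wP σ) =ᶠ[nhds z] fun u => sigmaB σ u / σ u ^ 3 := by
      filter_upwards [(h.analyticAt z).continuousAt.eventually_ne hz] with u hu
      exact deriv_wP_eq (h.analyticAt u) hu
    rw [ev.deriv_eq, ((hB z trivial).differentiableAt.hasDerivAt.fun_div
      ((h.analyticAt z).differentiableAt.hasDerivAt.fun_pow 3) (pow_ne_zero 3 hz)).deriv]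
    push_cast
    field_simp
  set C : ℂ → ℂ := fun z => deriv (sigmaB σ) z * σ z - 3 * sigmaB σ z * deriv σ z -
    (6 * sigmaA σ z ^ 2 - g₂ / 2 * σ z ^ 4) with hC
  have hCa : AnalyticOnNhd ℂ C univ := ((hB.deriv.mul hσ).sub ((analyticOnNhd_const.mul hB).mul
    hσ.deriv)).sub ((analyticOnNhd_const.mul (hA.pow 2)).sub (analyticOnNhd_const.mul (hσ.pow 4)))
  have hprod : ∀ z ∈ univ, (σ z * sigmaB σ z) * C z = 0 := by
    intro z _
    by_cases hz : σ z = 0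
    · rw [hz]; ring
    · have ev : (fun z => deriv (wP σ) z ^ 2) =ᶠ[nhds z]
          fun z => 4 * wP σ z ^ 3 - (g₂ : ℂ) * wP σ z - (g₃ : ℂ) := by
        filter_upwards [(h.analyticAt z).continuousAt.eventually_ne hz] with u hu
        exact h.ode u hu
      have dx := hasDerivAt_wP (h.analyticAt z) hz
      have dy := (analyticAt_wP (h.analyticAt z) hz).deriv.differentiableAt.hasDerivAt
      have := (dy.fun_pow 2).unique (((((dx.fun_pow 3).const_mul 4).fun_sub
        (dx.const_mul (g₂ : ℂ))).sub_const (g₃ : ℂ)).congr_of_eventuallyEq ev)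
      rw [d2 z hz, deriv_wP_eq (h.analyticAt z) hz, wP_eq (h.analyticAt z) hz] at this
      simp only [hC]
      push_cast at this
      field_simp at this
      linear_combination σ z * this / 2
  have hne : ¬ ∀ z ∈ univ, σ z * sigmaB σ z = 0 := by
    intro hall
    obtain ⟨r, hr, hr0⟩ := h.exists_ball_ne_zero
    have h1 : ∀ᶠ z in nhdsWithin (0 : ℂ) {0}ᶜ, σ z ≠ 0 := by
      filter_upwards [mem_nhdsWithin_of_mem_nhds (Metric.ball_mem_nhds (0 : ℂ) hr),
        self_mem_nhdsWithin] with z hz hz0 using hr0 z hz hz0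
    have h2 : ∀ᶠ z in nhdsWithin (0 : ℂ) {0}ᶜ, sigmaB σ z ≠ 0 :=
      ((hB 0 trivial).continuousAt.eventually_ne (by rw [h.sigmaB_zero]; norm_num)).filter_mono
        nhdsWithin_le_nhds
    obtain ⟨z, hz1, hz2⟩ := (h1.and h2).exists
    exact mul_ne_zero hz1 hz2 (hall z trivial)
  have hC0 : ∀ z ∈ univ, C z = 0 :=
    ((hσ.mul hB).eq_zero_or_eq_zero_of_mul_eq_zero hCa hprod isPreconnected_univ).resolve_left hne
  have := hC0 z trivial
  simp only [hC] at this
  rw [d2 z hz, wP_eq (h.analyticAt z) hz]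
  field_simp
  linear_combination 2 * this

theorem hasDerivAt_deriv_wP (h : IsWeierstrassSigma g₂ g₃ σ) {z : ℂ} (hz : σ z ≠ 0) :
    HasDerivAt (deriv (wP σ)) (6 * wP σ z ^ 2 - g₂ / 2) z := by
  rw [← h.deriv_deriv_wP hz]
  exact (analyticAt_wP (h.analyticAt z) hz).deriv.differentiableAt.hasDerivAt

theorem exists_isSigmaOn (h : IsWeierstrassSigma g₂ g₃ σ) : ∃ r, IsSigmaOn g₂ g₃ r σ := by
  obtain ⟨r, hr, hr0⟩ := h.exists_ball_ne_zero
  exact ⟨r, hr, h.entire.differentiableOn, hr0, fun z _ => h.odd z, h.deriv_zero,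
    fun z hz hz0 => h.ode z (hr0 z hz hz0), fun z hz hz0 => h.deriv_deriv_wP (hr0 z hz hz0)⟩

/-- The addition theorem: `σ(z + w) σ(z - w) = σ(z)² σ(w)² (℘(w) - ℘(z))`. -/
theorem addition (h : IsWeierstrassSigma g₂ g₃ σ) (z w : ℂ) :
    σ (z + w) * σ (z - w) = σ z ^ 2 * sigmaA σ w - sigmaA σ z * σ w ^ 2 := by
  obtain ⟨r, hr⟩ := h.exists_isSigmaOn
  have hr2 : 0 < r / 2 := half_pos hr.pos
  have hσ := entire_analytic h.entire
  have hA : AnalyticOnNhd ℂ (sigmaA σ) univ := fun z _ => analyticAt_sigmaA (h.analyticAt z)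
  -- The local addition theorem is continued to all z for small w, and then to all w.
  have step1 : ∀ w ∈ Metric.ball (0 : ℂ) (r / 2), ∀ z,
      σ (z + w) * σ (z - w) = σ z ^ 2 * sigmaA σ w - sigmaA σ z * σ w ^ 2 := by
    intro w hw z
    have : (fun z => σ (z + w) * σ (z - w)) =
        fun z => σ z ^ 2 * sigmaA σ w - sigmaA σ z * σ w ^ 2 := by
      refine AnalyticOnNhd.eq_of_eventuallyEq (z₀ := 0) (entire_analytic
        ((h.entire.comp (differentiable_id.add_const w)).mul
          (h.entire.comp (differentiable_id.sub_const w))))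
        (((hσ.pow 2).mul analyticOnNhd_const).sub (hA.mul analyticOnNhd_const)) ?_
      filter_upwards [Metric.ball_mem_nhds (0 : ℂ) hr2] with z hz using hr.addition z hz w hw
    exact congrFun this z
  have : (fun w => σ (z + w) * σ (z - w)) =
        fun w => σ z ^ 2 * sigmaA σ w - sigmaA σ z * σ w ^ 2 := by
    refine AnalyticOnNhd.eq_of_eventuallyEq (z₀ := 0) (entire_analytic
      ((h.entire.comp (differentiable_id.const_add z)).mul
        (h.entire.comp (differentiable_id.const_sub z))))
      ((analyticOnNhd_const.mul hA).sub (analyticOnNhd_const.mul (hσ.pow 2))) ?_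
    filter_upwards [Metric.ball_mem_nhds (0 : ℂ) hr2] with w hw using step1 w hw z
  exact congrFun this w

theorem unique {τ : ℂ → ℂ} (h : IsWeierstrassSigma g₂ g₃ σ) (h' : IsWeierstrassSigma g₂ g₃ τ) :
    σ = τ := by
  obtain ⟨r, hr⟩ := h.exists_isSigmaOn
  obtain ⟨r', hr'⟩ := h'.exists_isSigmaOn
  refine AnalyticOnNhd.eq_of_eventuallyEq (z₀ := 0) (entire_analytic h.entire)
    (entire_analytic h'.entire) (sigma_germ_unique (g₂ := g₂) (g₃ := g₃) (h.analyticAt 0)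
      (h'.analyticAt 0) h.map_zero h'.map_zero h.deriv_zero h'.deriv_zero h.deriv_deriv_zero
      h'.deriv_deriv_zero ?_ ?_)
  · filter_upwards [mem_nhdsWithin_of_mem_nhds (Metric.ball_mem_nhds (0 : ℂ) hr.pos),
        self_mem_nhdsWithin] with z hz hz0 using hr.ode z hz hz0
  · filter_upwards [mem_nhdsWithin_of_mem_nhds (Metric.ball_mem_nhds (0 : ℂ) hr'.pos),
        self_mem_nhdsWithin] with z hz hz0 using hr'.ode z hz hz0

end IsWeierstrassSigma

/-! ### The values of `℘` -/

namespace IsWeierstrassSigma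
variable {g₂ g₃ : ℝ} {σ : ℂ → ℂ}

theorem not_eventually_zero (h : IsWeierstrassSigma g₂ g₃ σ) (z : ℂ) :
    ¬ ∀ᶠ u in nhds z, σ u = 0 := by
  intro hz
  have := AnalyticOnNhd.eq_of_eventuallyEq (z₀ := z) (entire_analytic h.entire)
    (entire_analytic (differentiable_const (0 : ℂ))) hz
  have h1 := h.deriv_zero
  rw [this] at h1
  simp at h1

theorem eventually_ne_zero (h : IsWeierstrassSigma g₂ g₃ σ) (z : ℂ) :
    ∀ᶠ u in nhdsWithin z {z}ᶜ, σ u ≠ 0 :=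
  ((h.analyticAt z).eventually_eq_zero_or_eventually_ne_zero).resolve_left (h.not_eventually_zero z)

/-- At a zero of order k the function ℘ has leading term k (z - z₀)⁻². Comparing leading
coefficients in the first-order equation gives 4 k² = 4 k³, hence k = 1. -/
theorem deriv_ne_zero_of_eq_zero (h : IsWeierstrassSigma g₂ g₃ σ) {z₀ : ℂ} (hz : σ z₀ = 0) :
    deriv σ z₀ ≠ 0 := by
  obtain ⟨k, e, r, hr, he, hen, hs⟩ := exists_factor_at (h.analyticAt z₀) (h.not_eventually_zero z₀)
  have hm : z₀ ∈ Metric.ball z₀ r := Metric.mem_ball_self hr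
  have hfac := wP_of_factor he hen hs
  have hk0 : k ≠ 0 := by
    rintro rfl
    have := hs z₀ hm
    rw [hz, pow_zero, one_mul] at this
    exact hen z₀ hm this.symm
  have hq := analyticAt_wP (he z₀ hm) (hen z₀ hm)
  set q := wP e with hqdef
  have key : ∀ᶠ z in nhdsWithin z₀ {z₀}ᶜ, (-2 * k + (z - z₀) ^ 3 * deriv q z) ^ 2
      - (4 * (k + (z - z₀) ^ 2 * q z) ^ 3 - g₂ * (z - z₀) ^ 4 * (k + (z - z₀) ^ 2 * q z)
        - g₃ * (z - z₀) ^ 6) = 0 := by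
    filter_upwards [mem_nhdsWithin_of_mem_nhds (Metric.isOpen_ball.mem_nhds hm),
      self_mem_nhdsWithin, h.eventually_ne_zero z₀] with z hzb hz0 hσ
    have ho := h.ode z hσ
    obtain ⟨-, h1, h2⟩ := hfac z hzb hz0
    rw [h1, h2] at ho
    have hne : z - z₀ ≠ 0 := sub_ne_zero.2 hz0
    field_simp at ho
    linear_combination ho
  have hlim : ContinuousAt (fun z => (-2 * (k : ℂ) + (z - z₀) ^ 3 * deriv q z) ^ 2
      - (4 * (k + (z - z₀) ^ 2 * q z) ^ 3 - g₂ * (z - z₀) ^ 4 * (k + (z - z₀) ^ 2 * q z)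
        - g₃ * (z - z₀) ^ 6)) z₀ := by
    have c1 := hq.continuousAt
    have c2 := hq.deriv.continuousAt
    fun_prop
  have h0 := tendsto_nhds_unique (hlim.tendsto.mono_left nhdsWithin_le_nhds)
    (Filter.Tendsto.congr' (Filter.EventuallyEq.symm key) tendsto_const_nhds)
  have hkc : (k : ℂ) ≠ 0 := Nat.cast_ne_zero.2 hk0
  have hk1 : (k : ℂ) = 1 := by
    simp at h0
    apply mul_left_cancel₀ (pow_ne_zero 2 hkc)
    linear_combination -h0 / 4
  have hk : k = 1 := by exact_mod_cast hk1
  subst hk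
  have ev : σ =ᶠ[nhds z₀] fun z => (z - z₀) * e z := by
    filter_upwards [Metric.isOpen_ball.mem_nhds hm] with u hu
    rw [hs u hu, pow_one]
  rw [ev.deriv_eq, (((hasDerivAt_id' z₀).sub_const z₀).fun_mul
    (he z₀ hm).differentiableAt.hasDerivAt).deriv]
  simpa using hen z₀ hm

theorem duplication (h : IsWeierstrassSigma g₂ g₃ σ) (z : ℂ) :
    σ (2 * z) = -(σ z * sigmaB σ z) := by
  obtain ⟨r, hr⟩ := h.exists_isSigmaOn
  have hσ := entire_analytic h.entire
  have hB : AnalyticOnNhd ℂ (sigmaB σ) univ := fun z _ => analyticAt_sigmaB (h.analyticAt z)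
  have : (fun z => σ (2 * z)) = fun z => -(σ z * sigmaB σ z) := by
    refine AnalyticOnNhd.eq_of_eventuallyEq (z₀ := 0) (entire_analytic
      (h.entire.comp (differentiable_id.const_mul 2))) (hσ.mul hB).neg ?_
    filter_upwards [Metric.ball_mem_nhds (0 : ℂ) (half_pos hr.pos)] with z hz using
      hr.duplication z hz
  exact congrFun this z

theorem norm_derivs_le {f : ℂ → ℂ} (h : Differentiable ℂ f) {z : ℂ} {b : ℝ}
    (hb : ∀ u, ‖u - z‖ ≤ 1 → ‖f u‖ ≤ b) :
    ‖f z‖ ≤ b ∧ ‖deriv f z‖ ≤ b ∧ ‖deriv (deriv f) z‖ ≤ 2 * b ∧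
      ‖deriv (deriv (deriv f)) z‖ ≤ 6 * b := by
  have key : ∀ n : ℕ, ‖iteratedDeriv n f z‖ ≤ n.factorial * b := by
    intro n
    have := Complex.norm_iteratedDeriv_le_of_forall_mem_sphere_norm_le n one_pos
      (h.diffContOnCl (s := Metric.ball z 1)) (C := b) (fun u hu => hb u (by
        rw [← dist_eq_norm]; exact (Metric.mem_sphere.1 hu).le))
    simpa using this
  refine ⟨hb z (by simp), ?_, ?_, ?_⟩
  · simpa [iteratedDeriv_one] using key 1
  · have := key 2
    simpa [iteratedDeriv_eq_iterate, Nat.factorial] using this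
  · have := key 3
    simpa [iteratedDeriv_eq_iterate, Nat.factorial] using this

/-- This is the bound |σ| ≤ exp(C |z|²) on dyadic discs. Halving takes the radius 2^(n + 1) + 2 to
2^n + 1, which leaves room for Cauchy's estimates on unit discs. If b bounds σ there, duplication
gives |σ(z)| ≤ 14 b⁴, and the division by 3 absorbs the constant since 14 / 81 ≤ 1 / 3. -/
theorem growth (h : IsWeierstrassSigma g₂ g₃ σ) : ∃ K : ℝ, 3 ≤ K ∧
    ∀ (n : ℕ) (z : ℂ), ‖z‖ ≤ 2 ^ n + 2 → ‖σ z‖ ≤ K ^ (4 ^ n) / 3 := by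
  obtain ⟨C, hC⟩ := (isCompact_closedBall (0 : ℂ) 3).exists_bound_of_continuousOn
    h.entire.continuous.continuousOn
  refine ⟨max 3 (3 * C), le_max_left _ _, ?_⟩
  set K : ℝ := max 3 (3 * C) with hK
  have hK3 : 3 ≤ K := le_max_left _ _
  intro n
  induction n with
  | zero =>
    intro z hz
    have h1 := hC z (by simp only [mem_closedBall_zero_iff]; norm_num at hz; linarith)
    have h2 : 3 * C ≤ K := le_max_right _ _
    simp only [pow_zero, pow_one]
    linarith
  | succ n ih =>
    intro z hz
    set b : ℝ := K ^ (4 ^ n) / 3 with hb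
    have hb0 : 0 ≤ b := by positivity
    have hzn : ‖z / 2‖ ≤ 2 ^ n + 1 := by
      rw [norm_div, RCLike.norm_ofNat]
      rw [pow_succ] at hz
      linarith
    obtain ⟨d0, d1, d2, d3⟩ := norm_derivs_le h.entire (z := z / 2) (b := b) (fun u hu => by
      refine ih u ?_
      have := norm_add_le (u - z / 2) (z / 2)
      rw [sub_add_cancel] at this
      linarith)
    have hdup := h.duplication (z / 2)
    rw [show 2 * (z / 2) = z by ring] at hdup
    rw [hdup, norm_neg, norm_mul]
    have hBn : ‖sigmaB σ (z / 2)‖ ≤ 14 * b ^ 3 := by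
      unfold sigmaB
      set s0 := σ (z / 2)
      set s1 := deriv σ (z / 2)
      set s2 := deriv (deriv σ) (z / 2)
      set s3 := deriv (deriv (deriv σ)) (z / 2)
      have e1 : ‖-(s0 ^ 2 * s3)‖ ≤ b ^ 2 * (6 * b) := by
        rw [norm_neg, norm_mul, norm_pow]
        gcongr
      have e2 : ‖3 * s0 * s1 * s2‖ ≤ 3 * b * b * (2 * b) := by
        rw [norm_mul, norm_mul, norm_mul, RCLike.norm_ofNat]
        gcongr
      have e3 : ‖2 * s1 ^ 3‖ ≤ 2 * b ^ 3 := by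
        rw [norm_mul, norm_pow, RCLike.norm_ofNat]
        gcongr
      calc _ ≤ ‖-(s0 ^ 2 * s3) + 3 * s0 * s1 * s2‖ + ‖2 * s1 ^ 3‖ := norm_sub_le _ _
        _ ≤ ‖-(s0 ^ 2 * s3)‖ + ‖3 * s0 * s1 * s2‖ + ‖2 * s1 ^ 3‖ := by gcongr; exact norm_add_le _ _
        _ ≤ b ^ 2 * (6 * b) + 3 * b * b * (2 * b) + 2 * b ^ 3 := by gcongr
        _ = 14 * b ^ 3 := by ring
    calc ‖σ (z / 2)‖ * ‖sigmaB σ (z / 2)‖ ≤ b * (14 * b ^ 3) := by gcongr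
      _ = 14 / 81 * K ^ (4 ^ (n + 1)) := by rw [hb, pow_succ 4 n, pow_mul]; ring
      _ ≤ K ^ (4 ^ (n + 1)) / 3 := by
        have : 0 ≤ K ^ (4 ^ (n + 1)) := by positivity
        linarith

end IsWeierstrassSigma

/-- A zero-free entire function of growth at most `exp (C |z|²)` is the exponential of a
polynomial of degree at most two. -/
theorem exists_log_quadratic {G : ℂ → ℂ} (hG : Differentiable ℂ G) (hne : ∀ z, G z ≠ 0)
    (h0 : G 0 = 1) {C : ℝ} (hC : 0 < C)
    (hgrow : ∀ (n : ℕ) (z : ℂ), ‖z‖ ≤ 2 ^ n → Real.log ‖G z‖ ≤ C * 4 ^ n) :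
    ∃ (L : ℂ → ℂ) (κ : ℂ), (∀ z, HasDerivAt L (deriv G z / G z) z) ∧
      ∀ z, deriv (deriv L) z = κ := by
  have hq : Differentiable ℂ fun z => deriv G z / G z := fun z =>
    ((hG.analyticAt z).deriv.div (hG.analyticAt z) (hne z)).differentiableAt
  obtain ⟨L, hL0, hL⟩ : ∃ L : ℂ → ℂ, L 0 = 0 ∧ ∀ z ∈ univ, HasDerivAt L (deriv G z / G z) z := by
    obtain ⟨L, a, b⟩ := hq.isExactOn_univ.with_val_at 0 0
    exact ⟨L, a, b⟩
  have hLd : Differentiable ℂ L := fun z => (hL z trivial).differentiableAt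
  have hexp : ∀ z, Complex.exp (L z) = G z := by
    intro z
    have hd : ∀ u, HasDerivAt (fun u => G u * Complex.exp (-L u)) 0 u := by
      intro u
      refine ((hG u).hasDerivAt.fun_mul (hL u trivial).fun_neg.cexp).congr_deriv ?_
      have := hne u
      field_simp
      ring
    have := is_const_of_deriv_eq_zero (fun u => (hd u).differentiableAt)
      (fun u => (hd u).deriv) z 0
    simp only [h0, hL0, neg_zero, Complex.exp_zero, mul_one] at this
    rw [Complex.exp_neg] at this
    have hne' := Complex.exp_ne_zero (L z)
    field_simp at this
    exact this.symm
  have hre : ∀ z, (L z).re = Real.log ‖G z‖ := by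
    intro z
    rw [← hexp z, Complex.norm_exp, Real.log_exp]
  -- The Borel–Carathéodory inequality on the disc of radius 2ⁿ, applied within half that radius.
  have hbound : ∀ (n : ℕ) (z : ℂ), ‖z‖ ≤ 2 ^ n / 2 → ‖L z‖ ≤ 2 * (C * 4 ^ n) := by
    intro n z hz
    have hpos : (0 : ℝ) < 2 ^ n := by positivity
    have hM : 0 < C * 4 ^ n := by positivity
    have hzl : ‖z‖ < 2 ^ n := by linarith
    have := Complex.borelCaratheodory_zero (M := C * 4 ^ n) (R := 2 ^ n) (f := L) (z := z) hM
      hLd.differentiableOn (fun u hu => by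
        simp only [mem_ofPred_eq]
        rw [hre]
        exact hgrow n u (mem_ball_zero_iff.1 hu).le) hpos (by simpa using hzl) hL0
    refine this.trans ?_
    rw [div_le_iff₀ (by linarith)]
    nlinarith
  -- Cauchy's estimate on circles of radius 2ⁿ / 4 is of order 4ⁿ / 8ⁿ, with 768 = 3! · 2 · 4³.
  have h3 : ∀ z, iteratedDeriv 3 L z = 0 := by
    intro z
    have hev : ∀ᶠ n : ℕ in Filter.atTop, ‖iteratedDeriv 3 L z‖ ≤ 768 * C * (1 / 2) ^ n := by
      obtain ⟨n₀, hn₀⟩ := pow_unbounded_of_one_lt (4 * ‖z‖) (one_lt_two (α := ℝ))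
      filter_upwards [Filter.eventually_ge_atTop n₀] with n hn
      have hnz : 4 * ‖z‖ ≤ 2 ^ n := hn₀.le.trans (by gcongr; norm_num)
      have hR : (0 : ℝ) < 2 ^ n / 4 := by positivity
      have := Complex.norm_iteratedDeriv_le_of_forall_mem_sphere_norm_le 3 hR
        (hLd.diffContOnCl (s := Metric.ball z (2 ^ n / 4))) (C := 2 * (C * 4 ^ n)) (fun u hu => by
          refine hbound n u ?_
          have h1 : ‖u - z‖ = 2 ^ n / 4 := by rw [← dist_eq_norm]; exact Metric.mem_sphere.1 hu
          have h2 := norm_add_le (u - z) z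
          rw [sub_add_cancel] at h2
          linarith)
      refine this.trans (le_of_eq ?_)
      have h4 : (4 : ℝ) ^ n = 2 ^ n * 2 ^ n := by rw [← mul_pow]; norm_num
      have h2 : (2 : ℝ) ^ n ≠ 0 := by positivity
      rw [h4, one_div, inv_pow]
      simp only [Nat.factorial]
      push_cast
      field_simp
      norm_num
    have hlim : Filter.Tendsto (fun n : ℕ => 768 * C * (1 / 2 : ℝ) ^ n) Filter.atTop (nhds 0) := by
      have := (tendsto_pow_atTop_nhds_zero_of_lt_one (r := (1 / 2 : ℝ)) (by norm_num)
        (by norm_num)).const_mul (768 * C)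
      simpa using this
    exact norm_le_zero_iff.1 (ge_of_tendsto hlim hev)
  have hd2 : Differentiable ℂ (deriv (deriv L)) := fun z =>
    (hLd.analyticAt z).deriv.deriv.differentiableAt
  refine ⟨L, deriv (deriv L) 0, fun z => hL z trivial, fun z => ?_⟩
  refine is_const_of_deriv_eq_zero hd2 (fun u => ?_) z 0
  have := h3 u
  simpa [iteratedDeriv_eq_iterate] using this

namespace IsWeierstrassSigma
variable {g₂ g₃ : ℝ} {σ : ℂ → ℂ}

/-- `℘` takes every value that is not a multiple root of the cubic polynomial. -/
theorem exists_wP_eq (h : IsWeierstrassSigma g₂ g₃ σ) (x : ℂ)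
    (hx : 4 * x ^ 3 - g₂ * x - g₃ ≠ 0 ∨ 12 * x ^ 2 - g₂ ≠ 0) :
    ∃ z, σ z ≠ 0 ∧ wP σ z = x := by
  by_contra hcon
  push Not at hcon
  -- G is σ² (℘ - x), continued over the zeros of σ, where it equals σ'² ≠ 0. As ℘ is supposed to
  -- omit x, G has no zero at all.
  set G : ℂ → ℂ := fun z => sigmaA σ z - x * σ z ^ 2 with hGdef
  have hGne : ∀ z, G z ≠ 0 := by
    intro z hz
    by_cases h0 : σ z = 0
    · simp only [hGdef, sigmaA, h0] at hz
      have h1 := h.deriv_ne_zero_of_eq_zero h0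
      apply pow_ne_zero 2 h1
      linear_combination hz
    · apply hcon z h0
      rw [wP_eq (h.analyticAt z) h0, div_eq_iff (pow_ne_zero 2 h0)]
      linear_combination hz
  have hGd : Differentiable ℂ G := fun z => ((analyticAt_sigmaA (h.analyticAt z)).sub
    (analyticAt_const.mul ((h.analyticAt z).pow 2))).differentiableAt
  have hG0 : G 0 = 1 := by simp [hGdef, h.sigmaA_zero, h.map_zero]
  obtain ⟨K, hK3, hK⟩ := h.growth
  have hgr : ∀ (n : ℕ) (z : ℂ), ‖z‖ ≤ 2 ^ n →
      Real.log ‖G z‖ ≤ (Real.log (3 + ‖x‖) + 2 * Real.log K) * 4 ^ n := by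
    intro n z hz
    obtain ⟨b, hb⟩ : ∃ b : ℝ, b = K ^ (4 ^ n) := ⟨_, rfl⟩
    have hb0 : 0 < b := by rw [hb]; positivity
    obtain ⟨d0, d1, d2, -⟩ := norm_derivs_le h.entire (z := z) (b := b) (fun u hu => by
      have h2 := norm_add_le (u - z) z
      rw [sub_add_cancel] at h2
      have := hK n u (by linarith)
      rw [hb]
      have : 0 ≤ K ^ (4 ^ n) := by positivity
      linarith)
    have hGb : ‖G z‖ ≤ (3 + ‖x‖) * b ^ 2 := by
      simp only [hGdef, sigmaA]
      calc _ ≤ ‖deriv σ z ^ 2‖ + ‖σ z * deriv (deriv σ) z‖ + ‖x * σ z ^ 2‖ :=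
            (norm_sub_le _ _).trans (by gcongr; exact norm_sub_le _ _)
        _ ≤ b ^ 2 + b * (2 * b) + ‖x‖ * b ^ 2 := by
            rw [norm_pow, norm_mul, norm_mul, norm_pow]
            gcongr
        _ = (3 + ‖x‖) * b ^ 2 := by ring
    have hx0 : 0 ≤ ‖x‖ := norm_nonneg x
    have hlx : 0 ≤ Real.log (3 + ‖x‖) := Real.log_nonneg (by linarith)
    calc Real.log ‖G z‖ ≤ Real.log ((3 + ‖x‖) * b ^ 2) :=
          Real.log_le_log (norm_pos_iff.2 (hGne z)) hGb
      _ = Real.log (3 + ‖x‖) + 2 * (4 ^ n * Real.log K) := by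
          rw [Real.log_mul (by positivity) (by positivity), Real.log_pow, hb, Real.log_pow]
          push_cast
          ring
      _ ≤ Real.log (3 + ‖x‖) * 4 ^ n + 2 * (4 ^ n * Real.log K) := by
          gcongr
          exact le_mul_of_one_le_right hlx (one_le_pow₀ (by norm_num))
      _ = _ := by ring
  obtain ⟨L, κ, hL, hκ⟩ := exists_log_quadratic hGd hGne hG0
    (C := Real.log (3 + ‖x‖) + 2 * Real.log K) (by
      have : 0 < Real.log K := Real.log_pos (by linarith)
      have : 0 ≤ Real.log (3 + ‖x‖) := Real.log_nonneg (by linarith [norm_nonneg x])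
      linarith) hgr
  -- the quadratic polynomial that vanishes along `℘`
  have hLd : ∀ z, σ z ≠ 0 → deriv L z = 2 * wZeta σ z + deriv (wP σ) z / (wP σ z - x) := by
    intro z hz
    have ha := h.analyticAt z
    have hX : wP σ z - x ≠ 0 := sub_ne_zero.2 (hcon z hz)
    have ev : G =ᶠ[nhds z] fun u => σ u ^ 2 * (wP σ u - x) := by
      filter_upwards [ha.continuousAt.eventually_ne hz] with u hu
      simp only [hGdef]
      rw [wP_eq (h.analyticAt u) hu]
      field_simp
    rw [(hL z).deriv, ev.deriv_eq, ev.eq_of_nhds, (((hasDerivAt_sigma ha hz).fun_pow 2).fun_mul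
      ((hasDerivAt_wP ha hz).sub_const x)).deriv]
    push_cast
    field_simp
  -- This is (log G)'' = κ times (℘ - x)², with ℘'² and ℘'' replaced by polynomials in ℘; the cubic
  -- terms cancel.
  have hquad : ∀ z, σ z ≠ 0 → (-2 * x - κ) * wP σ z ^ 2
      + (g₂ / 2 - 2 * x ^ 2 + 2 * κ * x) * wP σ z + (g₂ * x / 2 + g₃ - κ * x ^ 2) = 0 := by
    intro z hz
    have ha := h.analyticAt z
    have hX : wP σ z - x ≠ 0 := sub_ne_zero.2 (hcon z hz)
    have ev : deriv L =ᶠ[nhds z] fun z => 2 * wZeta σ z + deriv (wP σ) z / (wP σ z - x) := by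
      filter_upwards [ha.continuousAt.eventually_ne hz] with u hu using hLd u hu
    have hk := hκ z
    rw [ev.deriv_eq, (((hasDerivAt_wZeta ha hz).const_mul 2).fun_add
      ((h.hasDerivAt_deriv_wP hz).fun_div ((hasDerivAt_wP ha hz).sub_const x) hX)).deriv] at hk
    have ho := h.ode z hz
    field_simp at hk
    linear_combination hk / 2 + ho
  have hB : ContinuousAt (sigmaB σ) 0 := (analyticAt_sigmaB (h.analyticAt 0)).continuousAt
  obtain ⟨z, hz, hBz⟩ := ((h.eventually_ne_zero 0).and
    ((hB.eventually_ne (y := 0) (by rw [h.sigmaB_zero]; norm_num)).filter_mono nhdsWithin_le_nhds)).exists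
  have hy : ∀ u, σ u ≠ 0 → sigmaB σ u ≠ 0 → deriv (wP σ) u ≠ 0 := by
    intro u hu hBu
    rw [deriv_wP_eq (h.analyticAt u) hu]
    exact div_ne_zero hBu (pow_ne_zero 3 hu)
  have hσc : ∀ᶠ u in nhds z, σ u ≠ 0 := (h.analyticAt z).continuousAt.eventually_ne hz
  have hBc : ∀ᶠ u in nhds z, sigmaB σ u ≠ 0 :=
    (analyticAt_sigmaB (h.analyticAt z)).continuousAt.eventually_ne hBz
  obtain ⟨a, ha⟩ : ∃ a, a = -2 * x - κ := ⟨_, rfl⟩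
  obtain ⟨b, hb⟩ : ∃ b, b = g₂ / 2 - 2 * x ^ 2 + 2 * κ * x := ⟨_, rfl⟩
  obtain ⟨c, hc⟩ : ∃ c, c = g₂ * x / 2 + g₃ - κ * x ^ 2 := ⟨_, rfl⟩
  rw [← ha, ← hb, ← hc] at hquad
  -- A quadratic polynomial vanishing along the non-constant ℘ has only zero coefficients; this is
  -- seen by differentiating at points where ℘' ≠ 0.
  have h1 : ∀ u, σ u ≠ 0 → sigmaB σ u ≠ 0 → 2 * a * wP σ u + b = 0 := by
    intro u hu hBu
    have ev : (fun z => a * wP σ z ^ 2 + b * wP σ z + c) =ᶠ[nhds u] fun _ => 0 := by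
      filter_upwards [(h.analyticAt u).continuousAt.eventually_ne hu] with v hv using hquad v hv
    have dx := hasDerivAt_wP (h.analyticAt u) hu
    have := ((((dx.fun_pow 2).const_mul a).fun_add (dx.const_mul b)).add_const c).unique
      ((hasDerivAt_const u (0 : ℂ)).congr_of_eventuallyEq ev)
    apply mul_right_cancel₀ (hy u hu hBu)
    push_cast at this
    linear_combination this
  have h2 : a = 0 := by
    have ev : (fun z => 2 * a * wP σ z + b) =ᶠ[nhds z] fun _ => 0 := by
      filter_upwards [hσc, hBc] with v hv hv' using h1 v hv hv'
    have dx := hasDerivAt_wP (h.analyticAt z) hz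
    have := ((dx.const_mul (2 * a)).add_const b).unique
      ((hasDerivAt_const z (0 : ℂ)).congr_of_eventuallyEq ev)
    simpa [hy z hz hBz] using this
  have h3 : b = 0 := by simpa [h2] using h1 z hz hBz
  have h4 : c = 0 := by simpa [h2, h3] using hquad z hz
  rw [h2] at ha
  rw [h3] at hb
  rw [h4] at hc
  -- Now κ = -2 x, and the other two coefficients say that g₂ = 12 x² and P(x) = 0: x is a multiple
  -- root.
  have hg2 : (g₂ : ℂ) = 12 * x ^ 2 := by linear_combination -2 * hb - 4 * x * ha
  rcases hx with hx | hx
  · apply hx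
    linear_combination hc - x ^ 2 * ha - (x / 2) * hg2
  · exact hx (by rw [hg2]; ring)

end IsWeierstrassSigma

/-! ### Parity -/

namespace IsWeierstrassSigma
variable {g₂ g₃ : ℝ} {σ : ℂ → ℂ}

theorem deriv_neg (h : IsWeierstrassSigma g₂ g₃ σ) (z : ℂ) : deriv σ (-z) = deriv σ z := by
  have : (fun z => σ (-z)) = fun z => -σ z := funext h.odd
  have h1 := congrFun (congrArg deriv this) z
  rw [deriv_comp_neg, deriv.fun_neg] at h1
  exact neg_injective h1

theorem wZeta_neg (h : IsWeierstrassSigma g₂ g₃ σ) (z : ℂ) : wZeta σ (-z) = -wZeta σ z := by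
  unfold wZeta
  rw [h.deriv_neg, h.odd, div_neg]

theorem wP_neg (h : IsWeierstrassSigma g₂ g₃ σ) (z : ℂ) : wP σ (-z) = wP σ z := by
  have : (fun z => wZeta σ (-z)) = fun z => -wZeta σ z := funext h.wZeta_neg
  have h1 := congrFun (congrArg deriv this) z
  rw [deriv_comp_neg, deriv.fun_neg] at h1
  unfold wP
  rw [neg_injective h1]

theorem deriv_wP_neg (h : IsWeierstrassSigma g₂ g₃ σ) (z : ℂ) :
    deriv (wP σ) (-z) = -deriv (wP σ) z := by
  have : (fun z => wP σ (-z)) = fun z => wP σ z := funext h.wP_neg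
  have h1 := congrFun (congrArg deriv this) z
  rw [deriv_comp_neg] at h1
  rw [← h1, neg_neg]

end IsWeierstrassSigma

/-! ### Potentials -/

/-- Grönwall's inequality on compact subintervals starting at s₀; the part to the left of s₀ is
reflected. All uniqueness statements for differential equations on I rest on it. -/
theorem eq_zero_of_norm_deriv_le {E : Type*} [NormedAddCommGroup E] [NormedSpace ℝ E]
    {I : Set ℝ} (hc : I.OrdConnected) {f f' : ℝ → E} {K : ℝ → ℝ}
    (hf : ∀ s ∈ I, HasDerivAt f (f' s) s) (hK : ContinuousOn K I)
    (hb : ∀ s ∈ I, ‖f' s‖ ≤ K s * ‖f s‖) {s₀ : ℝ} (hs₀ : s₀ ∈ I) (h0 : f s₀ = 0) :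
    ∀ s ∈ I, f s = 0 := by
  intro s hs
  rcases le_total s₀ s with hle | hle
  · have hsub : Icc s₀ s ⊆ I := hc.out hs₀ hs
    obtain ⟨C, hC⟩ := isCompact_Icc.exists_bound_of_continuousOn (hK.mono hsub)
    refine eq_zero_of_abs_deriv_le_mul_abs_self_of_eq_zero_right (f' := f') (K := C)
      (fun u hu => (hf u (hsub hu)).continuousAt.continuousWithinAt)
      (fun u hu => (hf u (hsub (Ico_subset_Icc_self hu))).hasDerivWithinAt) h0 (fun u hu => ?_) s
      (right_mem_Icc.2 hle)
    have hu' := Ico_subset_Icc_self hu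
    refine (hb u (hsub hu')).trans ?_
    have := (le_abs_self _).trans (hC u hu')
    gcongr
  · have hsub : Icc s s₀ ⊆ I := hc.out hs hs₀
    obtain ⟨C, hC⟩ := isCompact_Icc.exists_bound_of_continuousOn (hK.mono hsub)
    have hneg : ∀ u ∈ Icc (-s₀) (-s), -u ∈ Icc s s₀ := fun u hu =>
      ⟨by linarith [hu.2], by linarith [hu.1]⟩
    have hd : ∀ u ∈ Icc (-s₀) (-s), HasDerivAt (fun u => f (-u)) (-f' (-u)) u := by
      intro u hu
      have := (hf _ (hsub (hneg u hu))).scomp u (hasDerivAt_neg u)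
      simpa [Function.comp_def] using this
    have := eq_zero_of_abs_deriv_le_mul_abs_self_of_eq_zero_right (f := fun u => f (-u))
      (f' := fun u => -f' (-u)) (K := C) (a := -s₀) (b := -s)
      (fun u hu => (hd u hu).continuousAt.continuousWithinAt)
      (fun u hu => (hd u (Ico_subset_Icc_self hu)).hasDerivWithinAt) (by simpa using h0)
      (fun u hu => ?_) (-s) (right_mem_Icc.2 (by linarith))
    · simpa using this
    · have hu' := hneg u (Ico_subset_Icc_self hu)
      rw [norm_neg]
      refine (hb _ (hsub hu')).trans ?_
      have := (le_abs_self _).trans (hC _ hu')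
      gcongr

namespace IsPotential
variable {I : Set ℝ} {g₂ g₃ : ℝ} {h : ℝ → ℝ}

theorem contDiffOn_deriv (hp : IsPotential I g₂ g₃ h) (hI : IsOpen I) :
    ContDiffOn ℝ (⊤ : ℕ∞) (deriv h) I :=
  hp.smooth.deriv_of_isOpen hI (by simp)

theorem hasDerivAt (hp : IsPotential I g₂ g₃ h) (hI : IsOpen I) {s : ℝ} (hs : s ∈ I) :
    HasDerivAt h (deriv h s) s :=
  ((hp.smooth.differentiableOn (by simp)).differentiableAt (hI.mem_nhds hs)).hasDerivAt

theorem hasDerivAt_deriv' (hp : IsPotential I g₂ g₃ h) (hI : IsOpen I) {s : ℝ} (hs : s ∈ I) :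
    HasDerivAt (deriv h) (deriv (deriv h) s) s :=
  (((hp.contDiffOn_deriv hI).differentiableOn (by simp)).differentiableAt
    (hI.mem_nhds hs)).hasDerivAt

/-- Differentiating h'² = P(h) gives F h' = 0 with F = h'' - 6 h² + g₂ / 2, and a smooth h might be
constant on a subinterval. But F F' = 0: where F ≠ 0, h' vanishes nearby and F is locally a function
of h alone. So F² is constant, and a non-zero value would force h' = 0 on all of I. -/
theorem deriv_deriv (hp : IsPotential I g₂ g₃ h) (hI : IsOpen I) (hc : I.OrdConnected) :
    ∀ s ∈ I, deriv (deriv h) s = 6 * h s ^ 2 - g₂ / 2 := by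
  have h3 : ContDiffOn ℝ (⊤ : ℕ∞) (deriv (deriv h)) I :=
    (hp.contDiffOn_deriv hI).deriv_of_isOpen hI (by simp)
  set F : ℝ → ℝ := fun s => deriv (deriv h) s - 6 * h s ^ 2 + g₂ / 2 with hF
  have hFd : DifferentiableOn ℝ F I :=
    ((h3.differentiableOn (by simp)).sub (((hp.smooth.differentiableOn (by simp)).pow 2).const_mul
      6)).add_const _
  have hmul : ∀ s ∈ I, F s * deriv h s = 0 := by
    intro s hs
    have ev : (fun s => deriv h s ^ 2) =ᶠ[nhds s] fun s => 4 * h s ^ 3 - g₂ * h s - g₃ := by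
      filter_upwards [hI.mem_nhds hs] with u hu using hp.ode u hu
    have d1 := (hp.hasDerivAt_deriv' hI hs).fun_pow 2
    have d0 := hp.hasDerivAt hI hs
    have := d1.unique (((((d0.fun_pow 3).const_mul 4).fun_sub (d0.const_mul g₂)).sub_const
      g₃).congr_of_eventuallyEq ev)
    simp only [hF]
    push_cast at this
    linear_combination this / 2
  have hFF : ∀ s ∈ I, F s * deriv F s = 0 := by
    intro s hs
    by_cases h0 : F s = 0
    · rw [h0, zero_mul]
    · have hev : ∀ᶠ u in nhds s, deriv h u = 0 := by
        filter_upwards [((hFd.differentiableAt (hI.mem_nhds hs)).continuousAt.eventually_ne h0),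
          hI.mem_nhds hs] with u hu huI
        exact (mul_eq_zero.1 (hmul u huI)).resolve_left hu
      have hev2 : ∀ᶠ u in nhds s, deriv (deriv h) u = 0 := by
        filter_upwards [hev.eventually_nhds] with u hu
        have : deriv h =ᶠ[nhds u] fun _ => 0 := hu
        rw [this.deriv_eq, deriv_const]
      have hev3 : F =ᶠ[nhds s] fun u => 0 - 6 * h u ^ 2 + g₂ / 2 := by
        filter_upwards [hev2] with u hu
        simp only [hF, hu]
      rw [hev3.deriv_eq, (((((hp.hasDerivAt hI hs).fun_pow 2).const_mul 6).const_sub 0).add_const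
        (g₂ / 2)).deriv, hev.self_of_nhds]
      simp
  have hd2 : ∀ s ∈ I, HasDerivAt (fun s => F s ^ 2) 0 s := by
    intro s hs
    refine ((hFd.differentiableAt (hI.mem_nhds hs)).hasDerivAt.fun_pow 2).congr_deriv ?_
    push_cast
    linear_combination 2 * hFF s hs
  intro s hs
  by_contra hne
  have hFs : F s ≠ 0 := fun h0 => hne (by simp only [hF] at h0; linear_combination h0)
  have hconst : ∀ u ∈ I, F u ^ 2 = F s ^ 2 := fun u hu =>
    hI.is_const_of_deriv_eq_zero hc.isPreconnected
      (fun v hv => (hd2 v hv).differentiableAt.differentiableWithinAt)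
      (fun v hv => (hd2 v hv).deriv) hu hs
  have hFu : ∀ u ∈ I, deriv h u = 0 := by
    intro u hu
    refine (mul_eq_zero.1 (hmul u hu)).resolve_left fun h0 => ?_
    have := hconst u hu
    rw [h0] at this
    exact hFs (by simpa using this.symm)
  obtain ⟨s₁, hs₁, s₂, hs₂, hn⟩ := hp.nonconst
  exact hn (hI.is_const_of_deriv_eq_zero hc.isPreconnected
    (hp.smooth.differentiableOn (by simp)) (fun v hv => hFu v hv) hs₁ hs₂)

theorem hasDerivAt_deriv (hp : IsPotential I g₂ g₃ h) (hI : IsOpen I) (hc : I.OrdConnected)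
    {s : ℝ} (hs : s ∈ I) : HasDerivAt (deriv h) (6 * h s ^ 2 - g₂ / 2) s := by
  rw [← hp.deriv_deriv hI hc s hs]
  exact hp.hasDerivAt_deriv' hI hs

/-- A potential does not meet a multiple root of the cubic polynomial. -/
theorem ne_of_multiple_root (hp : IsPotential I g₂ g₃ h) (hI : IsOpen I) (hc : I.OrdConnected)
    {c : ℝ} (h1 : cubicP g₂ g₃ c = 0) (h2 : 3 * c ^ 2 - g₂ / 4 = 0) : ∀ s ∈ I, h s ≠ c := by
  intro s₀ hs₀ heq
  have hg2 : g₂ = 12 * c ^ 2 := by linarith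
  have hd0 : deriv h s₀ = 0 := by
    have := hp.ode s₀ hs₀
    rw [heq, h1] at this
    exact pow_eq_zero_iff (two_ne_zero) |>.1 this
  -- As g₂ = 12 c², the point (c, 0) is an equilibrium of the system for (h, h'); a solution through
  -- it is constant.
  have key := eq_zero_of_norm_deriv_le hc (f := fun s => ((h s - c, deriv h s) : ℝ × ℝ))
    (f' := fun s => (deriv h s, 6 * h s ^ 2 - g₂ / 2)) (K := fun s => 1 + 6 * |h s + c|)
    (fun s hs => ((hp.hasDerivAt hI hs).sub_const c).prodMk (hp.hasDerivAt_deriv hI hc hs))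
    (continuousOn_const.add (continuousOn_const.mul
      ((hp.smooth.continuousOn.add continuousOn_const).abs))) (fun s hs => ?_) hs₀
    (by simp [heq, hd0])
  · obtain ⟨s₁, hs₁, s₂, hs₂, hn⟩ := hp.nonconst
    have a := key s₁ hs₁
    have b := key s₂ hs₂
    simp only [Prod.mk_eq_zero] at a b
    apply hn
    linarith [a.1, b.1]
  · have e : 6 * h s ^ 2 - g₂ / 2 = 6 * (h s + c) * (h s - c) := by rw [hg2]; ring
    rw [e, Prod.norm_mk, Prod.norm_mk, norm_mul, norm_mul]
    simp only [Real.norm_eq_abs]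
    have m1 : |h s - c| ≤ max |h s - c| |deriv h s| := le_max_left _ _
    have m2 : |deriv h s| ≤ max |h s - c| |deriv h s| := le_max_right _ _
    have p1 : 0 ≤ max |h s - c| |deriv h s| := (abs_nonneg _).trans m1
    have p2 := abs_nonneg (h s + c)
    have a6 : |(6 : ℝ)| = 6 := by norm_num
    rw [a6]
    refine max_le ?_ ?_
    · nlinarith [mul_nonneg p2 p1]
    · nlinarith [mul_le_mul_of_nonneg_left m1 p2]

/-- The value h(s₁) is not a multiple root, so ℘ attains it, and the sign of z can be chosen so that
℘'(z) = h'(s₁). Then h and ℘(s + α) solve the same second-order equation with the same data. The set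
where both agree together with their derivatives is open by uniqueness, and closed in I because a
pole cannot be reached while h stays finite. -/
theorem exists_isShift (hp : IsPotential I g₂ g₃ h) (hI : IsOpen I) (hc : I.OrdConnected)
    {σ : ℂ → ℂ} (hσ : IsWeierstrassSigma g₂ g₃ σ) : ∃ α, IsShift I h σ α := by
  obtain ⟨s₁, hs₁, -⟩ := hp.nonconst
  have hnd : (4 * ((h s₁ : ℝ) : ℂ) ^ 3 - g₂ * (h s₁ : ℝ) - g₃ ≠ 0) ∨
      12 * ((h s₁ : ℝ) : ℂ) ^ 2 - g₂ ≠ 0 := by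
    by_contra hcon
    push Not at hcon
    refine hp.ne_of_multiple_root hI hc (c := h s₁) ?_ ?_ s₁ hs₁ rfl
    · have : ((cubicP g₂ g₃ (h s₁) : ℝ) : ℂ) = 0 := by
        rw [← hcon.1]; unfold cubicP; push_cast; ring
      exact_mod_cast this
    · have : ((12 * h s₁ ^ 2 - g₂ : ℝ) : ℂ) = 0 := by
        rw [← hcon.2]; push_cast; ring
      have : 12 * h s₁ ^ 2 - g₂ = 0 := by exact_mod_cast this
      linarith
  obtain ⟨z, hz, hzx, hzy⟩ : ∃ z, σ z ≠ 0 ∧ wP σ z = (h s₁ : ℝ) ∧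
      deriv (wP σ) z = (deriv h s₁ : ℝ) := by
    obtain ⟨z, hz, hx⟩ := hσ.exists_wP_eq _ hnd
    have hy : deriv (wP σ) z ^ 2 = ((deriv h s₁ : ℝ) : ℂ) ^ 2 := by
      rw [hσ.ode z hz, hx]
      have := hp.ode s₁ hs₁
      unfold cubicP at this
      exact_mod_cast this.symm
    rcases sq_eq_sq_iff_eq_or_eq_neg.1 hy with hy | hy
    · exact ⟨z, hz, hx, hy⟩
    · exact ⟨-z, by rw [hσ.odd]; exact neg_ne_zero.2 hz, by rw [hσ.wP_neg, hx],
        by rw [hσ.deriv_wP_neg, hy, neg_neg]⟩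
  refine ⟨z - s₁, ?_⟩
  set α : ℂ := z - s₁ with hα
  have hcont : Continuous fun s : ℝ => (s : ℂ) + α := by fun_prop
  have dx : ∀ s : ℝ, σ (s + α) ≠ 0 →
      HasDerivAt (fun s : ℝ => wP σ (s + α)) (deriv (wP σ) (s + α)) s := by
    intro s hs
    have := (hasDerivAt_wP (hσ.analyticAt _) hs).comp_add_const (s : ℂ) α
    exact this.comp_ofReal
  have dy : ∀ s : ℝ, σ (s + α) ≠ 0 → HasDerivAt (fun s : ℝ => deriv (wP σ) (s + α))
      (6 * wP σ (s + α) ^ 2 - g₂ / 2) s := by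
    intro s hs
    have := (hσ.hasDerivAt_deriv_wP hs).comp_add_const (s : ℂ) α
    exact this.comp_ofReal
  set u : Set ℝ := {s | s ∈ I ∧ σ (s + α) ≠ 0 ∧ ((h s : ℝ) : ℂ) = wP σ (s + α) ∧
    ((deriv h s : ℝ) : ℂ) = deriv (wP σ) (s + α)} with hu
  have hnear : ∀ s ∈ I, σ (s + α) ≠ 0 → ∃ ε > 0, ∀ t ∈ Metric.ball s ε, t ∈ I ∧ σ (t + α) ≠ 0 := by
    intro s hs hs0
    exact Metric.eventually_nhds_iff_ball.1 ((hI.eventually_mem hs).and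
      ((hσ.entire.continuous.comp hcont).continuousAt.eventually_ne hs0))
  have hopen : IsOpen u := by
    rw [isOpen_iff_mem_nhds]
    rintro s ⟨hs, hs0, hsx, hsy⟩
    obtain ⟨ε, hε, hb⟩ := hnear s hs hs0
    have hcx : ContinuousOn (fun t : ℝ => wP σ (t + α)) (Metric.ball s ε) := fun t ht =>
      (dx t (hb t ht).2).continuousAt.continuousWithinAt
    have hch : ContinuousOn (fun t : ℝ => ((h t : ℝ) : ℂ)) (Metric.ball s ε) :=
      Complex.continuous_ofReal.comp_continuousOn (hp.smooth.continuousOn.mono fun t ht => (hb t ht).1)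
    have key := eq_zero_of_norm_deriv_le (convex_ball s ε).ordConnected
      (f := fun t => ((((h t : ℝ) : ℂ) - wP σ (t + α),
        ((deriv h t : ℝ) : ℂ) - deriv (wP σ) (t + α)) : ℂ × ℂ))
      (f' := fun t => (((deriv h t : ℝ) : ℂ) - deriv (wP σ) (t + α),
        ((6 * h t ^ 2 - g₂ / 2 : ℝ) : ℂ) - (6 * wP σ (t + α) ^ 2 - g₂ / 2)))
      (K := fun t => 1 + 6 * ‖((h t : ℝ) : ℂ) + wP σ (t + α)‖)
      (fun t ht => ((hp.hasDerivAt hI (hb t ht).1).ofReal_comp.fun_sub (dx t (hb t ht).2)).prodMk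
        ((hp.hasDerivAt_deriv hI hc (hb t ht).1).ofReal_comp.fun_sub (dy t (hb t ht).2)))
      (continuousOn_const.add (continuousOn_const.mul (hch.add hcx).norm)) (fun t ht => ?_)
      (Metric.mem_ball_self hε) (by simp [hsx, hsy])
    · filter_upwards [Metric.ball_mem_nhds s hε] with t ht
      have := key t ht
      simp only [Prod.mk_eq_zero, sub_eq_zero] at this
      exact ⟨(hb t ht).1, (hb t ht).2, this.1, this.2⟩
    · set X := ((h t : ℝ) : ℂ) with hX
      set Y := wP σ (t + α) with hY
      set dd := ((deriv h t : ℝ) : ℂ) - deriv (wP σ) (t + α)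
      have e : ((6 * h t ^ 2 - g₂ / 2 : ℝ) : ℂ) - (6 * Y ^ 2 - g₂ / 2) =
          6 * (X + Y) * (X - Y) := by rw [hX]; push_cast; ring
      rw [e, Prod.norm_mk, Prod.norm_mk, norm_mul, norm_mul, RCLike.norm_ofNat]
      have m1 : ‖X - Y‖ ≤ max ‖X - Y‖ ‖dd‖ := le_max_left _ _
      have m2 : ‖dd‖ ≤ max ‖X - Y‖ ‖dd‖ := le_max_right _ _
      have p1 : 0 ≤ max ‖X - Y‖ ‖dd‖ := (norm_nonneg _).trans m1
      have p2 := norm_nonneg (X + Y)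
      refine max_le ?_ ?_
      · nlinarith [mul_nonneg p2 p1]
      · nlinarith [mul_le_mul_of_nonneg_left m1 p2]
  have hsub : I ⊆ u := by
    refine hc.isPreconnected.subset_of_closure_inter_subset hopen ⟨s₁, hs₁, hs₁, ?_, ?_, ?_⟩ ?_
    · simpa [hα] using hz
    · simp [hα, hzx]
    · simp [hα, hzy]
    · rintro s ⟨hsc, hs⟩
      have hfr : ∃ᶠ t in nhds s, t ∈ u := mem_closure_iff_frequently.1 hsc
      have hhc : ContinuousAt (fun t : ℝ => ((h t : ℝ) : ℂ)) s :=
        (hp.hasDerivAt hI hs).ofReal_comp.continuousAt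
      -- On `u` one has σ'² - σ σ'' = h σ². In the limit at a zero of σ this would give σ' = 0, but
      -- the zeros of σ are simple.
      by_cases hs0 : σ (s + α) = 0
      · exfalso
        have hcs : ContinuousAt (fun t : ℝ => σ (t + α)) s :=
          (hσ.entire.continuous.comp hcont).continuousAt
        have hcA : ContinuousAt (fun t : ℝ => sigmaA σ (t + α)) s :=
          ContinuousAt.comp (f := fun t : ℝ => (t : ℂ) + α)
            (analyticAt_sigmaA (hσ.analyticAt _)).continuousAt hcont.continuousAt
        have hcF : ContinuousAt (fun t : ℝ => sigmaA σ (t + α) - (h t : ℝ) * σ (t + α) ^ 2) s :=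
          hcA.sub (hhc.mul (hcs.pow 2))
        have hF0 : sigmaA σ (s + α) - (h s : ℝ) * σ (s + α) ^ 2 = 0 := by
          by_contra hne
          refine hfr ((hcF.eventually_ne hne).mono ?_)
          rintro t ht ⟨-, t0, tx, -⟩
          apply ht
          rw [tx, wP_eq (hσ.analyticAt _) t0]
          field_simp
          ring
        rw [hs0] at hF0
        simp only [sigmaA, hs0] at hF0
        exact pow_ne_zero 2 (hσ.deriv_ne_zero_of_eq_zero hs0) (by linear_combination hF0)
      · have hdc : ContinuousAt (fun t : ℝ => ((deriv h t : ℝ) : ℂ)) s :=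
          (hp.hasDerivAt_deriv hI hc hs).ofReal_comp.continuousAt
        refine ⟨hs, hs0, ?_, ?_⟩
        · by_contra hne
          refine hfr (((hhc.sub (dx s hs0).continuousAt).eventually_ne (sub_ne_zero.2 hne)).mono ?_)
          rintro t ht ⟨-, -, tx, -⟩
          exact ht (sub_eq_zero.2 tx)
        · by_contra hne
          refine hfr (((hdc.sub (dy s hs0).continuousAt).eventually_ne (sub_ne_zero.2 hne)).mono ?_)
          rintro t ht ⟨-, -, -, ty⟩
          exact ht (sub_eq_zero.2 ty)
  exact fun s hs => ⟨(hsub hs).2.1, (hsub hs).2.2.1⟩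

end IsPotential

/-! ### Consequences of the addition theorem -/

/-- The solution `σ(z - w) / σ(z) * exp (z ζ(w))` of Lamé's equation. -/
noncomputable def lameE (σ : ℂ → ℂ) (w z : ℂ) : ℂ := σ (z - w) / σ z * Complex.exp (z * wZeta σ w)

namespace IsWeierstrassSigma
variable {g₂ g₃ : ℝ} {σ : ℂ → ℂ}

theorem addition' (h : IsWeierstrassSigma g₂ g₃ σ) {z w : ℂ} (hz : σ z ≠ 0) (hw : σ w ≠ 0) :
    σ (z + w) * σ (z - w) = σ z ^ 2 * σ w ^ 2 * (wP σ w - wP σ z) := by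
  rw [h.addition, wP_eq (h.analyticAt z) hz, wP_eq (h.analyticAt w) hw]
  field_simp

theorem ne_zero_of_wP_ne (h : IsWeierstrassSigma g₂ g₃ σ) {z w : ℂ} (hz : σ z ≠ 0) (hw : σ w ≠ 0)
    (hne : wP σ z ≠ wP σ w) : σ (z + w) ≠ 0 ∧ σ (z - w) ≠ 0 := by
  have := h.addition' hz hw
  have hr : σ z ^ 2 * σ w ^ 2 * (wP σ w - wP σ z) ≠ 0 :=
    mul_ne_zero (mul_ne_zero (pow_ne_zero 2 hz) (pow_ne_zero 2 hw)) (sub_ne_zero.2 hne.symm)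
  rw [← this] at hr
  exact ⟨left_ne_zero_of_mul hr, right_ne_zero_of_mul hr⟩

/-- The logarithmic derivatives of the addition theorem in z and in w are the sum and the difference
of ζ(z + w) and ζ(z - w). -/
theorem wZeta_add_sub (h : IsWeierstrassSigma g₂ g₃ σ) {z w : ℂ} (hz : σ z ≠ 0) (hw : σ w ≠ 0)
    (hne : wP σ z ≠ wP σ w) :
    wZeta σ (z + w) = wZeta σ z + wZeta σ w
      + (deriv (wP σ) z - deriv (wP σ) w) / (2 * (wP σ z - wP σ w)) ∧
    wZeta σ (z - w) = wZeta σ z - wZeta σ w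
      + (deriv (wP σ) z + deriv (wP σ) w) / (2 * (wP σ z - wP σ w)) := by
  obtain ⟨h1, h2⟩ := h.ne_zero_of_wP_ne hz hw hne
  have hx : wP σ z - wP σ w ≠ 0 := sub_ne_zero.2 hne
  have hadd := h.addition' hz hw
  have ez : (fun z => σ (z + w) * σ (z - w)) =ᶠ[nhds z]
      fun z => σ z ^ 2 * σ w ^ 2 * (wP σ w - wP σ z) := by
    filter_upwards [(h.analyticAt z).continuousAt.eventually_ne hz] with u hu using h.addition' hu hw
  have ew : (fun w => σ (z + w) * σ (z - w)) =ᶠ[nhds w]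
      fun w => σ z ^ 2 * σ w ^ 2 * (wP σ w - wP σ z) := by
    filter_upwards [(h.analyticAt w).continuousAt.eventually_ne hw] with u hu using h.addition' hz hu
  have a1 := hasDerivAt_sigma (h.analyticAt _) h1
  have a2 := hasDerivAt_sigma (h.analyticAt _) h2
  have dz1 := (a1.comp_add_const z w).fun_mul (a2.comp_sub_const z w)
  have dz2 := ((((hasDerivAt_sigma (h.analyticAt z) hz).fun_pow 2).mul_const (σ w ^ 2)).fun_mul
    ((hasDerivAt_wP (h.analyticAt z) hz).const_sub (wP σ w))).congr_of_eventuallyEq ez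
  have dw1 := (a1.comp_const_add z w).fun_mul (a2.comp_const_sub z w)
  have dw2 := ((((hasDerivAt_sigma (h.analyticAt w) hw).fun_pow 2).const_mul (σ z ^ 2)).fun_mul
    ((hasDerivAt_wP (h.analyticAt w) hw).sub_const (wP σ z))).congr_of_eventuallyEq ew
  have ez' := dz1.unique dz2
  have ew' := dw1.unique dw2
  have hK : σ z ^ 2 * σ w ^ 2 ≠ 0 := mul_ne_zero (pow_ne_zero 2 hz) (pow_ne_zero 2 hw)
  have s1 : (wZeta σ (z + w) + wZeta σ (z - w)) * (wP σ z - wP σ w) =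
      2 * wZeta σ z * (wP σ z - wP σ w) + deriv (wP σ) z := by
    apply mul_left_cancel₀ hK
    push_cast at ez'
    linear_combination -ez' + (wZeta σ (z + w) + wZeta σ (z - w)) * hadd
  have s2 : (wZeta σ (z + w) - wZeta σ (z - w)) * (wP σ z - wP σ w) =
      2 * wZeta σ w * (wP σ z - wP σ w) - deriv (wP σ) w := by
    apply mul_left_cancel₀ hK
    push_cast at ew'
    linear_combination -ew' + (wZeta σ (z + w) - wZeta σ (z - w)) * hadd
  constructor
  · field_simp
    linear_combination s1 + s2
  · field_simp
    linear_combination s1 - s2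

theorem lameE_mul (h : IsWeierstrassSigma g₂ g₃ σ) {z w : ℂ} (hz : σ z ≠ 0) (hw : σ w ≠ 0) :
    lameE σ w z * lameE σ (-w) z = -σ w ^ 2 * (wP σ z - wP σ w) := by
  unfold lameE
  rw [h.wZeta_neg, sub_neg_eq_add, mul_neg, Complex.exp_neg]
  have := h.addition' hz hw
  have he := Complex.exp_ne_zero (z * wZeta σ w)
  field_simp
  linear_combination this

theorem analyticAt_lameE (h : IsWeierstrassSigma g₂ g₃ σ) {z : ℂ} (w : ℂ) (hz : σ z ≠ 0) :
    AnalyticAt ℂ (lameE σ w) z := by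
  have h1 : AnalyticAt ℂ (fun z => σ (z - w)) z :=
    (h.entire.comp (differentiable_id.sub_const w)).analyticAt z
  exact (h1.div (h.analyticAt z) hz).mul (analyticAt_id.mul analyticAt_const).cexp

/-- The logarithmic derivative ζ(z - w) - ζ(z) + ζ(w) is rational in ℘ and ℘' by the addition
theorem for ζ. It is the logarithmic derivative of e^φ √(h - c) when ℘(w) = c and ℘'(w) = 2 μ. -/
theorem hasDerivAt_lameE (h : IsWeierstrassSigma g₂ g₃ σ) {z w : ℂ} (hz : σ z ≠ 0) (hw : σ w ≠ 0)
    (hne : wP σ z ≠ wP σ w) :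
    HasDerivAt (lameE σ w) (lameE σ w z *
      ((deriv (wP σ) z + deriv (wP σ) w) / (2 * (wP σ z - wP σ w)))) z := by
  obtain ⟨-, h2⟩ := h.ne_zero_of_wP_ne hz hw hne
  have hζ := (h.wZeta_add_sub hz hw hne).2
  have a2 := (hasDerivAt_sigma (h.analyticAt _) h2).comp_sub_const z w
  refine ((a2.fun_div (hasDerivAt_sigma (h.analyticAt z) hz) hz).fun_mul
    (((hasDerivAt_id' z).mul_const (wZeta σ w)).cexp)).congr_deriv ?_
  have hrw : (deriv (wP σ) z + deriv (wP σ) w) / (2 * (wP σ z - wP σ w)) =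
      wZeta σ (z - w) - wZeta σ z + wZeta σ w := by rw [hζ]; ring
  rw [hrw]
  unfold lameE
  field_simp

theorem lameE_div (h : IsWeierstrassSigma g₂ g₃ σ) {z w : ℂ} (hz : σ z ≠ 0) :
    lameE σ w z / lameE σ (-w) z = sigmaQuotient σ w z := by
  unfold lameE sigmaQuotient
  rw [h.wZeta_neg, sub_neg_eq_add, mul_neg, Complex.exp_neg,
    show 2 * z * wZeta σ w = z * wZeta σ w + z * wZeta σ w by ring, Complex.exp_add]
  have he := Complex.exp_ne_zero (z * wZeta σ w)
  by_cases h1 : σ (z + w) = 0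
  · simp [h1]
  · field_simp

/-- The addition of a half-period. -/
theorem wP_add_halfPeriod (h : IsWeierstrassSigma g₂ g₃ σ) {z w : ℂ} (hz : σ z ≠ 0)
    (hw : σ w ≠ 0) (hne : wP σ z ≠ wP σ w) (hy : deriv (wP σ) w = 0) :
    wP σ (z + w) - wP σ w = (3 * wP σ w ^ 2 - g₂ / 4) / (wP σ z - wP σ w) := by
  have hx : wP σ z - wP σ w ≠ 0 := sub_ne_zero.2 hne
  obtain ⟨h1, -⟩ := h.ne_zero_of_wP_ne hz hw hne
  have dx := hasDerivAt_wP (h.analyticAt z) hz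
  -- The addition theorem for ζ, to be differentiated in z; the first-order equation then eliminates
  -- ℘'(z)².
  have ev : (fun z => wZeta σ (z + w)) =ᶠ[nhds z] fun z => wZeta σ z + wZeta σ w
      + (deriv (wP σ) z - deriv (wP σ) w) / (2 * (wP σ z - wP σ w)) := by
    filter_upwards [(h.analyticAt z).continuousAt.eventually_ne hz,
      dx.continuousAt.eventually_ne hne] with u hu hu' using (h.wZeta_add_sub hu hw hu').1
  have d1 := (hasDerivAt_wZeta (h.analyticAt _) h1).comp_add_const z w
  have d2 := ((((hasDerivAt_wZeta (h.analyticAt z) hz).add_const (wZeta σ w)).fun_add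
    (((h.hasDerivAt_deriv_wP hz).sub_const (deriv (wP σ) w)).fun_div
      ((dx.sub_const (wP σ w)).const_mul 2) (mul_ne_zero two_ne_zero hx)))).congr_of_eventuallyEq ev
  have := d1.unique d2
  rw [hy] at this
  have o1 := h.ode z hz
  have o2 := h.ode w hw
  rw [hy] at o2
  have hfin : wP σ (z + w) = wP σ z - ((6 * wP σ z ^ 2 - g₂ / 2) * (2 * (wP σ z - wP σ w))
      - deriv (wP σ) z * (2 * deriv (wP σ) z)) / (2 * (wP σ z - wP σ w)) ^ 2 := by
    rw [sub_zero] at this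
    linear_combination -this
  rw [hfin]
  field_simp
  linear_combination 8 * (o1 - o2)

end IsWeierstrassSigma

/-! ### Square roots and phases -/

theorem csqrt_sq (x : ℝ) : csqrt x ^ 2 = x := by
  have := Complex.cpow_nat_inv_pow (x : ℂ) (n := 2) two_ne_zero
  unfold csqrt
  rw [one_div]
  exact_mod_cast this

theorem csqrt_ne_zero {x : ℝ} (hx : x ≠ 0) : csqrt x ≠ 0 := by
  intro h
  have := csqrt_sq x
  rw [h] at this
  apply hx
  have h0 : (x : ℂ) = 0 := by rw [← this]; ring
  exact_mod_cast h0

theorem csqrt_of_neg {x : ℝ} (hx : x < 0) : csqrt x = csqrt (-x) * Complex.I := by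
  unfold csqrt
  rw [Complex.ofReal_cpow_of_nonpos hx.le]
  push_cast
  congr 1
  rw [show (Real.pi : ℂ) * Complex.I * (1 / 2) = (Real.pi : ℂ) / 2 * Complex.I by ring,
    Complex.exp_pi_div_two_mul_I]

theorem AnalyticAt.comp_real {f : ℂ → ℂ} {g : ℝ → ℂ} {s : ℝ} (hf : AnalyticAt ℂ f (g s))
    (hg : AnalyticAt ℝ g s) : AnalyticAt ℝ (fun t => f (g t)) s :=
  (hf.restrictScalars (𝕜 := ℝ)).comp hg

theorem analyticAt_ofReal {s : ℝ} : AnalyticAt ℝ (fun t : ℝ => (t : ℂ)) s :=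
  Complex.ofRealCLM.analyticAt s

/-- The negative axis is the branch cut of the complex square root, but along the real line √x = i
√(-x) there, which is analytic. -/
theorem analyticAt_csqrt {x : ℝ} (hx : x ≠ 0) : AnalyticAt ℝ csqrt x := by
  have hpos : ∀ y : ℝ, 0 < y → AnalyticAt ℝ csqrt y := by
    intro y hy
    have h1 : AnalyticAt ℂ (fun z : ℂ => z ^ (1 / 2 : ℂ)) (y : ℂ) :=
      analyticAt_id.cpow analyticAt_const (Or.inl (by simpa using hy))
    exact h1.comp_real (g := fun t : ℝ => (t : ℂ)) analyticAt_ofReal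
  rcases lt_or_gt_of_ne hx with h | h
  · have h1 : AnalyticAt ℝ (fun y => csqrt (-y) * Complex.I) x :=
      (AnalyticAt.fun_comp (f := fun y : ℝ => -y) (hpos _ (by linarith)) analyticAt_id.neg).mul
        analyticAt_const
    refine h1.congr ?_
    filter_upwards [Iio_mem_nhds h] with y hy using (csqrt_of_neg hy).symm
  · exact hpos x h

theorem hasDerivAt_csqrt {x : ℝ} (hx : x ≠ 0) : HasDerivAt csqrt (1 / (2 * csqrt x)) x := by
  have hd := (analyticAt_csqrt hx).differentiableAt.hasDerivAt
  have h1 := hd.fun_pow 2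
  have h2 : HasDerivAt (fun y => csqrt y ^ 2) 1 x := by
    have : (fun y => csqrt y ^ 2) = fun y : ℝ => (y : ℂ) := funext csqrt_sq
    rw [this]
    exact (hasDerivAt_id' (x : ℝ)).ofReal_comp
  have h3 := h1.unique h2
  have h0 := csqrt_ne_zero hx
  refine hd.congr_deriv ?_
  rw [eq_div_iff (mul_ne_zero two_ne_zero h0)]
  push_cast at h3
  linear_combination h3

theorem four_mul_muC_sq (g₂ g₃ c : ℝ) : 4 * muC g₂ g₃ c ^ 2 = cubicP g₂ g₃ c := by
  unfold muC
  linear_combination csqrt_sq (cubicP g₂ g₃ c)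

theorem muC_eq_zero_iff {g₂ g₃ c : ℝ} : muC g₂ g₃ c = 0 ↔ cubicP g₂ g₃ c = 0 := by
  have := four_mul_muC_sq g₂ g₃ c
  constructor
  · intro h
    rw [h] at this
    have h0 : ((cubicP g₂ g₃ c : ℝ) : ℂ) = 0 := by rw [← this]; ring
    exact_mod_cast h0
  · intro h
    rw [h] at this
    simpa using this

section phase
variable {I : Set ℝ} {g₂ g₃ : ℝ} {h : ℝ → ℝ} {c s₀ s : ℝ}

theorem continuousOn_inv_sub (κ : ℂ) (hh : ContinuousOn h I) :
    ContinuousOn (fun u => κ / ((h u - c : ℝ) : ℂ)) (I ∩ {u | h u ≠ c}) := by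
  refine continuousOn_const.div (Complex.continuous_ofReal.comp_continuousOn
    ((hh.mono inter_subset_left).sub continuousOn_const)) fun u hu => ?_
  rw [Complex.ofReal_ne_zero]
  exact sub_ne_zero.2 hu.2

theorem isOpen_inter_ne (hI : IsOpen I) (hh : ContinuousOn h I) (c : ℝ) :
    IsOpen (I ∩ {u | h u ≠ c}) :=
  hh.isOpen_inter_preimage hI isOpen_compl_singleton

theorem hasDerivAt_phase (hI : IsOpen I) (hc : I.OrdConnected) (hh : ContinuousOn h I)
    (hs₀ : s₀ ∈ I) (hs : s ∈ I) (hne : ∀ u ∈ uIcc s₀ s, h u ≠ c) :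
    HasDerivAt (phase g₂ g₃ h c s₀)
      ((if muC g₂ g₃ c = 0 then 1 else muC g₂ g₃ c) / ((h s - c : ℝ) : ℂ)) s := by
  classical
  have hsub : uIcc s₀ s ⊆ I ∩ {u | h u ≠ c} := fun u hu => ⟨hc.uIcc_subset hs₀ hs hu, hne u hu⟩
  have hcont := continuousOn_inv_sub (c := c) (if muC g₂ g₃ c = 0 then 1 else muC g₂ g₃ c) hh
  have hopen := isOpen_inter_ne hI hh c
  have hsm := hsub right_mem_uIcc
  unfold phase
  convert intervalIntegral.integral_hasDerivAt_right ((hcont.mono hsub).intervalIntegrable)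
    (hcont.stronglyMeasurableAtFilter hopen s hsm)
    (hcont.continuousAt (hopen.mem_nhds hsm)) using 1

theorem phase_eq_sub (hc : I.OrdConnected) (hh : ContinuousOn h I)
    (hs₀ : s₀ ∈ I) (hs : s ∈ I) (hne : ∀ u ∈ uIcc s₀ s, h u ≠ c) (hμ : muC g₂ g₃ c = 0)
    {φ : ℝ → ℂ} (hφ : ∀ u ∈ I, h u ≠ c → HasDerivAt φ (1 / ((h u - c : ℝ) : ℂ)) u) :
    phase g₂ g₃ h c s₀ s = φ s - φ s₀ := by
  have hsub : uIcc s₀ s ⊆ I ∩ {u | h u ≠ c} := fun u hu => ⟨hc.uIcc_subset hs₀ hs hu, hne u hu⟩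
  have hcont := continuousOn_inv_sub (c := c) 1 hh
  unfold phase
  simp only [hμ, if_true]
  exact intervalIntegral.integral_eq_sub_of_hasDerivAt
    (fun u hu => hφ u (hsub hu).1 (hsub hu).2) ((hcont.mono hsub).intervalIntegrable)

theorem phase_self : phase g₂ g₃ h c s₀ s₀ = 0 := by
  unfold phase; simp

end phase

/-! ### The explicit frames as Wronskian matrices -/

/-- With φ' = μ / r² and r² = h - c this is the Wronskian matrix of -e^(-φ) r / (2 μ) and e^φ r / (2
μ): the first column is the derivative of the second. -/
theorem matD_mul_matR_of_ne {μ : ℂ} (hμ : μ ≠ 0) (φ h' r : ℂ) :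
    matD μ φ r * matR μ h' r =
      !![-(Complex.exp (-φ) * (h' - 2 * μ) / (2 * r)) / (2 * μ), -(Complex.exp (-φ) * r) / (2 * μ);
        Complex.exp φ * (h' + 2 * μ) / (2 * r) / (2 * μ), Complex.exp φ * r / (2 * μ)] := by
  unfold matD matR
  rw [if_neg hμ, if_neg hμ]
  ext i j
  fin_cases i <;> fin_cases j <;> simp [Matrix.mul_apply, Fin.sum_univ_two] <;> ring

/-- With φ' = 1 / r² and r² = h - c this is the Wronskian matrix of φ r and r. -/
theorem matD_mul_matR_zero {r : ℂ} (φ h' : ℂ) :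
    matD 0 φ r * matR 0 h' r =
      !![1 / r + φ * (h' / (2 * r)), φ * r; h' / (2 * r), r] := by
  unfold matD matR
  rw [if_pos rfl, if_pos rfl]
  ext i j
  fin_cases i <;> fin_cases j <;> simp [Matrix.mul_apply, Fin.sum_univ_two]

theorem det_matD_mul_matR_ne_zero {μ r : ℂ} (hr : r ≠ 0) (φ h' : ℂ) :
    (matD μ φ r * matR μ h' r).det ≠ 0 := by
  by_cases hμ : μ = 0
  · subst hμ
    rw [matD_mul_matR_zero, Matrix.det_fin_two_of]
    have : (1 / r + φ * (h' / (2 * r))) * r - φ * r * (h' / (2 * r)) = 1 := by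
      field_simp; ring
    rw [this]
    exact one_ne_zero
  · rw [matD_mul_matR_of_ne hμ, Matrix.det_fin_two_of, Complex.exp_neg]
    have he := Complex.exp_ne_zero φ
    have : -((Complex.exp φ)⁻¹ * (h' - 2 * μ) / (2 * r)) / (2 * μ) * (Complex.exp φ * r / (2 * μ)) -
        -((Complex.exp φ)⁻¹ * r) / (2 * μ) * (Complex.exp φ * (h' + 2 * μ) / (2 * r) / (2 * μ)) =
        1 / (2 * μ) := by
      field_simp; ring
    rw [this]
    exact div_ne_zero one_ne_zero (mul_ne_zero two_ne_zero hμ)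

theorem frameFormula_eq (g₂ g₃ : ℝ) (h : ℝ → ℝ) (c s₀ s : ℝ) (φ r : ℂ) :
    frameFormula g₂ g₃ h c s₀ s φ r =
      (matD (muC g₂ g₃ c) 0 (csqrt (h s₀ - c)) *
        matR (muC g₂ g₃ c) ((deriv h s₀ : ℝ) : ℂ) (csqrt (h s₀ - c)))⁻¹ *
      (matD (muC g₂ g₃ c) φ r * matR (muC g₂ g₃ c) ((deriv h s : ℝ) : ℂ) r) := by
  unfold frameFormula
  rw [Matrix.mul_inv_rev]
  simp only [Matrix.mul_assoc]

/-- The Wronskian matrix of two functions. -/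
noncomputable def wronskiMatrix (p u : ℝ → ℂ) (s : ℝ) : Matrix (Fin 2) (Fin 2) ℂ :=
  !![deriv p s, p s; deriv u s, u s]

/-- `Γ` is an analytic solution of `Γ' = Γ (0, 1; 2 h + c, 0)` on `I`. -/
structure IsSpinorSolution (I : Set ℝ) (h : ℝ → ℝ) (c : ℝ)
    (Γ : ℝ → Matrix (Fin 2) (Fin 2) ℂ) : Prop where
  analytic : ∀ i j, AnalyticOnNhd ℝ (fun s => Γ s i j) I
  hasDerivAt : ∀ s ∈ I, ∀ i j, HasDerivAt (fun t => Γ t i j)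
    ((Γ s * !![0, 1; ((2 * h s + c : ℝ) : ℂ), 0]) i j) s

theorem isSpinorSolution_wronski {I : Set ℝ} {h : ℝ → ℝ} {c : ℝ} {p u : ℝ → ℂ}
    (hp : AnalyticOnNhd ℝ p I) (hu : AnalyticOnNhd ℝ u I)
    (lp : ∀ s ∈ I, deriv (deriv p) s = ((2 * h s + c : ℝ) : ℂ) * p s)
    (lu : ∀ s ∈ I, deriv (deriv u) s = ((2 * h s + c : ℝ) : ℂ) * u s)
    (N : Matrix (Fin 2) (Fin 2) ℂ) :
    IsSpinorSolution I h c (fun s => N * wronskiMatrix p u s) := by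
  have e0 : ∀ i s, (N * wronskiMatrix p u s) i 0 = N i 0 * deriv p s + N i 1 * deriv u s := by
    intro i s; simp [wronskiMatrix, Matrix.mul_apply, Fin.sum_univ_two]
  have e1 : ∀ i s, (N * wronskiMatrix p u s) i 1 = N i 0 * p s + N i 1 * u s := by
    intro i s; simp [wronskiMatrix, Matrix.mul_apply, Fin.sum_univ_two]
  constructor
  · intro i j
    fin_cases j
    · simp only [Fin.zero_eta, e0]
      exact (analyticOnNhd_const.mul hp.deriv).add (analyticOnNhd_const.mul hu.deriv)
    · simp only [Fin.mk_one, e1]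
      exact (analyticOnNhd_const.mul hp).add (analyticOnNhd_const.mul hu)
  · intro s hs i j
    have hp0 := (hp s hs).differentiableAt.hasDerivAt
    have hu0 := (hu s hs).differentiableAt.hasDerivAt
    have hp1 := (hp s hs).deriv.differentiableAt.hasDerivAt
    have hu1 := (hu s hs).deriv.differentiableAt.hasDerivAt
    rw [Matrix.mul_apply, Fin.sum_univ_two, e0, e1]
    fin_cases j
    · simp only [Fin.zero_eta, e0]
      refine ((hp1.const_mul (N i 0)).fun_add (hu1.const_mul (N i 1))).congr_deriv ?_
      rw [lp s hs, lu s hs]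
      simp
      ring
    · simp only [Fin.mk_one, e1]
      refine ((hp0.const_mul (N i 0)).fun_add (hu0.const_mul (N i 1))).congr_deriv ?_
      simp

/-! ### Lamé's equation y'' = (2 h + c) y along a potential -/

section lame
variable {I : Set ℝ} {g₂ g₃ : ℝ} {h : ℝ → ℝ} {c : ℝ}

/-- The logarithmic derivative y = (h' + ν) / (2 (h - c)) satisfies the Riccati equation y' + y² = 2
h + c as soon as ν² = P(c). -/
theorem lame_of_hasDerivAt (hp : IsPotential I g₂ g₃ h) (hI : IsOpen I) (hc : I.OrdConnected)
    {ν : ℂ} (hν : ν ^ 2 = cubicP g₂ g₃ c) {u : ℝ → ℂ}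
    (hu : ∀ s ∈ I, h s ≠ c → HasDerivAt u (u s * ((((deriv h s : ℝ) : ℂ) + ν)
      / (2 * ((h s - c : ℝ) : ℂ)))) s) :
    ∀ s ∈ I, h s ≠ c → HasDerivAt (deriv u) (((2 * h s + c : ℝ) : ℂ) * u s) s := by
  intro s hs hne
  have ev : deriv u =ᶠ[nhds s] fun s => u s * ((((deriv h s : ℝ) : ℂ) + ν)
      / (2 * ((h s - c : ℝ) : ℂ))) := by
    filter_upwards [(isOpen_inter_ne hI hp.smooth.continuousOn c).mem_nhds ⟨hs, hne⟩] with t ht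
    exact (hu t ht.1 ht.2).deriv
  have d1 := (hp.hasDerivAt_deriv hI hc hs).ofReal_comp.add_const ν
  have d0 := ((hp.hasDerivAt hI hs).sub_const c).ofReal_comp.const_mul (2 : ℂ)
  have hx : ((h s - c : ℝ) : ℂ) ≠ 0 := by
    rw [Complex.ofReal_ne_zero]; exact sub_ne_zero.2 hne
  refine ((hu s hs hne).fun_mul (d1.fun_div d0 (mul_ne_zero two_ne_zero
    hx))).congr_of_eventuallyEq ev |>.congr_deriv ?_
  have ho : ((deriv h s : ℝ) : ℂ) ^ 2 = 4 * ((h s : ℝ) : ℂ) ^ 3 - g₂ * (h s : ℝ) - g₃ := by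
    have := hp.ode s hs
    unfold cubicP at this
    exact_mod_cast this
  unfold cubicP at hν
  push_cast at hν hx ⊢
  field_simp
  linear_combination u s * (hν - ho)

/-- Analyticity carries Lamé's equation across the zeros of h - c. -/
theorem lame_of_eventually {s₀ : ℝ} (hc : I.OrdConnected) (hs₀ : s₀ ∈ I)
    (hh : AnalyticOnNhd ℝ (fun s => ((h s : ℝ) : ℂ)) I) {u : ℝ → ℂ} (hu : AnalyticOnNhd ℝ u I)
    (hev : ∀ᶠ s in nhds s₀, deriv (deriv u) s = ((2 * h s + c : ℝ) : ℂ) * u s) :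
    ∀ s ∈ I, deriv (deriv u) s = ((2 * h s + c : ℝ) : ℂ) * u s := by
  have hr : AnalyticOnNhd ℝ (fun s => ((2 * h s + c : ℝ) : ℂ) * u s) I := by
    push_cast
    exact ((analyticOnNhd_const.mul hh).add analyticOnNhd_const).mul hu
  exact fun s hs => hu.deriv.deriv.eqOn_of_preconnected_of_eventuallyEq hr hc.isPreconnected
    hs₀ hev hs

end lame

/-! ### Existence and uniqueness of the explicit frames -/

section explicit
variable {I : Set ℝ} {g₂ g₃ : ℝ} {h : ℝ → ℝ} {c s₀ : ℝ}

/-- Between s₀ and s both sides solve the same first-order linear equation, and they agree at s₀. -/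
theorem exp_phase_mul_csqrt (hp : IsPotential I g₂ g₃ h) (hI : IsOpen I) (hc : I.OrdConnected)
    (hs₀ : s₀ ∈ I) (hμ : muC g₂ g₃ c ≠ 0) {u : ℝ → ℂ}
    (hu : ∀ s ∈ I, h s ≠ c → HasDerivAt u (u s * ((((deriv h s : ℝ) : ℂ) + 2 * muC g₂ g₃ c)
      / (2 * ((h s - c : ℝ) : ℂ)))) s) (hu0 : u s₀ = csqrt (h s₀ - c)) {s : ℝ} (hs : s ∈ I)
    (hne : ∀ t ∈ uIcc s₀ s, h t ≠ c) :
    Complex.exp (phase g₂ g₃ h c s₀ s) * csqrt (h s - c) = u s := by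
  have hsub : uIcc s₀ s ⊆ I := hc.uIcc_subset hs₀ hs
  have hsub2 : ∀ t ∈ uIcc s₀ s, uIcc s₀ t ⊆ uIcc s₀ s := fun t ht => uIcc_subset_uIcc_left ht
  set k : ℝ → ℂ := fun s => ((((deriv h s : ℝ) : ℂ) + 2 * muC g₂ g₃ c)
      / (2 * ((h s - c : ℝ) : ℂ))) with hk
  have hx : ∀ t ∈ uIcc s₀ s, ((h t - c : ℝ) : ℂ) ≠ 0 := fun t ht => by
    rw [Complex.ofReal_ne_zero]; exact sub_ne_zero.2 (hne t ht)
  have hd : ∀ t ∈ uIcc s₀ s, HasDerivAt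
      (fun t => Complex.exp (phase g₂ g₃ h c s₀ t) * csqrt (h t - c) - u t)
      ((Complex.exp (phase g₂ g₃ h c s₀ t) * csqrt (h t - c) - u t) * k t) t := by
    intro t ht
    have d1 := hasDerivAt_phase (g₂ := g₂) (g₃ := g₃) hI hc hp.smooth.continuousOn hs₀ (hsub ht)
      (fun v hv => hne v (hsub2 t ht hv))
    rw [if_neg hμ] at d1
    have hxt : h t - c ≠ 0 := sub_ne_zero.2 (hne t ht)
    have d2 := (hasDerivAt_csqrt hxt).scomp t ((hp.hasDerivAt hI (hsub ht)).sub_const c)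
    simp only [Function.comp_def] at d2
    refine ((d1.cexp.fun_mul d2).fun_sub (hu t (hsub ht) (hne t ht))).congr_deriv ?_
    have hr := csqrt_ne_zero hxt
    have hr2 := csqrt_sq (h t - c)
    simp only [hk]
    rw [← hr2]
    simp only [Complex.real_smul]
    field_simp
    ring
  have hkc : ContinuousOn (fun t => ‖k t‖) (uIcc s₀ s) := by
    refine ContinuousOn.norm (ContinuousOn.div ?_ ?_ fun t ht => mul_ne_zero two_ne_zero (hx t ht))
    · exact (Complex.continuous_ofReal.comp_continuousOn
        ((hp.contDiffOn_deriv hI).continuousOn.mono hsub)).add continuousOn_const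
    · exact continuousOn_const.mul (Complex.continuous_ofReal.comp_continuousOn
        ((hp.smooth.continuousOn.mono hsub).sub continuousOn_const))
  have := eq_zero_of_norm_deriv_le ordConnected_uIcc hd hkc
    (fun t _ => by rw [norm_mul, mul_comm]) left_mem_uIcc (by
      simp [phase_self, hu0]) s right_mem_uIcc
  exact sub_eq_zero.1 this

theorem csqrt_eq_of_hasDerivAt (hp : IsPotential I g₂ g₃ h) (hI : IsOpen I) (hc : I.OrdConnected)
    (hs₀ : s₀ ∈ I) {u : ℝ → ℂ}
    (hu : ∀ s ∈ I, h s ≠ c → HasDerivAt u (u s * ((((deriv h s : ℝ) : ℂ) + 0)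
      / (2 * ((h s - c : ℝ) : ℂ)))) s) (hu0 : u s₀ = csqrt (h s₀ - c)) {s : ℝ} (hs : s ∈ I)
    (hne : ∀ t ∈ uIcc s₀ s, h t ≠ c) : csqrt (h s - c) = u s := by
  have hsub : uIcc s₀ s ⊆ I := hc.uIcc_subset hs₀ hs
  set k : ℝ → ℂ := fun s => ((((deriv h s : ℝ) : ℂ) + 0) / (2 * ((h s - c : ℝ) : ℂ))) with hk
  have hx : ∀ t ∈ uIcc s₀ s, ((h t - c : ℝ) : ℂ) ≠ 0 := fun t ht => by
    rw [Complex.ofReal_ne_zero]; exact sub_ne_zero.2 (hne t ht)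
  have hd : ∀ t ∈ uIcc s₀ s, HasDerivAt (fun t => csqrt (h t - c) - u t)
      ((csqrt (h t - c) - u t) * k t) t := by
    intro t ht
    have hxt : h t - c ≠ 0 := sub_ne_zero.2 (hne t ht)
    have d2 := (hasDerivAt_csqrt hxt).scomp t ((hp.hasDerivAt hI (hsub ht)).sub_const c)
    simp only [Function.comp_def] at d2
    refine (d2.fun_sub (hu t (hsub ht) (hne t ht))).congr_deriv ?_
    have hr := csqrt_ne_zero hxt
    have hr2 := csqrt_sq (h t - c)
    simp only [hk]
    rw [← hr2]
    simp only [Complex.real_smul]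
    field_simp
    ring
  have hkc : ContinuousOn (fun t => ‖k t‖) (uIcc s₀ s) := by
    refine ContinuousOn.norm (ContinuousOn.div ?_ ?_ fun t ht => mul_ne_zero two_ne_zero (hx t ht))
    · exact (Complex.continuous_ofReal.comp_continuousOn
        ((hp.contDiffOn_deriv hI).continuousOn.mono hsub)).add continuousOn_const
    · exact continuousOn_const.mul (Complex.continuous_ofReal.comp_continuousOn
        ((hp.smooth.continuousOn.mono hsub).sub continuousOn_const))
  have := eq_zero_of_norm_deriv_le ordConnected_uIcc hd hkc
    (fun t _ => by rw [norm_mul, mul_comm]) left_mem_uIcc (by simp [hu0]) s right_mem_uIcc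
  exact sub_eq_zero.1 this

/-- u and v are analytic continuations of e^φ √(h - c) and e^(-φ) √(h - c) over the zeros of h - c.
Their scaled Wronskian matrix equals D R for every pair (φ, r) with r² = h - c and e^φ r = u,
because u v = r² then determines v. Hence the last clause, which is not restricted to the interval
around s₀ where h ≠ c. -/
theorem exists_explicitFrame_of_ne (hp : IsPotential I g₂ g₃ h) (hI : IsOpen I)
    (hc : I.OrdConnected) (hha : AnalyticOnNhd ℝ (fun s => ((h s : ℝ) : ℂ)) I)
    (hs₀ : s₀ ∈ I) (h0 : h s₀ ≠ c) (hμ : muC g₂ g₃ c ≠ 0) {u v : ℝ → ℂ}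
    (hua : AnalyticOnNhd ℝ u I) (hva : AnalyticOnNhd ℝ v I)
    (huv : ∀ s ∈ I, u s * v s = ((h s - c : ℝ) : ℂ))
    (hu : ∀ s ∈ I, h s ≠ c → HasDerivAt u (u s * ((((deriv h s : ℝ) : ℂ) + 2 * muC g₂ g₃ c)
      / (2 * ((h s - c : ℝ) : ℂ)))) s)
    (hv : ∀ s ∈ I, h s ≠ c → HasDerivAt v (v s * ((((deriv h s : ℝ) : ℂ) + -(2 * muC g₂ g₃ c))
      / (2 * ((h s - c : ℝ) : ℂ)))) s)
    (hu0 : u s₀ = csqrt (h s₀ - c)) :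
    ∃ Γ, IsExplicitFrame I g₂ g₃ h c s₀ Γ ∧ IsSpinorSolution I h c Γ ∧
      ∀ s ∈ I, h s ≠ c → ∀ φ r : ℂ, r ^ 2 = ((h s - c : ℝ) : ℂ) → Complex.exp φ * r = u s →
        Γ s = frameFormula g₂ g₃ h c s₀ s φ r := by
  set μ := muC g₂ g₃ c with hμdef
  have hO := isOpen_inter_ne hI hp.smooth.continuousOn c
  have hν : (2 * μ) ^ 2 = cubicP g₂ g₃ c := by rw [← four_mul_muC_sq]; ring
  have hν' : (-(2 * μ)) ^ 2 = cubicP g₂ g₃ c := by rw [← four_mul_muC_sq]; ring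
  have lu := lame_of_hasDerivAt hp hI hc hν hu
  have lv := lame_of_hasDerivAt hp hI hc hν' hv
  have lu' := lame_of_eventually (c := c) hc hs₀ hha hua (by
    filter_upwards [hO.mem_nhds ⟨hs₀, h0⟩] with s hs using (lu s hs.1 hs.2).deriv)
  have lv' := lame_of_eventually (c := c) hc hs₀ hha hva (by
    filter_upwards [hO.mem_nhds ⟨hs₀, h0⟩] with s hs using (lv s hs.1 hs.2).deriv)
  set p : ℝ → ℂ := fun s => (-1 / (2 * μ)) * v s with hpdef
  set q : ℝ → ℂ := fun s => (1 / (2 * μ)) * u s with hqdef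
  have dp : deriv p = fun s => (-1 / (2 * μ)) * deriv v s := by
    funext s; simp only [hpdef]; exact deriv_const_mul_field _
  have dq : deriv q = fun s => (1 / (2 * μ)) * deriv u s := by
    funext s; simp only [hqdef]; exact deriv_const_mul_field _
  have hsol := isSpinorSolution_wronski (h := h) (c := c) (p := p) (u := q)
    (analyticOnNhd_const.mul hva) (analyticOnNhd_const.mul hua)
    (fun s hs => by
      rw [dp, deriv_const_mul_field, lv' s hs]; simp only [hpdef]; ring)
    (fun s hs => by
      rw [dq, deriv_const_mul_field, lu' s hs]; simp only [hqdef]; ring)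
    (matD μ 0 (csqrt (h s₀ - c)) * matR μ ((deriv h s₀ : ℝ) : ℂ) (csqrt (h s₀ - c)))⁻¹
  have hform : ∀ s ∈ I, h s ≠ c → ∀ φ r : ℂ, r ^ 2 = ((h s - c : ℝ) : ℂ) →
      Complex.exp φ * r = u s → wronskiMatrix p q s =
        matD μ φ r * matR μ ((deriv h s : ℝ) : ℂ) r := by
    intro s hs hne φ r hr hφ
    have hx : ((h s - c : ℝ) : ℂ) ≠ 0 := by
      rw [Complex.ofReal_ne_zero]; exact sub_ne_zero.2 hne
    have hr0 : r ≠ 0 := by rintro rfl; exact hx (by rw [← hr]; ring)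
    have he := Complex.exp_ne_zero φ
    have hvs : v s = Complex.exp (-φ) * r := by
      have := huv s hs
      rw [← hr, ← hφ] at this
      rw [Complex.exp_neg]
      field_simp
      apply mul_left_cancel₀ hr0
      linear_combination this
    rw [matD_mul_matR_of_ne hμ]
    unfold wronskiMatrix
    rw [dp, dq]
    simp only [hpdef, hqdef]
    rw [(hu s hs hne).deriv, (hv s hs hne).deriv, hvs, ← hφ, ← hr]
    congr 1
    ext i j
    fin_cases i <;> fin_cases j <;> simp <;> field_simp
    ring
  refine ⟨_, ⟨hsol.analytic, ?_⟩, hsol, ?_⟩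
  · intro s hs hne
    rw [frameFormula_eq, hform s hs (hne s right_mem_uIcc) _ _ (csqrt_sq _)
      (exp_phase_mul_csqrt hp hI hc hs₀ hμ hu hu0 hs hne)]
  · intro s hs hne φ r hr hφ
    rw [frameFormula_eq, hform s hs hne φ r hr hφ]

/-- Reduction of order: u continues √(h - c), and v continues the second solution φ √(h - c) with
the phase normalized to 0 at s₀. -/
theorem exists_explicitFrame_of_eq (hp : IsPotential I g₂ g₃ h) (hI : IsOpen I)
    (hc : I.OrdConnected) (hha : AnalyticOnNhd ℝ (fun s => ((h s : ℝ) : ℂ)) I)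
    (hs₀ : s₀ ∈ I) (h0 : h s₀ ≠ c) (hμ : cubicP g₂ g₃ c = 0) {u v φ : ℝ → ℂ}
    (hua : AnalyticOnNhd ℝ u I) (hva : AnalyticOnNhd ℝ v I)
    (hu2 : ∀ s ∈ I, u s ^ 2 = ((h s - c : ℝ) : ℂ))
    (hu : ∀ s ∈ I, h s ≠ c → HasDerivAt u (u s * ((((deriv h s : ℝ) : ℂ) + 0)
      / (2 * ((h s - c : ℝ) : ℂ)))) s)
    (hφ : ∀ s ∈ I, h s ≠ c → HasDerivAt φ (1 / ((h s - c : ℝ) : ℂ)) s)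
    (hv : ∀ s ∈ I, h s ≠ c → v s = (φ s - φ s₀) * u s)
    (hu0 : u s₀ = csqrt (h s₀ - c)) :
    ∃ Γ, IsExplicitFrame I g₂ g₃ h c s₀ Γ ∧ IsSpinorSolution I h c Γ ∧
      ∀ s ∈ I, h s ≠ c → Γ s = frameFormula g₂ g₃ h c s₀ s (φ s - φ s₀) (u s) := by
  have hμ0 : muC g₂ g₃ c = 0 := muC_eq_zero_iff.2 hμ
  have hO := isOpen_inter_ne hI hp.smooth.continuousOn c
  have hx : ∀ s, h s ≠ c → ((h s - c : ℝ) : ℂ) ≠ 0 := fun s hne => by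
    rw [Complex.ofReal_ne_zero]; exact sub_ne_zero.2 hne
  have lu := lame_of_hasDerivAt hp hI hc (ν := 0) (c := c) (by rw [hμ]; simp) hu
  have lu' := lame_of_eventually (c := c) hc hs₀ hha hua (by
    filter_upwards [hO.mem_nhds ⟨hs₀, h0⟩] with s hs using (lu s hs.1 hs.2).deriv)
  have dv : ∀ s ∈ I, h s ≠ c → HasDerivAt v
      (u s / ((h s - c : ℝ) : ℂ) + (φ s - φ s₀) * deriv u s) s := by
    intro s hs hne
    have ev : v =ᶠ[nhds s] fun s => (φ s - φ s₀) * u s := by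
      filter_upwards [hO.mem_nhds ⟨hs, hne⟩] with t ht using hv t ht.1 ht.2
    refine ((((hφ s hs hne).sub_const (φ s₀)).fun_mul
      (hua s hs).differentiableAt.hasDerivAt).congr_of_eventuallyEq ev).congr_deriv ?_
    ring
  have lv : ∀ s ∈ I, h s ≠ c → HasDerivAt (deriv v) (((2 * h s + c : ℝ) : ℂ) * v s) s := by
    intro s hs hne
    have ev : deriv v =ᶠ[nhds s] fun s =>
        u s / ((h s - c : ℝ) : ℂ) + (φ s - φ s₀) * deriv u s := by
      filter_upwards [hO.mem_nhds ⟨hs, hne⟩] with t ht using (dv t ht.1 ht.2).deriv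
    refine (((((hu s hs hne).fun_div ((hp.hasDerivAt hI hs).sub_const c).ofReal_comp
      (hx s hne)).fun_add (((hφ s hs hne).sub_const (φ s₀)).fun_mul
      (lu s hs hne)))).congr_of_eventuallyEq ev).congr_deriv ?_
    rw [hv s hs hne, (hu s hs hne).deriv]
    have := hx s hne
    field_simp
    ring
  have lv' := lame_of_eventually (c := c) hc hs₀ hha hva (by
    filter_upwards [hO.mem_nhds ⟨hs₀, h0⟩] with s hs using (lv s hs.1 hs.2).deriv)
  have hsol := isSpinorSolution_wronski (h := h) (c := c) hva hua lv' lu'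
    (matD (muC g₂ g₃ c) 0 (csqrt (h s₀ - c)) *
      matR (muC g₂ g₃ c) ((deriv h s₀ : ℝ) : ℂ) (csqrt (h s₀ - c)))⁻¹
  have hform : ∀ s ∈ I, h s ≠ c → wronskiMatrix v u s =
      matD (muC g₂ g₃ c) (φ s - φ s₀) (u s) *
        matR (muC g₂ g₃ c) ((deriv h s : ℝ) : ℂ) (u s) := by
    intro s hs hne
    have hus : u s ≠ 0 := by
      intro h1
      have := hu2 s hs
      rw [h1] at this
      exact hx s hne (by rw [← this]; ring)
    rw [hμ0, matD_mul_matR_zero]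
    unfold wronskiMatrix
    rw [(dv s hs hne).deriv, (hu s hs hne).deriv, hv s hs hne, ← hu2 s hs]
    congr 1
    ext i j
    fin_cases i <;> fin_cases j <;> simp <;> field_simp
  refine ⟨_, ⟨hsol.analytic, ?_⟩, hsol, ?_⟩
  · intro s hs hne
    rw [frameFormula_eq, hform s hs (hne s right_mem_uIcc),
      phase_eq_sub hc hp.smooth.continuousOn hs₀ hs hne hμ0 hφ,
      csqrt_eq_of_hasDerivAt hp hI hc hs₀ hu hu0 hs hne]
  · intro s hs hne
    rw [frameFormula_eq, hform s hs hne]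

theorem IsExplicitFrame.eqOn (hp : IsPotential I g₂ g₃ h) (hI : IsOpen I)
    (hc : I.OrdConnected) (hs₀ : s₀ ∈ I) (h0 : h s₀ ≠ c) {Γ Γ' : ℝ → Matrix (Fin 2) (Fin 2) ℂ}
    (hΓ : IsExplicitFrame I g₂ g₃ h c s₀ Γ) (hΓ' : IsExplicitFrame I g₂ g₃ h c s₀ Γ') :
    Set.EqOn Γ Γ' I := by
  have hO := isOpen_inter_ne hI hp.smooth.continuousOn c
  obtain ⟨ε, hε, hb⟩ := Metric.isOpen_iff.1 hO s₀ ⟨hs₀, h0⟩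
  have hev : ∀ᶠ s in nhds s₀, Γ s = Γ' s := by
    filter_upwards [Metric.ball_mem_nhds s₀ hε] with s hs
    have hsub : uIcc s₀ s ⊆ Metric.ball s₀ ε :=
      (convex_ball s₀ ε).ordConnected.uIcc_subset (Metric.mem_ball_self hε) hs
    have hne : ∀ u ∈ uIcc s₀ s, h u ≠ c := fun u hu => (hb (hsub hu)).2
    rw [hΓ.formula s (hb hs).1 hne, hΓ'.formula s (hb hs).1 hne]
  intro s hs
  ext i j
  exact (hΓ.analytic i j).eqOn_of_preconnected_of_eventuallyEq (hΓ'.analytic i j)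
    hc.isPreconnected hs₀ (hev.mono fun t ht => by simp only [ht]) hs

theorem IsExplicitFrame.map_base (hs₀ : s₀ ∈ I) (h0 : h s₀ ≠ c)
    {Γ : ℝ → Matrix (Fin 2) (Fin 2) ℂ} (hΓ : IsExplicitFrame I g₂ g₃ h c s₀ Γ) : Γ s₀ = 1 := by
  rw [hΓ.formula s₀ hs₀ (by simpa using h0), frameFormula_eq, phase_self]
  exact Matrix.nonsing_inv_mul _ (isUnit_iff_ne_zero.2
    (det_matD_mul_matR_ne_zero (csqrt_ne_zero (sub_ne_zero.2 h0)) _ _))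

end explicit

/-! ### Phases and frames through the Weierstrass functions -/

section weierstrassForm
variable {I : Set ℝ} {g₂ g₃ : ℝ} {h : ℝ → ℝ} {c s₀ : ℝ} {σ : ℂ → ℂ} {α w : ℂ}

theorem hasDerivAt_add_const_ofReal (α : ℂ) (s : ℝ) :
    HasDerivAt (fun t : ℝ => (t : ℂ) + α) 1 s :=
  ((hasDerivAt_id' s).ofReal_comp).add_const α

theorem HasDerivAt.comp_shift {f : ℂ → ℂ} {f' : ℂ} {s : ℝ} (hf : HasDerivAt f f' ((s : ℂ) + α)) :
    HasDerivAt (fun t : ℝ => f ((t : ℂ) + α)) f' s := by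
  have := hf.comp s (hasDerivAt_add_const_ofReal α s)
  simpa [Function.comp_def] using this

theorem AnalyticAt.comp_shift {f : ℂ → ℂ} {s : ℝ} (hf : AnalyticAt ℂ f ((s : ℂ) + α)) :
    AnalyticAt ℝ (fun t : ℝ => f ((t : ℂ) + α)) s :=
  hf.comp_real (g := fun t : ℝ => (t : ℂ) + α) (analyticAt_ofReal.add analyticAt_const)

theorem IsShift.deriv_eq (hα : IsShift I h σ α) (hσ : IsWeierstrassSigma g₂ g₃ σ) (hI : IsOpen I)
    (hp : IsPotential I g₂ g₃ h) {s : ℝ} (hs : s ∈ I) :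
    ((deriv h s : ℝ) : ℂ) = deriv (wP σ) ((s : ℂ) + α) := by
  have d1 := (hp.hasDerivAt hI hs).ofReal_comp
  have d2 := (hasDerivAt_wP (hσ.analyticAt _) (hα s hs).1).comp_shift
  refine d1.unique (d2.congr_of_eventuallyEq ?_)
  filter_upwards [hI.mem_nhds hs] with t ht using (hα t ht).2

theorem IsShift.analyticOnNhd (hα : IsShift I h σ α) (hσ : IsWeierstrassSigma g₂ g₃ σ)
    (hI : IsOpen I) : AnalyticOnNhd ℝ (fun s => ((h s : ℝ) : ℂ)) I := by
  intro s hs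
  refine (analyticAt_wP (hσ.analyticAt _) (hα s hs).1).comp_shift.congr ?_
  filter_upwards [hI.mem_nhds hs] with t ht using (hα t ht).2.symm

theorem IsShift.wP_ne (hα : IsShift I h σ α) (hw : wP σ w = c) {s : ℝ} (hs : s ∈ I)
    (hne : h s ≠ c) : wP σ ((s : ℂ) + α) ≠ wP σ w := by
  rw [← (hα s hs).2, hw]
  exact_mod_cast hne

/-- A multiple of `s ↦ lameE σ w (s + α)` with the principal value of `√(h - c)` at `s₀`. -/
noncomputable def lameU (h : ℝ → ℝ) (c s₀ : ℝ) (σ : ℂ → ℂ) (α w : ℂ) (s : ℝ) : ℂ :=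
  csqrt (h s₀ - c) / lameE σ w ((s₀ : ℂ) + α) * lameE σ w ((s : ℂ) + α)

theorem lameE_shift_ne_zero (hσ : IsWeierstrassSigma g₂ g₃ σ) (hα : IsShift I h σ α)
    (hw0 : σ w ≠ 0) (hw : wP σ w = c) {s : ℝ} (hs : s ∈ I) (hne : h s ≠ c) :
    lameE σ w ((s : ℂ) + α) ≠ 0 := by
  have h1 := (hα s hs).1
  have := hσ.lameE_mul h1 hw0
  have hx := sub_ne_zero.2 (hα.wP_ne hw hs hne)
  intro h0
  rw [h0, zero_mul] at this
  exact mul_ne_zero (neg_ne_zero.2 (pow_ne_zero 2 hw0)) hx this.symm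

theorem analyticOnNhd_lameU (hσ : IsWeierstrassSigma g₂ g₃ σ) (hα : IsShift I h σ α) :
    AnalyticOnNhd ℝ (lameU h c s₀ σ α w) I := fun s hs =>
  analyticAt_const.mul ((hσ.analyticAt_lameE w (hα s hs).1).comp_shift)

theorem hasDerivAt_lameU (hσ : IsWeierstrassSigma g₂ g₃ σ) (hα : IsShift I h σ α) (hI : IsOpen I)
    (hp : IsPotential I g₂ g₃ h) (hw0 : σ w ≠ 0) (hw : wP σ w = c) {s : ℝ} (hs : s ∈ I)
    (hne : h s ≠ c) :
    HasDerivAt (lameU h c s₀ σ α w) (lameU h c s₀ σ α w s *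
      ((((deriv h s : ℝ) : ℂ) + deriv (wP σ) w) / (2 * ((h s - c : ℝ) : ℂ)))) s := by
  refine (((hσ.hasDerivAt_lameE (hα s hs).1 hw0 (hα.wP_ne hw hs hne)).comp_shift).const_mul
    (csqrt (h s₀ - c) / lameE σ w ((s₀ : ℂ) + α))).congr_deriv ?_
  rw [hα.deriv_eq hσ hI hp hs, Complex.ofReal_sub, (hα s hs).2, ← hw]
  unfold lameU
  ring

theorem lameU_base (hσ : IsWeierstrassSigma g₂ g₃ σ) (hα : IsShift I h σ α)
    (hw0 : σ w ≠ 0) (hw : wP σ w = c) (hs₀ : s₀ ∈ I) (hne : h s₀ ≠ c) :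
    lameU h c s₀ σ α w s₀ = csqrt (h s₀ - c) :=
  div_mul_cancel₀ _ (lameE_shift_ne_zero hσ hα hw0 hw hs₀ hne)

theorem lameU_mul (hσ : IsWeierstrassSigma g₂ g₃ σ) (hα : IsShift I h σ α)
    (hw0 : σ w ≠ 0) (hw : wP σ w = c) (hs₀ : s₀ ∈ I) (hne : h s₀ ≠ c) {s : ℝ} (hs : s ∈ I) :
    lameU h c s₀ σ α w s * lameU h c s₀ σ α (-w) s = ((h s - c : ℝ) : ℂ) := by
  have e := hσ.lameE_mul (hα s hs).1 hw0
  have e0 := hσ.lameE_mul (hα s₀ hs₀).1 hw0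
  rw [← (hα s hs).2, hw, ← Complex.ofReal_sub] at e
  rw [← (hα s₀ hs₀).2, hw, ← Complex.ofReal_sub] at e0
  have hr := csqrt_sq (h s₀ - c)
  have n1 := lameE_shift_ne_zero hσ hα hw0 hw hs₀ hne
  have n2 := lameE_shift_ne_zero (w := -w) hσ hα (by rw [hσ.odd]; exact neg_ne_zero.2 hw0)
    (by rw [hσ.wP_neg, hw]) hs₀ hne
  unfold lameU
  rw [mul_mul_mul_comm, div_mul_div_comm, div_mul_eq_mul_div, div_eq_iff (mul_ne_zero n1 n2), e0,
    ← hr]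
  linear_combination csqrt (h s₀ - c) ^ 2 * e

theorem lameU_div (hσ : IsWeierstrassSigma g₂ g₃ σ) (hα : IsShift I h σ α)
    (hw0 : σ w ≠ 0) (hw : wP σ w = c) (hs₀ : s₀ ∈ I) (hne₀ : h s₀ ≠ c) {s : ℝ} (hs : s ∈ I)
    (hne : h s ≠ c) :
    lameU h c s₀ σ α w s ^ 2 / ((h s - c : ℝ) : ℂ) =
      sigmaQuotient σ w ((s : ℂ) + α) / sigmaQuotient σ w ((s₀ : ℂ) + α) := by
  have hw0' : σ (-w) ≠ 0 := by rw [hσ.odd]; exact neg_ne_zero.2 hw0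
  have hw' : wP σ (-w) = c := by rw [hσ.wP_neg, hw]
  have hr : csqrt (h s₀ - c) ≠ 0 := csqrt_ne_zero (sub_ne_zero.2 hne₀)
  have n1 := lameE_shift_ne_zero hσ hα hw0 hw hs₀ hne₀
  have n2 := lameE_shift_ne_zero hσ hα hw0' hw' hs₀ hne₀
  have n3 := lameE_shift_ne_zero hσ hα hw0 hw hs hne
  have n4 := lameE_shift_ne_zero hσ hα hw0' hw' hs hne
  rw [← lameU_mul hσ hα hw0 hw hs₀ hne₀ hs, ← hσ.lameE_div (hα s hs).1,
    ← hσ.lameE_div (hα s₀ hs₀).1]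
  unfold lameU
  field_simp

/-- The continuations of e^φ √(h - c) and e^(-φ) √(h - c) are `lameU` at w and at -w. -/
theorem exists_explicitFrame_of_point_of_ne (hσ : IsWeierstrassSigma g₂ g₃ σ)
    (hα : IsShift I h σ α) (hI : IsOpen I) (hc : I.OrdConnected) (hp : IsPotential I g₂ g₃ h)
    (hs₀ : s₀ ∈ I) (h0 : h s₀ ≠ c) (hw : IsSpectralPoint g₂ g₃ σ c w)
    (hμ : cubicP g₂ g₃ c ≠ 0) :
    ∃ Γ, IsExplicitFrame I g₂ g₃ h c s₀ Γ ∧ IsSpinorSolution I h c Γ ∧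
      ∀ s ∈ I, h s ≠ c → ∀ φ r : ℂ, r ^ 2 = ((h s - c : ℝ) : ℂ) →
        Complex.exp φ * r = lameU h c s₀ σ α w s → Γ s = frameFormula g₂ g₃ h c s₀ s φ r := by
  obtain ⟨hw0, hw1, hw2⟩ := hw
  have hw0' : σ (-w) ≠ 0 := by rw [hσ.odd]; exact neg_ne_zero.2 hw0
  have hw1' : wP σ (-w) = c := by rw [hσ.wP_neg, hw1]
  refine exists_explicitFrame_of_ne hp hI hc (hα.analyticOnNhd hσ hI) hs₀ h0
    (mt muC_eq_zero_iff.1 hμ) (analyticOnNhd_lameU hσ hα) (analyticOnNhd_lameU (w := -w) hσ hα)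
    (fun s hs => lameU_mul hσ hα hw0 hw1 hs₀ h0 hs) (fun s hs hne => ?_) (fun s hs hne => ?_)
    (lameU_base hσ hα hw0 hw1 hs₀ h0)
  · rw [← hw2]
    exact hasDerivAt_lameU hσ hα hI hp hw0 hw1 hs hne
  · rw [← hw2, ← hσ.deriv_wP_neg]
    exact hasDerivAt_lameU hσ hα hI hp hw0' hw1' hs hne

theorem exp_two_mul_phase (hσ : IsWeierstrassSigma g₂ g₃ σ)
    (hα : IsShift I h σ α) (hI : IsOpen I) (hc : I.OrdConnected) (hp : IsPotential I g₂ g₃ h)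
    (hs₀ : s₀ ∈ I) (h0 : h s₀ ≠ c) (hw : IsSpectralPoint g₂ g₃ σ c w)
    (hμ : cubicP g₂ g₃ c ≠ 0) {s : ℝ} (hs : s ∈ I) (hne : ∀ u ∈ uIcc s₀ s, h u ≠ c) :
    Complex.exp (2 * phase g₂ g₃ h c s₀ s) =
      sigmaQuotient σ w ((s : ℂ) + α) / sigmaQuotient σ w ((s₀ : ℂ) + α) := by
  obtain ⟨hw0, hw1, hw2⟩ := hw
  have hx : csqrt (h s - c) ≠ 0 := csqrt_ne_zero (sub_ne_zero.2 (hne s right_mem_uIcc))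
  rw [← lameU_div hσ hα hw0 hw1 hs₀ h0 hs (hne s right_mem_uIcc),
    ← exp_phase_mul_csqrt hp hI hc hs₀ (mt muC_eq_zero_iff.1 hμ) (fun s hs hne => by
      rw [← hw2]; exact hasDerivAt_lameU hσ hα hI hp hw0 hw1 hs hne)
      (lameU_base hσ hα hw0 hw1 hs₀ h0) hs hne, ← csqrt_sq, two_mul, Complex.exp_add]
  field_simp

/-- By the half-period formula ℘(z + w) - c is the constant 3 c² - g₂ / 4 divided by ℘(z) - c, and
-ζ(z + w) - c z is a primitive of it. -/
theorem hasDerivAt_zetaPrimitive (hσ : IsWeierstrassSigma g₂ g₃ σ) {z : ℂ} (hz : σ z ≠ 0)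
    (hw0 : σ w ≠ 0) (hw : wP σ w = c) (hy : deriv (wP σ) w = 0) (hne : wP σ z ≠ wP σ w)
    (hd : 3 * c ^ 2 - g₂ / 4 ≠ 0) :
    HasDerivAt (zetaPrimitive g₂ c σ w) (1 / (wP σ z - c)) z := by
  have hd' : 3 * (c : ℂ) ^ 2 - (g₂ : ℂ) / 4 ≠ 0 := by exact_mod_cast hd
  have h1 := hσ.wP_add_halfPeriod hz hw0 hne hy
  obtain ⟨n1, -⟩ := hσ.ne_zero_of_wP_ne hz hw0 hne
  have d := (hasDerivAt_wZeta (hσ.analyticAt _) n1).comp_add_const z w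
  refine ((d.add ((hasDerivAt_id' z).const_mul (c : ℂ))).const_mul
    (-1 / (3 * (c : ℂ) ^ 2 - (g₂ : ℂ) / 4))).congr_deriv ?_
  rw [hw] at h1 hne
  have hx := sub_ne_zero.2 hne
  have h2 : wP σ (z + w) = (3 * (c : ℂ) ^ 2 - g₂ / 4) / (wP σ z - c) + c := by
    linear_combination h1
  rw [h2]
  generalize 3 * (c : ℂ) ^ 2 - (g₂ : ℂ) / 4 = d at hd' ⊢
  field_simp
  ring

theorem exists_explicitFrame_of_point_of_eq (hσ : IsWeierstrassSigma g₂ g₃ σ)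
    (hα : IsShift I h σ α) (hI : IsOpen I) (hc : I.OrdConnected) (hp : IsPotential I g₂ g₃ h)
    (hs₀ : s₀ ∈ I) (h0 : h s₀ ≠ c) (hw : IsSpectralPoint g₂ g₃ σ c w)
    (hμ : cubicP g₂ g₃ c = 0) (hd : 3 * c ^ 2 - g₂ / 4 ≠ 0) :
    (∀ s ∈ I, (∀ u ∈ uIcc s₀ s, h u ≠ c) → phase g₂ g₃ h c s₀ s =
        zetaPrimitive g₂ c σ w ((s : ℂ) + α) - zetaPrimitive g₂ c σ w ((s₀ : ℂ) + α)) ∧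
    ∃ Γ, IsExplicitFrame I g₂ g₃ h c s₀ Γ ∧ IsSpinorSolution I h c Γ ∧
      ∀ s ∈ I, h s ≠ c → ∃ r : ℂ, r ^ 2 = ((h s - c : ℝ) : ℂ) ∧
        Γ s = frameFormula g₂ g₃ h c s₀ s
          (zetaPrimitive g₂ c σ w ((s : ℂ) + α) - zetaPrimitive g₂ c σ w ((s₀ : ℂ) + α)) r := by
  obtain ⟨hw0, hw1, hw2⟩ := hw
  have hμ0 : muC g₂ g₃ c = 0 := muC_eq_zero_iff.2 hμ
  rw [hμ0, mul_zero] at hw2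
  have hw0' : σ (-w) ≠ 0 := by rw [hσ.odd]; exact neg_ne_zero.2 hw0
  have hw1' : wP σ (-w) = c := by rw [hσ.wP_neg, hw1]
  have hO := isOpen_inter_ne hI hp.smooth.continuousOn c
  -- The point -w is used so that u contains the factor σ(z + w), which cancels the pole of ζ(z + w)
  -- in the phase.
  set u := lameU h c s₀ σ α (-w) with hudef
  have hua : AnalyticOnNhd ℝ u I := analyticOnNhd_lameU hσ hα
  have hha := hα.analyticOnNhd hσ hI
  have hu : ∀ s ∈ I, h s ≠ c → HasDerivAt u (u s * ((((deriv h s : ℝ) : ℂ) + 0)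
      / (2 * ((h s - c : ℝ) : ℂ)))) s := by
    intro s hs hne
    have := hasDerivAt_lameU (s₀ := s₀) hσ hα hI hp hw0' hw1' hs hne
    rwa [hσ.deriv_wP_neg, hw2, neg_zero] at this
  have hu0 : u s₀ = csqrt (h s₀ - c) := lameU_base hσ hα hw0' hw1' hs₀ h0
  -- Near s₀ the function u is the principal square root of h - c; the identity then continues
  -- analytically.
  have hu2 : ∀ s ∈ I, u s ^ 2 = ((h s - c : ℝ) : ℂ) := by
    have hr : AnalyticOnNhd ℝ (fun s => ((h s - c : ℝ) : ℂ)) I := by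
      push_cast
      exact hha.sub analyticOnNhd_const
    obtain ⟨ε, hε, hb⟩ := Metric.isOpen_iff.1 hO s₀ ⟨hs₀, h0⟩
    refine fun s hs => (hua.pow 2).eqOn_of_preconnected_of_eventuallyEq hr hc.isPreconnected
      hs₀ ?_ hs
    filter_upwards [Metric.ball_mem_nhds s₀ hε] with s hs
    have hsub : uIcc s₀ s ⊆ Metric.ball s₀ ε :=
      (convex_ball s₀ ε).ordConnected.uIcc_subset (Metric.mem_ball_self hε) hs
    simp only [Pi.pow_apply]
    rw [← csqrt_eq_of_hasDerivAt hp hI hc hs₀ hu hu0 (hb hs).1 (fun t ht => (hb (hsub ht)).2),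
      csqrt_sq]
  set φ : ℝ → ℂ := fun s => zetaPrimitive g₂ c σ w ((s : ℂ) + α) with hφdef
  have hφ : ∀ s ∈ I, h s ≠ c → HasDerivAt φ (1 / ((h s - c : ℝ) : ℂ)) s := by
    intro s hs hne
    have := (hasDerivAt_zetaPrimitive hσ (hα s hs).1 hw0 hw1 hw2 (hα.wP_ne hw1 hs hne)
      hd).comp_shift
    rwa [← (hα s hs).2, ← Complex.ofReal_sub] at this
  set C : ℂ := csqrt (h s₀ - c) / lameE σ (-w) ((s₀ : ℂ) + α) with hC
  -- This is (φ - φ(s₀)) u with σ(z + w) ζ(z + w) written as σ'(z + w), which is analytic also where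
  -- h = c.
  set v : ℝ → ℂ := fun s => -1 / (3 * (c : ℂ) ^ 2 - (g₂ : ℂ) / 4) *
    (C * (deriv σ ((s : ℂ) + α + w) / σ ((s : ℂ) + α) *
      Complex.exp (((s : ℂ) + α) * wZeta σ (-w))) + c * ((s : ℂ) + α) * u s) - φ s₀ * u s with hv
  have hva : AnalyticOnNhd ℝ v I := by
    intro s hs
    have a1 : AnalyticAt ℝ (fun s : ℝ => (s : ℂ) + α) s := analyticAt_ofReal.add analyticAt_const
    have a2 : AnalyticAt ℝ (fun s : ℝ => deriv σ ((s : ℂ) + α + w)) s := by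
      have : AnalyticAt ℂ (fun z => deriv σ (z + w)) ((s : ℂ) + α) :=
        AnalyticAt.fun_comp (g := deriv σ) (f := fun z => z + w) (hσ.analyticAt _).deriv
          (analyticAt_id.add analyticAt_const)
      exact this.comp_shift
    have a3 : AnalyticAt ℝ (fun s : ℝ => σ ((s : ℂ) + α)) s := (hσ.analyticAt _).comp_shift
    have a4 : AnalyticAt ℝ (fun s : ℝ => Complex.exp (((s : ℂ) + α) * wZeta σ (-w))) s := by
      have : AnalyticAt ℂ (fun z => Complex.exp (z * wZeta σ (-w))) ((s : ℂ) + α) :=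
        (analyticAt_id.mul analyticAt_const).cexp
      exact this.comp_shift
    exact (analyticAt_const.mul ((analyticAt_const.mul ((a2.div a3 (hα s hs).1).mul a4)).add
      ((analyticAt_const.mul a1).mul (hua s hs)))).sub (analyticAt_const.mul (hua s hs))
  have hvu : ∀ s ∈ I, h s ≠ c → v s = (φ s - φ s₀) * u s := by
    intro s hs hne
    obtain ⟨n1, -⟩ := hσ.ne_zero_of_wP_ne (hα s hs).1 hw0 (hα.wP_ne hw1 hs hne)
    have n2 := (hα s hs).1
    simp only [hv, hφdef, hudef, lameU, ← hC]
    unfold zetaPrimitive lameE wZeta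
    rw [sub_neg_eq_add]
    field_simp
  obtain ⟨Γ, h1, h2, h3⟩ := exists_explicitFrame_of_eq hp hI hc hha hs₀ h0 hμ hua hva hu2 hu hφ
    hvu hu0
  exact ⟨fun s hs hne => phase_eq_sub hc hp.smooth.continuousOn hs₀ hs hne hμ0 hφ,
    Γ, h1, h2, fun s hs hne => ⟨u s, hu2 s hs, h3 s hs hne⟩⟩

end weierstrassForm

/-! ### Multiple roots of the cubic, and the frames in all cases -/

section degenerate
variable {I : Set ℝ} {g₂ g₃ : ℝ} {h : ℝ → ℝ} {c s₀ : ℝ} {σ : ℂ → ℂ} {α w : ℂ}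

theorem hasDerivAt_csqrt_sub (hI : IsOpen I) (hp : IsPotential I g₂ g₃ h) {s : ℝ} (hs : s ∈ I)
    (hne : h s ≠ c) :
    HasDerivAt (fun s => csqrt (h s - c)) (csqrt (h s - c) *
      ((((deriv h s : ℝ) : ℂ) + 0) / (2 * ((h s - c : ℝ) : ℂ)))) s := by
  have hxt : h s - c ≠ 0 := sub_ne_zero.2 hne
  have d2 := (hasDerivAt_csqrt hxt).scomp s ((hp.hasDerivAt hI hs).sub_const c)
  simp only [Function.comp_def] at d2
  refine d2.congr_deriv ?_
  have hr := csqrt_ne_zero hxt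
  have hr2 := csqrt_sq (h s - c)
  rw [← hr2]
  simp only [Complex.real_smul]
  field_simp
  ring

theorem exists_explicitFrame_of_primitive (hσ : IsWeierstrassSigma g₂ g₃ σ)
    (hα : IsShift I h σ α) (hI : IsOpen I) (hc : I.OrdConnected) (hp : IsPotential I g₂ g₃ h)
    (hs₀ : s₀ ∈ I) (hne : ∀ s ∈ I, h s ≠ c) (hμ : cubicP g₂ g₃ c = 0) {φ : ℝ → ℂ}
    (hφa : AnalyticOnNhd ℝ φ I) (hφ : ∀ s ∈ I, HasDerivAt φ (1 / ((h s - c : ℝ) : ℂ)) s) :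
    ∃ Γ, IsExplicitFrame I g₂ g₃ h c s₀ Γ ∧ IsSpinorSolution I h c Γ := by
  have hha := hα.analyticOnNhd hσ hI
  have hre : AnalyticOnNhd ℝ (fun s => h s - c) I := by
    intro s hs
    refine AnalyticAt.sub ?_ analyticAt_const
    exact (Complex.reCLM.analyticAt _).comp (hha s hs)
  have hua : AnalyticOnNhd ℝ (fun s => csqrt (h s - c)) I := fun s hs =>
    AnalyticAt.fun_comp (analyticAt_csqrt (sub_ne_zero.2 (hne s hs))) (hre s hs)
  obtain ⟨Γ, h1, h2, -⟩ := exists_explicitFrame_of_eq (v := fun s => (φ s - φ s₀) * csqrt (h s - c))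
    hp hI hc hha hs₀ (hne s₀ hs₀) hμ hua
    ((hφa.sub analyticOnNhd_const).mul hua) (fun s _ => csqrt_sq _)
    (fun s hs hn => hasDerivAt_csqrt_sub hI hp hs hn) (fun s hs _ => hφ s hs)
    (fun _ _ _ => rfl) rfl
  exact ⟨Γ, h1, h2⟩

theorem hasDerivAt_nodePrimitive (hI : IsOpen I) (hc : I.OrdConnected)
    (hp : IsPotential I g₂ g₃ h) (hne : ∀ s ∈ I, h s ≠ c) (hμ : cubicP g₂ g₃ c = 0)
    (hd : 3 * c ^ 2 - g₂ / 4 = 0) (hc0 : c ≠ 0) {s : ℝ} (hs : s ∈ I) :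
    HasDerivAt (fun s => ((-1 / (12 * c) * (deriv h s / (h s - c) ^ 2 + 2 * s) : ℝ) : ℂ))
      (1 / ((h s - c : ℝ) : ℂ)) s := by
  have hx : h s - c ≠ 0 := sub_ne_zero.2 (hne s hs)
  have hg2 : g₂ = 12 * c ^ 2 := by linarith
  -- The invariants are those of P(t) = 4 (t - c)² (t + 2 c).
  have hg3 : g₃ = -8 * c ^ 3 := by
    unfold cubicP at hμ
    rw [hg2] at hμ
    linarith
  have key : HasDerivAt (fun s => -1 / (12 * c) * (deriv h s / (h s - c) ^ 2 + 2 * s))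
      (1 / (h s - c)) s := by
    refine ((((hp.hasDerivAt_deriv hI hc hs).fun_div
      (((hp.hasDerivAt hI hs).sub_const c).fun_pow 2) (pow_ne_zero 2 hx)).fun_add
      ((hasDerivAt_id' s).const_mul 2)).const_mul (-1 / (12 * c))).congr_deriv ?_
    have ho := hp.ode s hs
    unfold cubicP at ho
    rw [hg2, hg3] at ho
    rw [hg2]
    field_simp
    generalize h s = y at *
    generalize deriv h s = y' at *
    push_cast
    linear_combination 4 * (y - c) * ho
  exact_mod_cast key.ofReal_comp

theorem phase_node_eq (hI : IsOpen I) (hc : I.OrdConnected)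
    (hp : IsPotential I g₂ g₃ h) (hs₀ : s₀ ∈ I) (hμ : cubicP g₂ g₃ c = 0)
    (hd : 3 * c ^ 2 - g₂ / 4 = 0) (hc0 : c ≠ 0) {s : ℝ} (hs : s ∈ I) :
    h s ≠ c ∧ phase g₂ g₃ h c s₀ s =
      ((-1 / (12 * c) * ((deriv h s / (h s - c) ^ 2 + 2 * s) -
        (deriv h s₀ / (h s₀ - c) ^ 2 + 2 * s₀)) : ℝ) : ℂ) := by
  have hne := hp.ne_of_multiple_root hI hc hμ hd
  refine ⟨hne s hs, ?_⟩
  rw [phase_eq_sub hc hp.smooth.continuousOn hs₀ hs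
    (fun u hu => hne u (hc.uIcc_subset hs₀ hs hu)) (muC_eq_zero_iff.2 hμ)
    (fun u hu _ => hasDerivAt_nodePrimitive hI hc hp hne hμ hd hc0 hu)]
  push_cast
  ring

theorem wZeta_id (z : ℂ) : wZeta id z = z⁻¹ := by
  unfold wZeta
  rw [deriv_id, id, one_div]

theorem wP_id (z : ℂ) : wP id z = (z ^ 2)⁻¹ := by
  unfold wP
  rw [show wZeta id = fun z => z⁻¹ from funext wZeta_id]
  simp

theorem isWeierstrassSigma_id : IsWeierstrassSigma 0 0 id where
  entire := differentiable_id
  odd := fun _ => rfl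
  deriv_zero := deriv_id 0
  ode := by
    intro z hz
    have hz : z ≠ 0 := hz
    rw [show wP id = fun z => (z ^ 2)⁻¹ from funext wP_id]
    have := ((hasDerivAt_id' z).fun_pow 2).fun_inv (pow_ne_zero 2 hz)
    rw [this.deriv]
    push_cast
    field_simp
    ring

/-- For g₂ = g₃ = 0 the function σ(z) = z qualifies, and uniqueness leaves no other. -/
theorem IsShift.cusp (hσ : IsWeierstrassSigma 0 0 σ) (hα : IsShift I h σ α) {s : ℝ} (hs : s ∈ I) :
    (s : ℂ) + α ≠ 0 ∧ ((h s : ℝ) : ℂ) = (((s : ℂ) + α) ^ 2)⁻¹ := by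
  have := hα s hs
  rw [hσ.unique isWeierstrassSigma_id, wP_id] at this
  exact this

theorem hasDerivAt_cuspPrimitive (hσ : IsWeierstrassSigma 0 0 σ) (hα : IsShift I h σ α) {s : ℝ}
    (hs : s ∈ I) :
    HasDerivAt (fun s : ℝ => ((s : ℂ) + α) ^ 3 / 3) (1 / ((h s - 0 : ℝ) : ℂ)) s := by
  obtain ⟨h1, h2⟩ := hα.cusp hσ hs
  refine (((hasDerivAt_add_const_ofReal α s).fun_pow 3).div_const 3).congr_deriv ?_
  rw [sub_zero, h2]
  field_simp
  push_cast
  ring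

theorem phase_cusp_eq (hσ : IsWeierstrassSigma 0 0 σ) (hα : IsShift I h σ α) (hI : IsOpen I)
    (hc : I.OrdConnected) (hp : IsPotential I 0 0 h) (hs₀ : s₀ ∈ I) {s : ℝ} (hs : s ∈ I) :
    h s ≠ 0 ∧ phase 0 0 h 0 s₀ s = ((s : ℂ) + α) ^ 3 / 3 - ((s₀ : ℂ) + α) ^ 3 / 3 := by
  have hμ : cubicP 0 0 0 = 0 := by unfold cubicP; ring
  have hne := hp.ne_of_multiple_root hI hc hμ (by norm_num)
  exact ⟨hne s hs, phase_eq_sub (φ := fun s : ℝ => ((s : ℂ) + α) ^ 3 / 3) hc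
    hp.smooth.continuousOn hs₀ hs
    (fun u hu => hne u (hc.uIcc_subset hs₀ hs hu)) (muC_eq_zero_iff.2 hμ)
    (fun u hu _ => hasDerivAt_cuspPrimitive hσ hα hu)⟩

/-- ℘'(w)² = P(c) = (2 μ)², so one of w and -w has the right sign. -/
theorem IsWeierstrassSigma.exists_isSpectralPoint (hσ : IsWeierstrassSigma g₂ g₃ σ)
    (hcd : cubicP g₂ g₃ c ≠ 0 ∨ 3 * c ^ 2 - g₂ / 4 ≠ 0) : ∃ w, IsSpectralPoint g₂ g₃ σ c w := by
  obtain ⟨w, hw0, hw⟩ := hσ.exists_wP_eq (c : ℂ) (by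
    rcases hcd with h | h
    · left
      unfold cubicP at h
      exact_mod_cast h
    · right
      intro h1
      have : 12 * c ^ 2 - g₂ = 0 := by exact_mod_cast h1
      apply h
      linarith)
  have h2 := hσ.ode w hw0
  rw [hw] at h2
  have h3 := four_mul_muC_sq g₂ g₃ c
  unfold cubicP at h3
  push_cast at h3
  have : (deriv (wP σ) w - 2 * muC g₂ g₃ c) * (deriv (wP σ) w + 2 * muC g₂ g₃ c) = 0 := by
    linear_combination h2 - h3
  rcases mul_eq_zero.1 this with h4 | h4
  · exact ⟨w, hw0, hw, sub_eq_zero.1 h4⟩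
  · refine ⟨-w, by rw [hσ.odd]; exact neg_ne_zero.2 hw0, by rw [hσ.wP_neg, hw], ?_⟩
    rw [hσ.deriv_wP_neg]
    linear_combination -h4

theorem IsPotential.exists_explicitFrame (hp : IsPotential I g₂ g₃ h) (hI : IsOpen I)
    (hc : I.OrdConnected) (hs₀ : s₀ ∈ I) (h0 : h s₀ ≠ c) :
    ∃ Γ, IsExplicitFrame I g₂ g₃ h c s₀ Γ ∧ IsSpinorSolution I h c Γ := by
  obtain ⟨σ, hσ⟩ := exists_isWeierstrassSigma g₂ g₃
  obtain ⟨α, hα⟩ := hp.exists_isShift hI hc hσ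
  by_cases hμ : cubicP g₂ g₃ c = 0
  · by_cases hd : 3 * c ^ 2 - g₂ / 4 = 0
    · have hne := hp.ne_of_multiple_root hI hc hμ hd
      by_cases hc0 : c = 0
      · subst hc0
        have hg2 : g₂ = 0 := by linarith
        have hg3 : g₃ = 0 := by unfold cubicP at hμ; linarith
        subst hg2 hg3
        refine exists_explicitFrame_of_primitive hσ hα hI hc hp hs₀ hne hμ (fun s _ => ?_)
          (fun s hs => hasDerivAt_cuspPrimitive hσ hα hs)
        exact ((analyticAt_ofReal.add analyticAt_const).pow 3).div_const
      · refine exists_explicitFrame_of_primitive hσ hα hI hc hp hs₀ hne hμ (fun s hs => ?_)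
          (fun s hs => hasDerivAt_nodePrimitive hI hc hp hne hμ hd hc0 hs)
        have hha := hα.analyticOnNhd hσ hI s hs
        have hx : ((h s : ℝ) : ℂ) - c ≠ 0 := by
          exact_mod_cast sub_ne_zero.2 (hne s hs)
        have : AnalyticAt ℝ (fun s : ℝ => -1 / (12 * (c : ℂ)) *
            (deriv (wP σ) ((s : ℂ) + α) / (((h s : ℝ) : ℂ) - c) ^ 2 + 2 * (s : ℂ))) s :=
          analyticAt_const.mul ((((analyticAt_wP (hσ.analyticAt _) (hα s hs).1).deriv.comp_shift).div
            ((hha.sub analyticAt_const).pow 2) (pow_ne_zero 2 hx)).add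
            (analyticAt_const.mul analyticAt_ofReal))
        refine this.congr ?_
        filter_upwards [hI.mem_nhds hs] with t ht
        rw [← hα.deriv_eq hσ hI hp ht]
        push_cast
        ring
    · obtain ⟨w, hw⟩ := hσ.exists_isSpectralPoint (Or.inr hd)
      obtain ⟨-, Γ, h1, h2, -⟩ := exists_explicitFrame_of_point_of_eq hσ hα hI hc hp hs₀ h0 hw hμ hd
      exact ⟨Γ, h1, h2⟩
  · obtain ⟨w, hw⟩ := hσ.exists_isSpectralPoint (Or.inl hμ)
    obtain ⟨Γ, h1, h2, -⟩ := exists_explicitFrame_of_point_of_ne hσ hα hI hc hp hs₀ h0 hw hμ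
    exact ⟨Γ, h1, h2⟩

theorem IsExplicitFrame.hasWeierstrassForm (hσ : IsWeierstrassSigma g₂ g₃ σ)
    (hα : IsShift I h σ α) (hI : IsOpen I) (hc : I.OrdConnected) (hp : IsPotential I g₂ g₃ h)
    (hs₀ : s₀ ∈ I) (h0 : h s₀ ≠ c) {Γ : ℝ → Matrix (Fin 2) (Fin 2) ℂ}
    (hΓ : IsExplicitFrame I g₂ g₃ h c s₀ Γ) : HasWeierstrassForm I g₂ g₃ h c s₀ σ α Γ where
  exists_point := hσ.exists_isSpectralPoint
  phase_sigma := fun hμ w hw s hs hne => exp_two_mul_phase hσ hα hI hc hp hs₀ h0 hw hμ hs hne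
  frame_sigma := by
    intro hμ w hw s hs hne
    obtain ⟨Γ', h1, -, h3⟩ := exists_explicitFrame_of_point_of_ne hσ hα hI hc hp hs₀ h0 hw hμ
    obtain ⟨n1, n2⟩ := hσ.ne_zero_of_wP_ne (hα s hs).1 hw.1 (hα.wP_ne hw.2.1 hs hne)
    have hr := csqrt_ne_zero (sub_ne_zero.2 hne)
    have hE := lameE_shift_ne_zero hσ hα hw.1 hw.2.1 hs hne
    have hE0 := lameE_shift_ne_zero hσ hα hw.1 hw.2.1 hs₀ h0
    have hu : lameU h c s₀ σ α w s ≠ 0 :=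
      mul_ne_zero (div_ne_zero (csqrt_ne_zero (sub_ne_zero.2 h0)) hE0) hE
    -- The logarithm is chosen so that e^φ r = u with r the principal root of h - c, as the formula
    -- for the frame requires.
    have he : Complex.exp (Complex.log (lameU h c s₀ σ α w s / csqrt (h s - c))) =
        lameU h c s₀ σ α w s / csqrt (h s - c) := Complex.exp_log (div_ne_zero hu hr)
    refine ⟨n2, n1, Complex.log (lameU h c s₀ σ α w s / csqrt (h s - c)), csqrt (h s - c),
      csqrt_sq _, ?_, ?_⟩
    · rw [← lameU_div hσ hα hw.1 hw.2.1 hs₀ h0 hs hne, two_mul, Complex.exp_add, he, ← csqrt_sq]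
      field_simp
    · rw [hΓ.eqOn hp hI hc hs₀ h0 h1 hs]
      exact h3 s hs hne _ _ (csqrt_sq _) (by rw [he, div_mul_cancel₀ _ hr])
  phase_zeta := fun hμ hd w hw =>
    (exists_explicitFrame_of_point_of_eq hσ hα hI hc hp hs₀ h0 hw hμ hd).1
  frame_zeta := by
    intro hμ hd w hw s hs hne
    obtain ⟨-, Γ', h1, -, h3⟩ := exists_explicitFrame_of_point_of_eq hσ hα hI hc hp hs₀ h0 hw hμ hd
    refine ⟨(hσ.ne_zero_of_wP_ne (hα s hs).1 hw.1 (hα.wP_ne hw.2.1 hs hne)).1, ?_⟩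
    rw [hΓ.eqOn hp hI hc hs₀ h0 h1 hs]
    exact h3 s hs hne
  phase_node := fun hμ hd hc0 s hs => phase_node_eq hI hc hp hs₀ hμ hd hc0 hs
  phase_cusp := by
    intro hμ hg2 hg3 s hs
    subst hg2 hg3
    have hc0 : c = 0 := by
      unfold cubicP at hμ
      have : c ^ 3 = 0 := by linarith
      exact pow_eq_zero_iff (by norm_num) |>.1 this
    subst hc0
    exact phase_cusp_eq hσ hα hI hc hp hs₀ hs

end degenerate

/-! ### Real frames -/

section realFrame
variable {I : Set ℝ}

/-- `Γ' = Γ (0, 1; κ, 0)` on `I`, with smooth entries. -/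
structure IsFrameSolution (I : Set ℝ) (κ : ℝ → ℝ) (Γ : ℝ → SL2R) : Prop where
  smooth : ∀ i j, ContDiffOn ℝ (⊤ : ℕ∞) (fun s => (Γ s).1 i j) I
  hasDerivAt_zero : ∀ s ∈ I, ∀ i, HasDerivAt (fun t => (Γ t).1 i 0) (κ s * (Γ s).1 i 1) s
  hasDerivAt_one : ∀ s ∈ I, ∀ i, HasDerivAt (fun t => (Γ t).1 i 1) ((Γ s).1 i 0) s

theorem eq_zero_of_linear_system (hc : I.OrdConnected) {κ x y : ℝ → ℝ}
    (hκ : ContinuousOn κ I) (hx : ∀ s ∈ I, HasDerivAt x (κ s * y s) s)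
    (hy : ∀ s ∈ I, HasDerivAt y (x s) s) {s₀ : ℝ} (hs₀ : s₀ ∈ I) (hx0 : x s₀ = 0)
    (hy0 : y s₀ = 0) : ∀ s ∈ I, x s = 0 ∧ y s = 0 := by
  have := eq_zero_of_norm_deriv_le (f := fun s => (x s, y s)) (K := fun s => |κ s| + 1) hc
    (fun s hs => (hx s hs).prodMk (hy s hs)) (hκ.abs.add continuousOn_const) (fun s _ => by
      simp only [Prod.norm_def, Real.norm_eq_abs]
      have h1 : |x s| ≤ max |x s| |y s| := le_max_left _ _
      have h2 : |y s| ≤ max |x s| |y s| := le_max_right _ _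
      have h3 := abs_nonneg (κ s)
      have h4 := abs_nonneg (x s)
      refine max_le ?_ ?_
      · rw [abs_mul]
        nlinarith
      · nlinarith) hs₀ (by simp [hx0, hy0])
  exact fun s hs => ⟨congrArg Prod.fst (this s hs), congrArg Prod.snd (this s hs)⟩

theorem IsFrameSolution.eqOn (hc : I.OrdConnected) {κ : ℝ → ℝ} (hκ : ContinuousOn κ I)
    {Γ Γ' : ℝ → SL2R} (h : IsFrameSolution I κ Γ) (h' : IsFrameSolution I κ Γ') {s₀ : ℝ}
    (hs₀ : s₀ ∈ I) (h0 : Γ s₀ = Γ' s₀) : EqOn Γ Γ' I := by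
  have key : ∀ i, ∀ s ∈ I, (Γ s).1 i 0 - (Γ' s).1 i 0 = 0 ∧ (Γ s).1 i 1 - (Γ' s).1 i 1 = 0 :=
    fun i => eq_zero_of_linear_system (x := fun s => (Γ s).1 i 0 - (Γ' s).1 i 0)
      (y := fun s => (Γ s).1 i 1 - (Γ' s).1 i 1) hc hκ
      (fun s hs => ((h.hasDerivAt_zero s hs i).fun_sub (h'.hasDerivAt_zero s hs i)).congr_deriv
        (by ring))
      (fun s hs => (h.hasDerivAt_one s hs i).fun_sub (h'.hasDerivAt_one s hs i)) hs₀
      (by simp [h0]) (by simp [h0])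
  intro s hs
  ext i j
  fin_cases j
  · exact sub_eq_zero.1 (key i s hs).1
  · exact sub_eq_zero.1 (key i s hs).2

theorem IsFrameSolution.const_mul {κ : ℝ → ℝ} {Γ : ℝ → SL2R} (h : IsFrameSolution I κ Γ)
    (A : SL2R) : IsFrameSolution I κ (fun s => A * Γ s) := by
  have e : ∀ i j s, (A * Γ s).1 i j = A.1 i 0 * (Γ s).1 0 j + A.1 i 1 * (Γ s).1 1 j := by
    intro i j s
    rw [Matrix.SpecialLinearGroup.coe_mul, Matrix.mul_apply, Fin.sum_univ_two]
  refine ⟨fun i j => ?_, fun s hs i => ?_, fun s hs i => ?_⟩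
  · simp only [e]
    exact (contDiffOn_const.mul (h.smooth 0 j)).add (contDiffOn_const.mul (h.smooth 1 j))
  · simp only [e]
    refine (((h.hasDerivAt_zero s hs 0).const_mul _).fun_add
      ((h.hasDerivAt_zero s hs 1).const_mul _)).congr_deriv ?_
    ring
  · simp only [e]
    exact ((h.hasDerivAt_one s hs 0).const_mul _).fun_add
      ((h.hasDerivAt_one s hs 1).const_mul _)

theorem IsSpinorFrame.isFrameSolution {γ Γp Γm : ℝ → SL2R} {k : ℝ → ℝ}
    (h : IsSpinorFrame I γ Γp Γm k (fun _ => 1)) :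
    IsFrameSolution I (fun s => k s + 1) Γp ∧ IsFrameSolution I (fun s => k s - 1) Γm := by
  refine ⟨⟨h.smooth_p, fun s hs i => ?_, fun s hs i => ?_⟩,
    ⟨h.smooth_m, fun s hs i => ?_, fun s hs i => ?_⟩⟩
  · refine (h.deriv_p s hs i 0).congr_deriv ?_
    simp [Matrix.mul_apply, Fin.sum_univ_two]; ring
  · refine (h.deriv_p s hs i 1).congr_deriv ?_
    simp [Matrix.mul_apply, Fin.sum_univ_two]
  · refine (h.deriv_m s hs i 0).congr_deriv ?_
    simp [Matrix.mul_apply, Fin.sum_univ_two]; ring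
  · refine (h.deriv_m s hs i 1).congr_deriv ?_
    simp [Matrix.mul_apply, Fin.sum_univ_two]

theorem isSpinorFrame_of_isFrameSolution {Γp Γm : ℝ → SL2R} {k : ℝ → ℝ}
    (hk : ContDiffOn ℝ (⊤ : ℕ∞) k I)
    (hp : IsFrameSolution I (fun s => k s + 1) Γp) (hm : IsFrameSolution I (fun s => k s - 1) Γm) :
    IsSpinorFrame I (fun s => Γp s * (Γm s)⁻¹) Γp Γm k (fun _ => 1) where
  smooth_p := hp.smooth
  smooth_m := hm.smooth
  smooth_k := hk
  smooth_ω := contDiffOn_const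
  ω_ne := fun _ _ => one_ne_zero
  proj := fun _ _ => rfl
  deriv_p := by
    intro s hs i j
    fin_cases j
    · refine (hp.hasDerivAt_zero s hs i).congr_deriv ?_
      simp [Matrix.mul_apply, Fin.sum_univ_two]; ring
    · refine (hp.hasDerivAt_one s hs i).congr_deriv ?_
      simp [Matrix.mul_apply, Fin.sum_univ_two]
  deriv_m := by
    intro s hs i j
    fin_cases j
    · refine (hm.hasDerivAt_zero s hs i).congr_deriv ?_
      simp [Matrix.mul_apply, Fin.sum_univ_two]; ring
    · refine (hm.hasDerivAt_one s hs i).congr_deriv ?_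
      simp [Matrix.mul_apply, Fin.sum_univ_two]

theorem IsSpinorSolution.hasDerivAt_zero {h : ℝ → ℝ} {c : ℝ} {Γ : ℝ → Matrix (Fin 2) (Fin 2) ℂ}
    (hΓ : IsSpinorSolution I h c Γ) {s : ℝ} (hs : s ∈ I) (i : Fin 2) :
    HasDerivAt (fun t => Γ t i 0) (((2 * h s + c : ℝ) : ℂ) * Γ s i 1) s := by
  refine (hΓ.hasDerivAt s hs i 0).congr_deriv ?_
  simp [Matrix.mul_apply, Fin.sum_univ_two]; ring

theorem IsSpinorSolution.hasDerivAt_one {h : ℝ → ℝ} {c : ℝ} {Γ : ℝ → Matrix (Fin 2) (Fin 2) ℂ}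
    (hΓ : IsSpinorSolution I h c Γ) {s : ℝ} (hs : s ∈ I) (i : Fin 2) :
    HasDerivAt (fun t => Γ t i 1) (Γ s i 0) s := by
  refine (hΓ.hasDerivAt s hs i 1).congr_deriv ?_
  simp [Matrix.mul_apply, Fin.sum_univ_two]

theorem HasDerivAt.complex_re {f : ℝ → ℂ} {f' : ℂ} {s : ℝ} (hf : HasDerivAt f f' s) :
    HasDerivAt (fun t => (f t).re) f'.re s :=
  (Complex.reCLM.hasFDerivAt.comp_hasDerivAt s hf)

theorem HasDerivAt.complex_im {f : ℝ → ℂ} {f' : ℂ} {s : ℝ} (hf : HasDerivAt f f' s) :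
    HasDerivAt (fun t => (f t).im) f'.im s :=
  (Complex.imCLM.hasFDerivAt.comp_hasDerivAt s hf)

/-- The coefficients are real and Γ(s₀) = 1, so the imaginary parts solve a homogeneous linear
system with zero data. The coefficient matrix has trace 0, which keeps the determinant equal to 1.
-/
theorem IsSpinorSolution.exists_real (hI : IsOpen I) (hc : I.OrdConnected) {h : ℝ → ℝ} {c : ℝ}
    (hh : ContinuousOn h I) {Γ : ℝ → Matrix (Fin 2) (Fin 2) ℂ} (hΓ : IsSpinorSolution I h c Γ)
    {s₀ : ℝ} (hs₀ : s₀ ∈ I) (h0 : Γ s₀ = 1) :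
    ∃ G : ℝ → SL2R, IsFrameSolution I (fun s => 2 * h s + c) G ∧
      (∀ s ∈ I, Γ s = toComplexMatrix (G s)) := by
  classical
  have hκ : ContinuousOn (fun s => 2 * h s + c) I :=
    (continuousOn_const.mul hh).add continuousOn_const
  have him : ∀ i, ∀ s ∈ I, (Γ s i 0).im = 0 ∧ (Γ s i 1).im = 0 := by
    intro i
    refine eq_zero_of_linear_system (x := fun s => (Γ s i 0).im) (y := fun s => (Γ s i 1).im)
      hc hκ (fun s hs => ?_) (fun s hs => (hΓ.hasDerivAt_one hs i).complex_im) hs₀ ?_ ?_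
    · exact ((hΓ.hasDerivAt_zero hs i).complex_im).congr_deriv (Complex.im_ofReal_mul _ _)
    · rw [h0, Matrix.one_apply]; split_ifs <;> simp
    · rw [h0, Matrix.one_apply]; split_ifs <;> simp
  have dre0 : ∀ s ∈ I, ∀ i, HasDerivAt (fun t => (Γ t i 0).re)
      ((2 * h s + c) * (Γ s i 1).re) s := fun s hs i =>
    ((hΓ.hasDerivAt_zero hs i).complex_re).congr_deriv (Complex.re_ofReal_mul _ _)
  have dre1 : ∀ s ∈ I, ∀ i, HasDerivAt (fun t => (Γ t i 1).re) ((Γ s i 0).re) s := fun s hs i =>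
    (hΓ.hasDerivAt_one hs i).complex_re
  have hdet : ∀ s ∈ I, (Γ s 0 0).re * (Γ s 1 1).re - (Γ s 0 1).re * (Γ s 1 0).re - 1 = 0 := by
    refine eq_zero_of_norm_deriv_le
      (f := fun s => (Γ s 0 0).re * (Γ s 1 1).re - (Γ s 0 1).re * (Γ s 1 0).re - 1)
      (f' := fun _ => 0) (K := fun _ => 0) hc (fun s hs => ?_) continuousOn_const (fun s _ => by simp)
      hs₀ (by simp [h0])
    refine ((((dre0 s hs 0).fun_mul (dre1 s hs 1)).fun_sub
      ((dre1 s hs 0).fun_mul (dre0 s hs 1))).sub_const 1).congr_deriv ?_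
    ring
  set G : ℝ → SL2R := fun s => if hs : s ∈ I then
    ⟨(Γ s).map Complex.re, by
      have := hdet s hs
      rw [Matrix.det_fin_two]
      simp only [Matrix.map_apply]
      linarith⟩ else 1 with hG
  have hGe : ∀ s ∈ I, ∀ i j, (G s).1 i j = (Γ s i j).re := by
    intro s hs i j
    have : G s = ⟨(Γ s).map Complex.re, _⟩ := dif_pos hs
    rw [this]
    rfl
  have hev : ∀ s ∈ I, ∀ i j, (fun t => (G t).1 i j) =ᶠ[nhds s] fun t => (Γ t i j).re := by
    intro s hs i j
    filter_upwards [hI.mem_nhds hs] with t ht using hGe t ht i j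
  refine ⟨G, ⟨fun i j => ?_, fun s hs i => ?_, fun s hs i => ?_⟩, fun s hs => ?_⟩
  · intro s hs
    have : AnalyticAt ℝ (fun t => (Γ t i j).re) s :=
      (Complex.reCLM.analyticAt _).comp (hΓ.analytic i j s hs)
    exact (this.contDiffAt.congr_of_eventuallyEq (hev s hs i j)).contDiffWithinAt
  · rw [hGe s hs]
    exact (dre0 s hs i).congr_of_eventuallyEq (hev s hs i 0)
  · rw [hGe s hs]
    exact (dre1 s hs i).congr_of_eventuallyEq (hev s hs i 1)
  · ext i j
    unfold toComplexMatrix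
    rw [Matrix.map_apply, hGe s hs]
    refine Complex.ext (by simp) ?_
    fin_cases j
    · simpa using (him i s hs).1
    · simpa using (him i s hs).2

theorem toComplexMatrix_mul (A B : SL2R) :
    toComplexMatrix (A * B) = toComplexMatrix A * toComplexMatrix B := by
  unfold toComplexMatrix
  rw [Matrix.SpecialLinearGroup.coe_mul]
  exact Matrix.map_mul (f := Complex.ofRealHom)

theorem toComplexMatrix_inv (A : SL2R) : toComplexMatrix A⁻¹ = (toComplexMatrix A)⁻¹ := by
  refine (Matrix.inv_eq_right_inv ?_).symm
  rw [← toComplexMatrix_mul, mul_inv_cancel]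
  unfold toComplexMatrix
  rw [Matrix.SpecialLinearGroup.coe_one]
  exact Matrix.map_one _ Complex.ofReal_zero Complex.ofReal_one

/-- The explicit frame of a potential takes values in `SL(2, ℝ)`. -/
theorem IsPotential.exists_realFrame {g₂ g₃ : ℝ} {h : ℝ → ℝ} {s₀ : ℝ}
    (hp : IsPotential I g₂ g₃ h) (hI : IsOpen I) (hc : I.OrdConnected) (hs₀ : s₀ ∈ I)
    {c : ℝ} (h0 : h s₀ ≠ c) :
    ∃ G : ℝ → SL2R, IsFrameSolution I (fun s => 2 * h s + c) G ∧ G s₀ = 1 ∧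
      ∀ Γ, IsExplicitFrame I g₂ g₃ h c s₀ Γ → ∀ s ∈ I, Γ s = toComplexMatrix (G s) := by
  obtain ⟨Γ, h1, h2⟩ := hp.exists_explicitFrame hI hc hs₀ h0
  obtain ⟨G, h3, h4⟩ := h2.exists_real hI hc hp.smooth.continuousOn hs₀ (h1.map_base hs₀ h0)
  refine ⟨G, h3, ?_, fun Γ' hΓ' s hs => by rw [hΓ'.eqOn hp hI hc hs₀ h0 h1 hs, h4 s hs]⟩
  have := h4 s₀ hs₀
  rw [h1.map_base hs₀ h0] at this
  ext i j
  have e := congrFun (congrFun this i) j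
  unfold toComplexMatrix at e
  rw [Matrix.map_apply] at e
  have e' := congrArg Complex.re e
  rw [Complex.ofReal_re] at e'
  rw [← e']
  fin_cases i <;> fin_cases j <;> simp

end realFrame

/-! ### Null curves from spinor frames -/

section nullCurve
variable {I : Set ℝ} {Γp Γm : ℝ → SL2R} {k : ℝ → ℝ}

theorem coe_mul_inv_apply (A B : SL2R) (i : Fin 2) :
    (A * B⁻¹).1 i 0 = A.1 i 0 * B.1 1 1 - A.1 i 1 * B.1 1 0 ∧
    (A * B⁻¹).1 i 1 = A.1 i 1 * B.1 0 0 - A.1 i 0 * B.1 0 1 := by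
  rw [Matrix.SpecialLinearGroup.coe_mul, Matrix.SpecialLinearGroup.coe_inv, Matrix.adjugate_fin_two]
  simp [Matrix.mul_apply, Fin.sum_univ_two]
  constructor <;> ring

/-- γ⁻¹ γ' = Γ₋ (X₊ - X₋) Γ₋⁻¹, where X± = Γ±⁻¹ Γ±' and X₊ - X₋ = (0, 0; 2, 0) is nilpotent. -/
theorem logVelocity_mul_inv (hp : IsFrameSolution I (fun s => k s + 1) Γp)
    (hm : IsFrameSolution I (fun s => k s - 1) Γm) {s : ℝ} (hs : s ∈ I) :
    logVelocity (fun s => Γp s * (Γm s)⁻¹) s =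
      !![2 * ((Γm s).1 0 1 * (Γm s).1 1 1), -2 * (Γm s).1 0 1 ^ 2;
        2 * (Γm s).1 1 1 ^ 2, -2 * ((Γm s).1 0 1 * (Γm s).1 1 1)] := by
  have d0 : ∀ i, deriv (fun t => (Γp t * (Γm t)⁻¹).1 i 0) s = 2 * (Γp s).1 i 1 * (Γm s).1 1 1 := by
    intro i
    simp only [fun t => (coe_mul_inv_apply (Γp t) (Γm t) i).1]
    have := ((hp.hasDerivAt_zero s hs i).fun_mul (hm.hasDerivAt_one s hs 1)).fun_sub
      ((hp.hasDerivAt_one s hs i).fun_mul (hm.hasDerivAt_zero s hs 1))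
    rw [this.deriv]
    ring
  have d1 : ∀ i, deriv (fun t => (Γp t * (Γm t)⁻¹).1 i 1) s = -2 * (Γp s).1 i 1 * (Γm s).1 0 1 := by
    intro i
    simp only [fun t => (coe_mul_inv_apply (Γp t) (Γm t) i).2]
    have := ((hp.hasDerivAt_one s hs i).fun_mul (hm.hasDerivAt_zero s hs 0)).fun_sub
      ((hp.hasDerivAt_zero s hs i).fun_mul (hm.hasDerivAt_one s hs 0))
    rw [this.deriv]
    ring
  have hdet := (Γp s).2
  rw [Matrix.det_fin_two] at hdet
  unfold logVelocity
  rw [mul_inv_rev, inv_inv, Matrix.SpecialLinearGroup.coe_mul, Matrix.SpecialLinearGroup.coe_inv,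
    Matrix.adjugate_fin_two]
  ext i j
  fin_cases i <;> fin_cases j <;>
    simp only [Matrix.mul_apply, Fin.sum_univ_two, Matrix.of_apply, d0, d1, Fin.zero_eta,
      Fin.mk_one, Matrix.cons_val', Matrix.cons_val_zero, Matrix.cons_val_one,
      Matrix.cons_val_fin_one]
  · linear_combination 2 * (Γm s).1 0 1 * (Γm s).1 1 1 * hdet
  · linear_combination -2 * (Γm s).1 0 1 * (Γm s).1 0 1 * hdet
  · linear_combination 2 * (Γm s).1 1 1 * (Γm s).1 1 1 * hdet
  · linear_combination -2 * (Γm s).1 0 1 * (Γm s).1 1 1 * hdet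

theorem isNullCurve_mul_inv (hI : IsOpen I) (hp : IsFrameSolution I (fun s => k s + 1) Γp)
    (hm : IsFrameSolution I (fun s => k s - 1) Γm) :
    IsNullCurve I (fun s => Γp s * (Γm s)⁻¹) := by
  refine ⟨fun i j => ?_, fun s hs => ?_, fun s hs => ?_⟩
  · fin_cases j
    · refine ContDiffOn.congr ?_ (fun t _ => (coe_mul_inv_apply (Γp t) (Γm t) i).1)
      exact ((hp.smooth i 0).mul (hm.smooth 1 1)).sub ((hp.smooth i 1).mul (hm.smooth 1 0))
    · refine ContDiffOn.congr ?_ (fun t _ => (coe_mul_inv_apply (Γp t) (Γm t) i).2)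
      exact ((hp.smooth i 1).mul (hm.smooth 0 0)).sub ((hp.smooth i 0).mul (hm.smooth 0 1))
  · rw [logVelocity_mul_inv hp hm hs, Matrix.det_fin_two_of]
    ring
  · have ev : ∀ i j, (fun t => logVelocity (fun s => Γp s * (Γm s)⁻¹) t i j) =ᶠ[nhds s]
        fun t => !![2 * ((Γm t).1 0 1 * (Γm t).1 1 1), -2 * (Γm t).1 0 1 ^ 2;
        2 * (Γm t).1 1 1 ^ 2, -2 * ((Γm t).1 0 1 * (Γm t).1 1 1)] i j := by
      intro i j
      filter_upwards [hI.mem_nhds hs] with t ht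
      rw [logVelocity_mul_inv hp hm ht]
    have b' := hm.hasDerivAt_one s hs 0
    have d' := hm.hasDerivAt_one s hs 1
    have hd : (Matrix.of fun i j => deriv (fun t => logVelocity (fun s => Γp s * (Γm s)⁻¹) t i j) s)
        = !![2 * ((Γm s).1 0 0 * (Γm s).1 1 1 + (Γm s).1 0 1 * (Γm s).1 1 0),
            -4 * ((Γm s).1 0 1 * (Γm s).1 0 0);
          4 * ((Γm s).1 1 1 * (Γm s).1 1 0),
            -2 * ((Γm s).1 0 0 * (Γm s).1 1 1 + (Γm s).1 0 1 * (Γm s).1 1 0)] := by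
      ext i j
      rw [Matrix.of_apply, (ev i j).deriv_eq]
      fin_cases i <;> fin_cases j
      · exact ((b'.fun_mul d').const_mul 2).deriv
      · refine ((b'.fun_pow 2).const_mul (-2)).deriv.trans ?_
        simp; ring
      · refine ((d'.fun_pow 2).const_mul 2).deriv.trans ?_
        simp; ring
      · exact ((b'.fun_mul d').const_mul (-2)).deriv
    rw [hd, logVelocity_mul_inv hp hm hs, LinearIndependent.pair_iff]
    intro x y hxy
    have hdet := (Γm s).2
    rw [Matrix.det_fin_two] at hdet
    generalize (Γm s).1 0 0 = a at *
    generalize (Γm s).1 0 1 = b at *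
    generalize (Γm s).1 1 0 = c at *
    generalize (Γm s).1 1 1 = d at *
    have e00 := congrFun (congrFun hxy 0) 0
    have e01 := congrFun (congrFun hxy 0) 1
    have e10 := congrFun (congrFun hxy 1) 0
    have e11 := congrFun (congrFun hxy 1) 1
    simp at e00 e01 e10 e11
    -- Conjugated back by Γ₋ the relation reads x (0, 0; 2, 0) + y (2, 0; 0, -2) = 0; `hy` and `hx`
    -- are two of its entries.
    have hy : 2 * y * (a * d - b * c) ^ 2 = 0 := by
      linear_combination a * d * e00 - a * b * e10 + c * d * e01 - b * c * e11
    have hx : 2 * x * (a * d - b * c) ^ 2 = 0 := by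
      linear_combination -c * a * e00 + a * a * e10 - c * c * e01 + a * c * e11
    rw [hdet] at hx hy
    constructor <;> linarith

end nullCurve

/-! ### Functions of two variables -/

section twoVariables
variable {I : Set ℝ} {ε : ℝ} {f g : ℝ → ℝ → ℝ} {s : ℝ}

/-- Smoothness of `f t s` on `(-ε, ε) × I`. -/
def SmoothFamily (ε : ℝ) (I : Set ℝ) (f : ℝ → ℝ → ℝ) : Prop :=
  ContDiffOn ℝ (⊤ : ℕ∞) (fun x : ℝ × ℝ => f x.1 x.2) (Ioo (-ε) ε ×ˢ I)

/-- The derivative of a family at `t = 0`. -/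
noncomputable def dotAt (f : ℝ → ℝ → ℝ) (s : ℝ) : ℝ := deriv (fun t => f t s) 0

theorem SmoothFamily.contDiffAt (hI : IsOpen I) (hf : SmoothFamily ε I f) {t : ℝ}
    (ht : t ∈ Ioo (-ε) ε) (hs : s ∈ I) :
    ContDiffAt ℝ (⊤ : ℕ∞) (fun x : ℝ × ℝ => f x.1 x.2) (t, s) :=
  ContDiffOn.contDiffAt hf (IsOpen.mem_nhds (isOpen_Ioo.prod hI) (mk_mem_prod ht hs))

theorem SmoothFamily.hasDerivAt_left (hI : IsOpen I) (hf : SmoothFamily ε I f) {t : ℝ}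
    (ht : t ∈ Ioo (-ε) ε) (hs : s ∈ I) :
    HasDerivAt (fun t => f t s) (fderiv ℝ (fun x : ℝ × ℝ => f x.1 x.2) (t, s) (1, 0)) t :=
  HasFDerivAt.comp_hasDerivAt (f := fun t => (t, s)) t
    ((hf.contDiffAt hI ht hs).differentiableAt (by simp)).hasFDerivAt
    ((hasDerivAt_id' t).prodMk (hasDerivAt_const t s))

theorem SmoothFamily.hasDerivAt_right (hI : IsOpen I) (hf : SmoothFamily ε I f) {t : ℝ}
    (ht : t ∈ Ioo (-ε) ε) (hs : s ∈ I) :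
    HasDerivAt (fun s => f t s) (fderiv ℝ (fun x : ℝ × ℝ => f x.1 x.2) (t, s) (0, 1)) s :=
  HasFDerivAt.comp_hasDerivAt (f := fun s => (t, s)) s
    ((hf.contDiffAt hI ht hs).differentiableAt (by simp)).hasFDerivAt
    ((hasDerivAt_const s t).prodMk (hasDerivAt_id' s))

theorem zero_mem_Ioo_neg (hε : 0 < ε) : (0 : ℝ) ∈ Ioo (-ε) ε := ⟨by linarith, hε⟩

theorem SmoothFamily.hasDerivAt_dotAt (hI : IsOpen I) (hε : 0 < ε) (hf : SmoothFamily ε I f)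
    (hs : s ∈ I) : HasDerivAt (fun t => f t s) (dotAt f s) 0 :=
  (hf.hasDerivAt_left hI (zero_mem_Ioo_neg hε) hs).differentiableAt.hasDerivAt

theorem SmoothFamily.fderivFamily (hI : IsOpen I) (hf : SmoothFamily ε I f) :
    ContDiffOn ℝ (⊤ : ℕ∞) (fderiv ℝ (fun x : ℝ × ℝ => f x.1 x.2)) (Ioo (-ε) ε ×ˢ I) :=
  hf.fderiv_of_isOpen (isOpen_Ioo.prod hI) (by simp)

theorem SmoothFamily.mul (hf : SmoothFamily ε I f) (hg : SmoothFamily ε I g) :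
    SmoothFamily ε I (fun t s => f t s * g t s) := ContDiffOn.mul hf hg

theorem SmoothFamily.add_const (hf : SmoothFamily ε I f) (c : ℝ) :
    SmoothFamily ε I (fun t s => f t s + c) := ContDiffOn.add hf contDiffOn_const

/-- The derivative in `t` at `t = 0` commutes with the derivative in `s`. -/
theorem SmoothFamily.hasDerivAt_dotAt_right (hI : IsOpen I) (hε : 0 < ε) (hf : SmoothFamily ε I f)
    (hfg : ∀ t ∈ Ioo (-ε) ε, ∀ s ∈ I, HasDerivAt (fun s => f t s) (g t s) s) (hs : s ∈ I) :
    HasDerivAt (dotAt f) (dotAt g s) s := by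
  have h0 := zero_mem_Ioo_neg hε
  set F : ℝ × ℝ → ℝ := fun x => f x.1 x.2 with hF
  have hD : ∀ t ∈ Ioo (-ε) ε, HasFDerivAt (fderiv ℝ F) (fderiv ℝ (fderiv ℝ F) (t, s)) (t, s) :=
    fun t ht => (((hf.fderivFamily hI).contDiffAt ((isOpen_Ioo.prod hI).mem_nhds
      ⟨ht, hs⟩)).differentiableAt (by simp)).hasFDerivAt
  have hsym : IsSymmSndFDerivAt ℝ F (0, s) :=
    (hf.contDiffAt hI h0 hs).isSymmSndFDerivAt
      (by rw [minSmoothness_of_isRCLikeNormedField]; exact WithTop.coe_le_coe.2 le_top)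
  have e1 : HasDerivAt (fun s => fderiv ℝ F (0, s) (1, 0))
      (fderiv ℝ (fderiv ℝ F) (0, s) (0, 1) (1, 0)) s := by
    have := (hD 0 h0).comp_hasDerivAt s ((hasDerivAt_const s (0 : ℝ)).prodMk (hasDerivAt_id' s))
    exact this.clm_apply (hasDerivAt_const s ((1 : ℝ), (0 : ℝ))) |>.congr_deriv (by simp)
  have e2 : HasDerivAt (fun t => fderiv ℝ F (t, s) (0, 1))
      (fderiv ℝ (fderiv ℝ F) (0, s) (1, 0) (0, 1)) 0 := by
    have := (hD 0 h0).comp_hasDerivAt (0 : ℝ)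
      ((hasDerivAt_id' (0 : ℝ)).prodMk (hasDerivAt_const (0 : ℝ) s))
    exact this.clm_apply (hasDerivAt_const (0 : ℝ) ((0 : ℝ), (1 : ℝ))) |>.congr_deriv (by simp)
  have e3 : dotAt g s = fderiv ℝ (fderiv ℝ F) (0, s) (1, 0) (0, 1) := by
    refine (HasDerivAt.congr_of_eventuallyEq e2 ?_).deriv
    filter_upwards [isOpen_Ioo.mem_nhds h0] with t ht
    exact (hfg t ht s hs).unique (hf.hasDerivAt_right hI ht hs)
  rw [e3, hsym.eq]
  refine e1.congr_of_eventuallyEq ?_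
  filter_upwards [hI.mem_nhds hs] with u hu using (hf.hasDerivAt_left hI h0 hu).deriv

theorem SmoothFamily.continuousOn_dotAt (hI : IsOpen I) (hε : 0 < ε) (hf : SmoothFamily ε I f) :
    ContinuousOn (dotAt f) I := by
  have h0 := zero_mem_Ioo_neg hε
  have h1 : ContinuousOn (fun s => fderiv ℝ (fun x : ℝ × ℝ => f x.1 x.2) (0, s) (1, 0)) I :=
    ((hf.fderivFamily hI).continuousOn.comp (by fun_prop)
      (show MapsTo (fun s : ℝ => ((0 : ℝ), s)) I (Ioo (-ε) ε ×ˢ I) from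
        fun s hs => ⟨h0, hs⟩)).clm_apply continuousOn_const
  exact h1.congr fun s hs => (hf.hasDerivAt_left hI h0 hs).deriv

theorem SmoothFamily.hasDerivAt_integral (hI : IsOpen I) (hc : I.OrdConnected) (hε : 0 < ε)
    (hf : SmoothFamily ε I f) {a b : ℝ} (ha : a ∈ I) (hb : b ∈ I) :
    HasDerivAt (fun t => ∫ s in a..b, f t s) (∫ s in a..b, dotAt f s) 0 := by
  have h0 := zero_mem_Ioo_neg hε
  have hsub : uIcc a b ⊆ I := hc.uIcc_subset ha hb
  set F : ℝ × ℝ → ℝ := fun x => f x.1 x.2 with hF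
  -- Halving ε gives a compact rectangle on which the t-derivative is bounded, as differentiation
  -- under the integral sign requires.
  have hsub2 : Icc (-(ε / 2)) (ε / 2) ⊆ Ioo (-ε) ε := fun t ht =>
    ⟨by linarith [ht.1], by linarith [ht.2]⟩
  have hcont : ContinuousOn (fun x => fderiv ℝ F x (1, 0)) (Ioo (-ε) ε ×ˢ I) :=
    (hf.fderivFamily hI).continuousOn.clm_apply continuousOn_const
  obtain ⟨C, hC⟩ := (isCompact_Icc (a := -(ε / 2)) (b := ε / 2)).prod (isCompact_uIcc (a := a)
    (b := b)) |>.exists_bound_of_continuousOn (hcont.mono (prod_mono hsub2 hsub))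
  have hfc : ∀ t ∈ Ioo (-ε) ε, ContinuousOn (f t) (uIcc a b) := fun t ht s hs =>
    (hf.hasDerivAt_right hI ht (hsub hs)).continuousAt.continuousWithinAt
  have hmeas : ∀ {φ : ℝ → ℝ}, ContinuousOn φ (uIcc a b) →
      MeasureTheory.AEStronglyMeasurable φ (MeasureTheory.volume.restrict (uIoc a b)) :=
    fun hφ => (hφ.mono uIoc_subset_uIcc).aestronglyMeasurable measurableSet_uIoc
  have hs' : Ioo (-(ε / 2)) (ε / 2) ∈ nhds (0 : ℝ) :=
    isOpen_Ioo.mem_nhds ⟨by linarith, by linarith⟩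
  have hdot : ∀ s ∈ I, dotAt f s = fderiv ℝ F (0, s) (1, 0) := fun s hs =>
    (hf.hasDerivAt_left hI h0 hs).deriv
  have := (intervalIntegral.hasDerivAt_integral_of_dominated_loc_of_deriv_le (𝕜 := ℝ)
    (F := f) (F' := fun t s => fderiv ℝ F (t, s) (1, 0)) (bound := fun _ => C) (a := a) (b := b)
    (μ := MeasureTheory.volume) hs'
    (by
      filter_upwards [isOpen_Ioo.mem_nhds h0] with t ht using hmeas (hfc t ht))
    ((hfc 0 h0).intervalIntegrable)
    (hmeas (((hf.continuousOn_dotAt hI hε).mono hsub).congr fun s hs => (hdot s (hsub hs)).symm))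
    (Filter.Eventually.of_forall fun s hs t ht =>
      hC (t, s) ⟨Ioo_subset_Icc_self ht, uIoc_subset_uIcc hs⟩)
    intervalIntegrable_const
    (Filter.Eventually.of_forall fun s hs t ht => hf.hasDerivAt_left hI
      (hsub2 (Ioo_subset_Icc_self ht)) (hsub (uIoc_subset_uIcc hs)))).2
  rwa [intervalIntegral.integral_congr fun s hs => (hdot s (hsub hs)).symm] at this

end twoVariables

/-! ### The first variation -/

section firstVariation
variable {I : Set ℝ} {ε : ℝ}

/-- A smooth family of solutions of `V' = V ω (0, 1; q, 0)`. -/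
structure IsFrameFamily (ε : ℝ) (I : Set ℝ) (V : ℝ → ℝ → SL2R) (q ω : ℝ → ℝ → ℝ) : Prop where
  smooth : ∀ i j, SmoothFamily ε I (fun t s => (V t s).1 i j)
  smooth_q : SmoothFamily ε I q
  smooth_ω : SmoothFamily ε I ω
  hasDerivAt_zero : ∀ t ∈ Ioo (-ε) ε, ∀ s ∈ I, ∀ i,
    HasDerivAt (fun s => (V t s).1 i 0) (ω t s * q t s * (V t s).1 i 1) s
  hasDerivAt_one : ∀ t ∈ Ioo (-ε) ε, ∀ s ∈ I, ∀ i,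
    HasDerivAt (fun s => (V t s).1 i 1) (ω t s * (V t s).1 i 0) s

theorem IsVariation.isFrameFamily {Γp Γm : ℝ → SL2R} {a b : ℝ} {Vp Vm : ℝ → ℝ → SL2R}
    {k ω : ℝ → ℝ → ℝ} (h : IsVariation I Γp Γm a b ε Vp Vm k ω) :
    IsFrameFamily ε I Vp (fun t s => k t s + 1) ω ∧
      IsFrameFamily ε I Vm (fun t s => k t s + -1) ω := by
  refine ⟨⟨h.smooth_p, SmoothFamily.add_const h.smooth_k 1, h.smooth_ω, ?_, ?_⟩,
    ⟨h.smooth_m, SmoothFamily.add_const h.smooth_k (-1), h.smooth_ω, ?_, ?_⟩⟩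
  · intro t ht s hs i
    refine ((h.frame t ht).deriv_p s hs i 0).congr_deriv ?_
    simp [Matrix.mul_apply, Fin.sum_univ_two]; ring
  · intro t ht s hs i
    refine ((h.frame t ht).deriv_p s hs i 1).congr_deriv ?_
    simp [Matrix.mul_apply, Fin.sum_univ_two]; ring
  · intro t ht s hs i
    refine ((h.frame t ht).deriv_m s hs i 0).congr_deriv ?_
    simp [Matrix.mul_apply, Fin.sum_univ_two]; ring
  · intro t ht s hs i
    refine ((h.frame t ht).deriv_m s hs i 1).congr_deriv ?_
    simp [Matrix.mul_apply, Fin.sum_univ_two]; ring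

/-- The entry `(0, 0)` of `V⁻¹ ∂V/∂t` at `t = 0`. -/
noncomputable def infA (V : ℝ → ℝ → SL2R) (s : ℝ) : ℝ :=
  (V 0 s).1 1 1 * dotAt (fun t s => (V t s).1 0 0) s
    - (V 0 s).1 0 1 * dotAt (fun t s => (V t s).1 1 0) s

/-- The entry `(0, 1)` of `V⁻¹ ∂V/∂t` at `t = 0`. -/
noncomputable def infB (V : ℝ → ℝ → SL2R) (s : ℝ) : ℝ :=
  (V 0 s).1 1 1 * dotAt (fun t s => (V t s).1 0 1) s
    - (V 0 s).1 0 1 * dotAt (fun t s => (V t s).1 1 1) s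

/-- The entry `(1, 0)` of `V⁻¹ ∂V/∂t` at `t = 0`. -/
noncomputable def infC (V : ℝ → ℝ → SL2R) (s : ℝ) : ℝ :=
  (V 0 s).1 0 0 * dotAt (fun t s => (V t s).1 1 0) s
    - (V 0 s).1 1 0 * dotAt (fun t s => (V t s).1 0 0) s

theorem inf_det (hI : IsOpen I) (hε : 0 < ε) {V : ℝ → ℝ → SL2R} {q ω : ℝ → ℝ → ℝ}
    (h : IsFrameFamily ε I V q ω) {s : ℝ} (hs : s ∈ I) :
    dotAt (fun t s => (V t s).1 0 0) s * (V 0 s).1 1 1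
      + (V 0 s).1 0 0 * dotAt (fun t s => (V t s).1 1 1) s
      - (dotAt (fun t s => (V t s).1 0 1) s * (V 0 s).1 1 0
      + (V 0 s).1 0 1 * dotAt (fun t s => (V t s).1 1 0) s) = 0 := by
  have d : ∀ i j, HasDerivAt (fun t => (V t s).1 i j) (dotAt (fun t s => (V t s).1 i j) s) 0 :=
    fun i j => (h.smooth i j).hasDerivAt_dotAt hI hε hs
  have h1 := ((d 0 0).fun_mul (d 1 1)).fun_sub ((d 0 1).fun_mul (d 1 0))
  have h2 : (fun t => (V t s).1 0 0 * (V t s).1 1 1 - (V t s).1 0 1 * (V t s).1 1 0) =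
      fun _ => 1 := by
    funext t
    rw [← Matrix.det_fin_two, (V t s).2]
  rw [h2] at h1
  exact h1.unique (hasDerivAt_const _ _)

/-- For Y = V⁻¹ ∂V/∂t at t = 0 and Ω = ω (0, 1; q, 0), equality of mixed derivatives gives Y' = [Y,
Ω] + ∂Ω/∂t. Since det V = 1, Y is trace-free and three entries describe it. -/
theorem hasDerivAt_inf (hI : IsOpen I) (hε : 0 < ε) {V : ℝ → ℝ → SL2R} {q ω : ℝ → ℝ → ℝ}
    (h : IsFrameFamily ε I V q ω) (hω : ∀ s ∈ I, ω 0 s = 1) {s : ℝ} (hs : s ∈ I) :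
    HasDerivAt (infA V) (infB V s * q 0 s - infC V s) s ∧
    HasDerivAt (infB V) (2 * infA V s + dotAt ω s) s ∧
    HasDerivAt (infC V) (-2 * infA V s * q 0 s + dotAt ω s * q 0 s + dotAt q s) s := by
  have h0 := zero_mem_Ioo_neg hε
  have dv0 : ∀ i, HasDerivAt (fun s => (V 0 s).1 i 0) (q 0 s * (V 0 s).1 i 1) s := fun i =>
    (h.hasDerivAt_zero 0 h0 s hs i).congr_deriv (by rw [hω s hs, one_mul])
  have dv1 : ∀ i, HasDerivAt (fun s => (V 0 s).1 i 1) ((V 0 s).1 i 0) s := fun i =>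
    (h.hasDerivAt_one 0 h0 s hs i).congr_deriv (by rw [hω s hs, one_mul])
  have tω := h.smooth_ω.hasDerivAt_dotAt hI hε hs
  have tq := h.smooth_q.hasDerivAt_dotAt hI hε hs
  have tV : ∀ i j, HasDerivAt (fun t => (V t s).1 i j) (dotAt (fun t s => (V t s).1 i j) s) 0 :=
    fun i j => (h.smooth i j).hasDerivAt_dotAt hI hε hs
  have dX : ∀ i, HasDerivAt (dotAt (fun t s => (V t s).1 i 0))
      (dotAt ω s * q 0 s * (V 0 s).1 i 1 + dotAt q s * (V 0 s).1 i 1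
        + q 0 s * dotAt (fun t s => (V t s).1 i 1) s) s := by
    intro i
    refine ((h.smooth i 0).hasDerivAt_dotAt_right hI hε
      (fun t ht s hs => h.hasDerivAt_zero t ht s hs i) hs).congr_deriv ?_
    refine (((tω.fun_mul tq).fun_mul (tV i 1)).deriv).trans ?_
    rw [hω s hs]
    ring
  have dY : ∀ i, HasDerivAt (dotAt (fun t s => (V t s).1 i 1))
      (dotAt ω s * (V 0 s).1 i 0 + dotAt (fun t s => (V t s).1 i 0) s) s := by
    intro i
    refine ((h.smooth i 1).hasDerivAt_dotAt_right hI hε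
      (fun t ht s hs => h.hasDerivAt_one t ht s hs i) hs).congr_deriv ?_
    refine ((tω.fun_mul (tV i 0)).deriv).trans ?_
    rw [hω s hs]
    ring
  have hdet := (V 0 s).2
  rw [Matrix.det_fin_two] at hdet
  have htr := inf_det hI hε h hs
  refine ⟨?_, ?_, ?_⟩
  · refine (((dv1 1).fun_mul (dX 0)).fun_sub ((dv1 0).fun_mul (dX 1))).congr_deriv ?_
    unfold infB infC
    ring
  · refine (((dv1 1).fun_mul (dY 0)).fun_sub ((dv1 0).fun_mul (dY 1))).congr_deriv ?_
    unfold infA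
    linear_combination dotAt ω s * hdet - htr
  · refine (((dv0 0).fun_mul (dX 1)).fun_sub ((dv0 1).fun_mul (dX 0))).congr_deriv ?_
    unfold infA
    linear_combination (dotAt ω s * q 0 s + dotAt q s) * hdet + q 0 s * htr

/-- The Euler–Lagrange expression of the functional `∫ (m + k) ω`. -/
noncomputable def eulerLagrange (m : ℝ) (k : ℝ → ℝ) (s : ℝ) : ℝ :=
  -(m / 4) * deriv k s + 3 / 4 * (k s * deriv k s) - 1 / 8 * deriv (deriv (deriv k)) s

theorem ContDiffOn.deriv_smooth (hI : IsOpen I) {f : ℝ → ℝ} (hf : ContDiffOn ℝ (⊤ : ℕ∞) f I) :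
    ContDiffOn ℝ (⊤ : ℕ∞) (deriv f) I :=
  hf.deriv_of_isOpen hI (by simp)

theorem ContDiffOn.hasDerivAt_smooth (hI : IsOpen I) {f : ℝ → ℝ}
    (hf : ContDiffOn ℝ (⊤ : ℕ∞) f I) {s : ℝ} (hs : s ∈ I) : HasDerivAt f (deriv f s) s :=
  ((hf.contDiffAt (hI.mem_nhds hs)).differentiableAt (by simp)).hasDerivAt

theorem contDiffOn_eulerLagrange (hI : IsOpen I) (m : ℝ) {k : ℝ → ℝ}
    (hk : ContDiffOn ℝ (⊤ : ℕ∞) k I) : ContDiffOn ℝ (⊤ : ℕ∞) (eulerLagrange m k) I := by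
  have h1 := hk.deriv_smooth hI
  have h3 := (h1.deriv_smooth hI).deriv_smooth hI
  exact ((contDiffOn_const.mul h1).add (contDiffOn_const.mul (hk.mul h1))).sub
    (contDiffOn_const.mul h3)

/-- The boundary term of the first variation. -/
noncomputable def boundaryTerm (m : ℝ) (k : ℝ → ℝ) (Vp Vm : ℝ → ℝ → SL2R) (s : ℝ) : ℝ :=
  1 / 2 * ((m + k s) * (infB Vp s + infB Vm s))
    + 1 / 2 * ((m - k s) * k s * (infB Vp s - infB Vm s))
    - 1 / 4 * ((m - k s) * (k s * (infB Vp s - infB Vm s) + (infB Vp s + infB Vm s)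
      - (infC Vp s - infC Vm s)))
    - 1 / 4 * (deriv k s * (infA Vp s - infA Vm s))
    + 1 / 8 * (deriv (deriv k) s * (infB Vp s - infB Vm s))
    + (infB Vp s - infB Vm s)
    - 1 / 2 * (k s * (infB Vp s + infB Vm s) + (infB Vp s - infB Vm s) - (infC Vp s + infC Vm s))

variable {Γp Γm γ : ℝ → SL2R} {a b m : ℝ} {Vp Vm : ℝ → ℝ → SL2R} {κ ω : ℝ → ℝ → ℝ} {k : ℝ → ℝ}

theorem IsVariation.at_zero (hI : IsOpen I) (hε : 0 < ε)
    (hγ : IsSpinorFrame I γ Γp Γm k (fun _ => 1))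
    (h : IsVariation I Γp Γm a b ε Vp Vm κ ω) {s : ℝ} (hs : s ∈ I) :
    ω 0 s = 1 ∧ κ 0 s = k s := by
  have h0 := zero_mem_Ioo_neg hε
  obtain ⟨hP, -⟩ := h.isFrameFamily
  obtain ⟨gP, -⟩ := hγ.isFrameSolution
  have ev : ∀ i j, (fun s => (Vp 0 s).1 i j) =ᶠ[nhds s] fun s => (Γp s).1 i j := by
    intro i j
    filter_upwards [hI.mem_nhds hs] with t ht
    rw [(h.initial t ht).1]
  have e1 : ∀ i, ω 0 s * (Γp s).1 i 0 = (Γp s).1 i 0 := by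
    intro i
    have := (hP.hasDerivAt_one 0 h0 s hs i).unique
      ((gP.hasDerivAt_one s hs i).congr_of_eventuallyEq (ev i 1))
    rwa [(h.initial s hs).1] at this
  have e0 : ∀ i, ω 0 s * (κ 0 s + 1) * (Γp s).1 i 1 = (k s + 1) * (Γp s).1 i 1 := by
    intro i
    have := (hP.hasDerivAt_zero 0 h0 s hs i).unique
      ((gP.hasDerivAt_zero s hs i).congr_of_eventuallyEq (ev i 0))
    rwa [(h.initial s hs).1] at this
  have hdet := (Γp s).2
  rw [Matrix.det_fin_two] at hdet
  have hω : ω 0 s = 1 := by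
    linear_combination (Γp s).1 1 1 * e1 0 - (Γp s).1 0 1 * e1 1 - (ω 0 s - 1) * hdet
  refine ⟨hω, ?_⟩
  have e2 : ω 0 s * (κ 0 s + 1) = k s + 1 := by
    linear_combination (Γp s).1 0 0 * e0 1 - (Γp s).1 1 0 * e0 0
      - (ω 0 s * (κ 0 s + 1) - (k s + 1)) * hdet
  rw [hω] at e2
  linarith

theorem dotAt_add_const (c : ℝ) (f : ℝ → ℝ → ℝ) (s : ℝ) :
    dotAt (fun t s => f t s + c) s = dotAt f s := by
  unfold dotAt
  exact deriv_add_const c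

/-- Let S and d be the sum and the difference of the two `infB`, p and g the differences of `infA`
and `infC`, G the sum of `infC`; a dot denotes ∂/∂t at t = 0. The linear equations give ω̇ = (S' +
g' + k d') / 4 and (m + k) ω̇ + κ̇ = (m - k) ω̇ + (G' + k S' + d') / 2. Integration by parts with p'
= k d + S - g and d' = 2 p leaves d times the Euler–Lagrange expression as the only remainder. -/
theorem IsVariation.hasDerivAt_boundaryTerm (hI : IsOpen I) (hε : 0 < ε)
    (hγ : IsSpinorFrame I γ Γp Γm k (fun _ => 1))
    (h : IsVariation I Γp Γm a b ε Vp Vm κ ω) {s : ℝ} (hs : s ∈ I) :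
    HasDerivAt (boundaryTerm m k Vp Vm)
      (dotAt (fun t s => (m + κ t s) * ω t s) s
        - eulerLagrange m k s * (infB Vp s - infB Vm s)) s := by
  obtain ⟨hP, hM⟩ := h.isFrameFamily
  have hω : ∀ s ∈ I, ω 0 s = 1 := fun s hs => (h.at_zero hI hε hγ hs).1
  have hκ := (h.at_zero hI hε hγ hs).2
  obtain ⟨aP, bP, cP⟩ := hasDerivAt_inf hI hε hP hω hs
  obtain ⟨aM, bM, cM⟩ := hasDerivAt_inf hI hε hM hω hs
  rw [dotAt_add_const] at cP cM
  simp only [hκ] at aP aM cP cM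
  have k0 := hγ.smooth_k.hasDerivAt_smooth hI hs
  have k1 := (hγ.smooth_k.deriv_smooth hI).hasDerivAt_smooth hI hs
  have k2 := ((hγ.smooth_k.deriv_smooth hI).deriv_smooth hI).hasDerivAt_smooth hI hs
  have hL : dotAt (fun t s => (m + κ t s) * ω t s) s = (m + k s) * dotAt ω s + dotAt κ s := by
    have tω := hP.smooth_ω.hasDerivAt_dotAt hI hε hs
    have tκ := SmoothFamily.hasDerivAt_dotAt hI hε h.smooth_k hs
    refine (((tκ.const_add m).fun_mul tω).deriv).trans ?_
    rw [hκ, hω s hs]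
    ring
  rw [hL]
  have S := bP.fun_add bM
  have d := bP.fun_sub bM
  have p := aP.fun_sub aM
  have g := cP.fun_sub cM
  have G := cP.fun_add cM
  refine ((((((((k0.const_add m).fun_mul S).const_mul (1 / 2)).fun_add
    ((((k0.const_sub m).fun_mul k0).fun_mul d).const_mul (1 / 2))).fun_sub
    (((k0.const_sub m).fun_mul (((k0.fun_mul d).fun_add S).fun_sub g)).const_mul (1 / 4))).fun_sub
    ((k1.fun_mul p).const_mul (1 / 4))).fun_add ((k2.fun_mul d).const_mul (1 / 8))).fun_add
    d).fun_sub ((((k0.fun_mul S).fun_add d).fun_sub G).const_mul (1 / 2)) |>.congr_deriv ?_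
  unfold eulerLagrange
  ring

/-- For γ = V₊ V₋⁻¹ the matrix γ⁻¹ ∂γ/∂t is the conjugate by V₋ of V₊⁻¹ ∂V₊/∂t - V₋⁻¹ ∂V₋/∂t, and
off [a, b] it vanishes. -/
theorem IsVariation.inf_eq_of_notMem (hI : IsOpen I) (hε : 0 < ε)
    (h : IsVariation I Γp Γm a b ε Vp Vm κ ω) {s : ℝ} (hs : s ∈ I) (hab : s ∉ Icc a b) :
    infA Vp s = infA Vm s ∧ infB Vp s = infB Vm s ∧ infC Vp s = infC Vm s := by
  have h0 := zero_mem_Ioo_neg hε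
  obtain ⟨hP, hM⟩ := h.isFrameFamily
  have dP : ∀ i j, HasDerivAt (fun t => (Vp t s).1 i j) (dotAt (fun t s => (Vp t s).1 i j) s) 0 :=
    fun i j => (hP.smooth i j).hasDerivAt_dotAt hI hε hs
  have dM : ∀ i j, HasDerivAt (fun t => (Vm t s).1 i j) (dotAt (fun t s => (Vm t s).1 i j) s) 0 :=
    fun i j => (hM.smooth i j).hasDerivAt_dotAt hI hε hs
  have hc : ∀ i j, HasDerivAt (fun t => (Vp t s * (Vm t s)⁻¹).1 i j) 0 0 := by
    intro i j
    refine (hasDerivAt_const (0 : ℝ) ((Γp s * (Γm s)⁻¹).1 i j)).congr_of_eventuallyEq ?_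
    filter_upwards [isOpen_Ioo.mem_nhds h0] with t ht
    rw [h.support t ht s hs hab]
  have e0 : ∀ i, _ := fun i => HasDerivAt.unique (by
    have := hc i 0
    simp only [fun t => (coe_mul_inv_apply (Vp t s) (Vm t s) i).1] at this
    exact this) (((dP i 0).fun_mul (dM 1 1)).fun_sub ((dP i 1).fun_mul (dM 1 0)))
  have e1 : ∀ i, _ := fun i => HasDerivAt.unique (by
    have := hc i 1
    simp only [fun t => (coe_mul_inv_apply (Vp t s) (Vm t s) i).2] at this
    exact this) (((dP i 1).fun_mul (dM 0 0)).fun_sub ((dP i 0).fun_mul (dM 0 1)))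
  have tM := inf_det hI hε hM hs
  have detP := (Vp 0 s).2
  have detM := (Vm 0 s).2
  rw [Matrix.det_fin_two] at detP detM
  have e00 := e0 0
  have e01 := e1 0
  have e10 := e0 1
  have e11 := e1 1
  unfold infA infB infC
  generalize dotAt (fun t s => (Vp t s).1 0 0) s = x00 at *
  generalize dotAt (fun t s => (Vp t s).1 0 1) s = x01 at *
  generalize dotAt (fun t s => (Vp t s).1 1 0) s = x10 at *
  generalize dotAt (fun t s => (Vp t s).1 1 1) s = x11 at *
  generalize dotAt (fun t s => (Vm t s).1 0 0) s = y00 at *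
  generalize dotAt (fun t s => (Vm t s).1 0 1) s = y01 at *
  generalize dotAt (fun t s => (Vm t s).1 1 0) s = y10 at *
  generalize dotAt (fun t s => (Vm t s).1 1 1) s = y11 at *
  generalize (Vp 0 s).1 = P at *
  generalize (Vm 0 s).1 = M at *
  refine ⟨?_, ?_, ?_⟩
  · linear_combination -(P 1 1 * M 0 0) * e00 - P 1 1 * M 1 0 * e01 + P 0 1 * M 0 0 * e10
      + P 0 1 * M 1 0 * e11 - (P 1 1 * x00 - P 0 1 * x10) * detM
      - (y11 * M 0 0 - y01 * M 1 0) * detP - tM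
  · linear_combination -(P 1 1 * M 0 1) * e00 - P 1 1 * M 1 1 * e01 + P 0 1 * M 0 1 * e10
      + P 0 1 * M 1 1 * e11 - (P 1 1 * x01 - P 0 1 * x11) * detM
      - (y11 * M 0 1 - y01 * M 1 1) * detP
  · linear_combination P 1 0 * M 0 0 * e00 + P 1 0 * M 1 0 * e01 - P 0 0 * M 0 0 * e10
      - P 0 0 * M 1 0 * e11 - (P 0 0 * x10 - P 1 0 * x00) * detM
      - (y00 * M 1 0 - y10 * M 0 0) * detP

/-- The support condition concerns the curves only, so the frames might still move by a common
infinitesimal motion. But the lower left coefficients k + 1 and k - 1 differ: subtracting the two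
equations for `infA` gives B = 0, those for `infC` together with B' = 0 give A = 0, and A' = 0 then
gives C = 0. -/
theorem IsVariation.boundaryTerm_eq_zero_of_notMem (hI : IsOpen I) (hε : 0 < ε)
    (hγ : IsSpinorFrame I γ Γp Γm k (fun _ => 1))
    (h : IsVariation I Γp Γm a b ε Vp Vm κ ω) {s : ℝ} (hs : s ∈ I) (hab : s ∉ Icc a b) :
    boundaryTerm m k Vp Vm s = 0 := by
  obtain ⟨hP, hM⟩ := h.isFrameFamily
  have hω : ∀ s ∈ I, ω 0 s = 1 := fun s hs => (h.at_zero hI hε hγ hs).1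
  have hO : IsOpen (I \ Icc a b) := hI.sdiff isClosed_Icc
  have hev : ∀ {s : ℝ} {f : ℝ → ℝ} {f' : ℝ}, s ∈ I \ Icc a b → HasDerivAt f f' s →
      (∀ u ∈ I \ Icc a b, f u = 0) → f' = 0 := by
    intro s f f' hs hf h0
    refine hf.unique ((hasDerivAt_const s (0 : ℝ)).congr_of_eventuallyEq ?_)
    filter_upwards [hO.mem_nhds hs] with u hu using h0 u hu
  have heq := fun u (hu : u ∈ I \ Icc a b) => h.inf_eq_of_notMem hI hε hu.1 hu.2
  have hB : ∀ u ∈ I \ Icc a b, infB Vp u = 0 := by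
    intro u hu
    obtain ⟨aP, -, -⟩ := hasDerivAt_inf hI hε hP hω hu.1
    obtain ⟨aM, -, -⟩ := hasDerivAt_inf hI hε hM hω hu.1
    have := hev hu (aP.fun_sub aM) (fun v hv => sub_eq_zero.2 (heq v hv).1)
    obtain ⟨-, hb, hc⟩ := heq u hu
    simp only [hb, hc] at this ⊢
    linarith
  have hA : ∀ u ∈ I \ Icc a b, infA Vp u = 0 := by
    intro u hu
    obtain ⟨-, bP, cP⟩ := hasDerivAt_inf hI hε hP hω hu.1
    obtain ⟨-, -, cM⟩ := hasDerivAt_inf hI hε hM hω hu.1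
    rw [dotAt_add_const] at cP cM
    have h1 := hev hu bP hB
    have h2 := hev hu (cP.fun_sub cM) (fun v hv => sub_eq_zero.2 (heq v hv).2.2)
    have ha := (heq u hu).1
    simp only [ha] at h1 h2 ⊢
    linarith
  have hC : ∀ u ∈ I \ Icc a b, infC Vp u = 0 := by
    intro u hu
    obtain ⟨aP, -, -⟩ := hasDerivAt_inf hI hε hP hω hu.1
    have h1 := hev hu aP hA
    rw [hB u hu] at h1
    linarith
  have hm : s ∈ I \ Icc a b := ⟨hs, hab⟩
  obtain ⟨ha, hb, hc⟩ := heq s hm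
  unfold boundaryTerm
  rw [← ha, ← hb, ← hc, hA s hm, hB s hm, hC s hm]
  ring

/-- The end points belong to [a, b], but they are limits of points of the open set I outside it. -/
theorem IsVariation.boundaryTerm_eq_zero (hI : IsOpen I) (hε : 0 < ε)
    (hγ : IsSpinorFrame I γ Γp Γm k (fun _ => 1))
    (h : IsVariation I Γp Γm a b ε Vp Vm κ ω) {s : ℝ} (hs : s ∈ I) (hab : s = a ∨ s = b)
    (hlt : a < b) : boundaryTerm m k Vp Vm s = 0 := by
  have hcont := (h.hasDerivAt_boundaryTerm (m := m) hI hε hγ hs).continuousAt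
  by_contra hne
  have h1 := (hcont.eventually_ne hne).and (hI.mem_nhds hs)
  rcases hab with rfl | rfl
  · obtain ⟨u, ⟨hu1, hu2⟩, hu3⟩ := ((h1.filter_mono nhdsWithin_le_nhds).and
      (self_mem_nhdsWithin (s := Iio s))).exists
    exact hu1 (h.boundaryTerm_eq_zero_of_notMem hI hε hγ hu2 fun hm => not_lt.2 hm.1 hu3)
  · obtain ⟨u, ⟨hu1, hu2⟩, hu3⟩ := ((h1.filter_mono nhdsWithin_le_nhds).and
      (self_mem_nhdsWithin (s := Ioi s))).exists
    exact hu1 (h.boundaryTerm_eq_zero_of_notMem hI hε hγ hu2 fun hm => not_lt.2 hm.2 hu3)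

/-- The first variation formula. -/
theorem IsVariation.hasDerivAt_integral (hI : IsOpen I) (hc : I.OrdConnected) (hε : 0 < ε)
    (hγ : IsSpinorFrame I γ Γp Γm k (fun _ => 1)) (ha : a ∈ I) (hb : b ∈ I) (hlt : a < b)
    (h : IsVariation I Γp Γm a b ε Vp Vm κ ω) :
    HasDerivAt (fun t => ∫ s in a..b, (m + κ t s) * ω t s)
      (∫ s in a..b, eulerLagrange m k s * (infB Vp s - infB Vm s)) 0 := by
  obtain ⟨hP, hM⟩ := h.isFrameFamily
  have hω : ∀ s ∈ I, ω 0 s = 1 := fun s hs => (h.at_zero hI hε hγ hs).1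
  have hsub : uIcc a b ⊆ I := hc.uIcc_subset ha hb
  have hL : SmoothFamily ε I (fun t s => (m + κ t s) * ω t s) :=
    (contDiffOn_const.add h.smooth_k).mul h.smooth_ω
  have hLc : ContinuousOn (dotAt (fun t s => (m + κ t s) * ω t s)) (uIcc a b) :=
    (hL.continuousOn_dotAt hI hε).mono hsub
  have hEc : ContinuousOn (fun s => eulerLagrange m k s * (infB Vp s - infB Vm s)) (uIcc a b) := by
    refine ((contDiffOn_eulerLagrange hI m hγ.smooth_k).continuousOn.mono hsub).mul
      (ContinuousOn.sub ?_ ?_)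
    · exact fun s hs => (hasDerivAt_inf hI hε hP hω (hsub hs)).2.1.continuousAt.continuousWithinAt
    · exact fun s hs => (hasDerivAt_inf hI hε hM hω (hsub hs)).2.1.continuousAt.continuousWithinAt
  refine (hL.hasDerivAt_integral hI hc hε ha hb).congr_deriv ?_
  have hF := intervalIntegral.integral_eq_sub_of_hasDerivAt
    (fun s hs => h.hasDerivAt_boundaryTerm (m := m) hI hε hγ (hsub hs))
    (hLc.sub hEc).intervalIntegrable
  rw [h.boundaryTerm_eq_zero hI hε hγ ha (Or.inl rfl) hlt,
    h.boundaryTerm_eq_zero hI hε hγ hb (Or.inr rfl) hlt, sub_zero,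
    intervalIntegral.integral_sub hLc.intervalIntegrable hEc.intervalIntegrable] at hF
  linarith

end firstVariation

/-! ### The explicit curves are extremal trajectories -/

section explicitCurve

/-- For k = 2 h + m / 3 the expression is 3 h h' - h''' / 4, and h''' = 12 h h'. -/
theorem IsPotential.eulerLagrange_eq_zero {I : Set ℝ} {g₂ g₃ : ℝ} {h : ℝ → ℝ}
    (hp : IsPotential I g₂ g₃ h) (hI : IsOpen I) (hc : I.OrdConnected) (m : ℝ) {s : ℝ}
    (hs : s ∈ I) : eulerLagrange m (fun s => 2 * h s + m / 3) s = 0 := by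
  have d1 : ∀ u ∈ I, HasDerivAt (fun s => 2 * h s + m / 3) (2 * deriv h u) u := fun u hu =>
    ((hp.hasDerivAt hI hu).const_mul 2).add_const _
  have d2 : ∀ u ∈ I, HasDerivAt (deriv fun s => 2 * h s + m / 3)
      (2 * (6 * h u ^ 2 - g₂ / 2)) u := by
    intro u hu
    refine ((hp.hasDerivAt_deriv hI hc hu).const_mul 2).congr_of_eventuallyEq ?_
    filter_upwards [hI.mem_nhds hu] with v hv using (d1 v hv).deriv
  have d3 : HasDerivAt (deriv (deriv fun s => 2 * h s + m / 3)) (24 * (h s * deriv h s)) s := by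
    have e : HasDerivAt (fun u => 2 * (6 * h u ^ 2 - g₂ / 2)) (24 * (h s * deriv h s)) s :=
      (((((hp.hasDerivAt hI hs).fun_pow 2).const_mul 6).sub_const (g₂ / 2)).const_mul
        2).congr_deriv (by simp; ring)
    refine e.congr_of_eventuallyEq ?_
    filter_upwards [hI.mem_nhds hs] with v hv using (d2 v hv).deriv
  unfold eulerLagrange
  rw [(d1 s hs).deriv, d3.deriv]
  ring

theorem IsPotential.isExtremalTrajectory {I : Set ℝ} {g₂ g₃ m : ℝ} {h : ℝ → ℝ}
    (hp : IsPotential I g₂ g₃ h) (hI : IsOpen I) (hc : I.OrdConnected) {Gp Gm : ℝ → SL2R}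
    (hGp : IsFrameSolution I (fun s => 2 * h s + (m / 3 + 1)) Gp)
    (hGm : IsFrameSolution I (fun s => 2 * h s + (m / 3 - 1)) Gm) :
    IsExtremalTrajectory m I (fun s => Gp s * (Gm s)⁻¹) (fun s => 2 * h s + m / 3) := by
  have eP : (fun s => 2 * h s + (m / 3 + 1)) = fun s => 2 * h s + m / 3 + 1 := by
    funext s; ring
  have eM : (fun s => 2 * h s + (m / 3 - 1)) = fun s => 2 * h s + m / 3 - 1 := by
    funext s; ring
  rw [eP] at hGp
  rw [eM] at hGm
  have hk : ContDiffOn ℝ (⊤ : ℕ∞) (fun s => 2 * h s + m / 3) I :=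
    (contDiffOn_const.mul hp.smooth).add contDiffOn_const
  have hγ := isSpinorFrame_of_isFrameSolution hk hGp hGm
  refine ⟨isNullCurve_mul_inv (k := fun s => 2 * h s + m / 3) hI hGp hGm, ?_, Gp, Gm, hγ, ?_⟩
  · obtain ⟨s₁, h1, s₂, h2, h3⟩ := hp.nonconst
    refine ⟨s₁, h1, s₂, h2, fun h4 => h3 ?_⟩
    linarith
  · intro a b ε Vp Vm κ ω ha hb hlt hε hV
    refine (hV.hasDerivAt_integral (m := m) hI hc hε hγ ha hb hlt).congr_deriv ?_
    rw [intervalIntegral.integral_congr (g := fun _ => 0) fun s hs => by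
      simp only [hp.eulerLagrange_eq_zero hI hc m (hc.uIcc_subset ha hb hs), zero_mul]]
    simp

theorem IsExplicitCurve.isExtremalTrajectory {I : Set ℝ} {g₂ g₃ m s₀ : ℝ} {h : ℝ → ℝ}
    (hp : IsPotential I g₂ g₃ h) (hI : IsOpen I) (hc : I.OrdConnected) (hs₀ : s₀ ∈ I)
    (h1 : h s₀ ≠ m / 3 + 1) (h2 : h s₀ ≠ m / 3 - 1) {g : ℝ → Matrix (Fin 2) (Fin 2) ℂ}
    (hg : IsExplicitCurve m I g₂ g₃ h s₀ g) :
    ∃ γ : ℝ → SL2R, (∀ s ∈ I, g s = toComplexMatrix (γ s)) ∧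
      IsExtremalTrajectory m I γ (fun s => 2 * h s + m / 3) := by
  obtain ⟨Gp, hGp, -, eP⟩ := hp.exists_realFrame hI hc hs₀ h1
  obtain ⟨Gm, hGm, -, eM⟩ := hp.exists_realFrame hI hc hs₀ h2
  obtain ⟨Γp, Γm, hΓp, hΓm, he⟩ := hg
  refine ⟨fun s => Gp s * (Gm s)⁻¹, fun s hs => ?_, hp.isExtremalTrajectory hI hc hGp hGm⟩
  rw [he s hs, eP Γp hΓp s hs, eM Γm hΓm s hs, toComplexMatrix_mul, toComplexMatrix_inv]

end explicitCurve

/-! ### Construction of variations -/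

section families
variable {I : Set ℝ} {ε : ℝ} {f g : ℝ → ℝ → ℝ} {s t : ℝ}

/-- The derivative of a family in the second variable. -/
noncomputable def dsFam (f : ℝ → ℝ → ℝ) (t s : ℝ) : ℝ := deriv (f t) s

theorem SmoothFamily.hasDerivAt_dsFam (hI : IsOpen I) (hf : SmoothFamily ε I f)
    (ht : t ∈ Ioo (-ε) ε) (hs : s ∈ I) : HasDerivAt (f t) (dsFam f t s) s :=
  (hf.hasDerivAt_right hI ht hs).differentiableAt.hasDerivAt

theorem SmoothFamily.dsFam (hI : IsOpen I) (hf : SmoothFamily ε I f) :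
    SmoothFamily ε I (dsFam f) :=
  ContDiffOn.congr ((hf.fderivFamily hI).clm_apply contDiffOn_const)
    fun _ hx => (hf.hasDerivAt_right hI hx.1 hx.2).deriv

theorem SmoothFamily.add (hf : SmoothFamily ε I f) (hg : SmoothFamily ε I g) :
    SmoothFamily ε I (fun t s => f t s + g t s) := ContDiffOn.add hf hg

theorem SmoothFamily.sub (hf : SmoothFamily ε I f) (hg : SmoothFamily ε I g) :
    SmoothFamily ε I (fun t s => f t s - g t s) := ContDiffOn.sub hf hg

theorem SmoothFamily.const (c : ℝ) : SmoothFamily ε I (fun _ _ => c) := contDiffOn_const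

theorem SmoothFamily.div (hf : SmoothFamily ε I f) (hg : SmoothFamily ε I g)
    (h0 : ∀ t ∈ Ioo (-ε) ε, ∀ s ∈ I, g t s ≠ 0) :
    SmoothFamily ε I (fun t s => f t s / g t s) :=
  ContDiffOn.div hf hg fun x hx => h0 x.1 hx.1 x.2 hx.2

theorem SmoothFamily.sqrt (hf : SmoothFamily ε I f)
    (h0 : ∀ t ∈ Ioo (-ε) ε, ∀ s ∈ I, 0 < f t s) : SmoothFamily ε I (fun t s => √(f t s)) :=
  ContDiffOn.sqrt hf fun x hx => (h0 x.1 hx.1 x.2 hx.2).ne'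

theorem SmoothFamily.of_right {k : ℝ → ℝ} (hk : ContDiffOn ℝ (⊤ : ℕ∞) k I) :
    SmoothFamily ε I (fun _ s => k s) :=
  ContDiffOn.comp hk contDiff_snd.contDiffOn fun _ hx => hx.2

theorem SmoothFamily.mono {ε' : ℝ} (hf : SmoothFamily ε I f) (h : ε' ≤ ε) :
    SmoothFamily ε' I f :=
  ContDiffOn.mono hf (prod_mono (Ioo_subset_Ioo (by linarith) h) subset_rfl)

/-- The tube lemma around {0} × K gives one ε' for all points of K; outside K positivity is given.
-/
theorem SmoothFamily.exists_pos (hI : IsOpen I) (hε : 0 < ε) (hf : SmoothFamily ε I f) {K : Set ℝ}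
    (hK : IsCompact K) (hKI : K ⊆ I) (h0 : ∀ s ∈ I, 0 < f 0 s)
    (h1 : ∀ t ∈ Ioo (-ε) ε, ∀ s ∈ I, s ∉ K → 0 < f t s) :
    ∃ ε' > 0, ε' ≤ ε ∧ ∀ t ∈ Ioo (-ε') ε', ∀ s ∈ I, 0 < f t s := by
  have hO : IsOpen ((Ioo (-ε) ε ×ˢ I) ∩ (fun x : ℝ × ℝ => f x.1 x.2) ⁻¹' Ioi 0) :=
    (ContDiffOn.continuousOn hf).isOpen_inter_preimage (isOpen_Ioo.prod hI) isOpen_Ioi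
  obtain ⟨u, v, hu, -, hu0, hv0, huv⟩ := generalized_tube_lemma (isCompact_singleton (x := (0 : ℝ)))
    hK hO (fun x hx => by
      obtain ⟨x1, x2⟩ := x
      obtain ⟨hx1, hx2⟩ := hx
      have hx1 : x1 = 0 := hx1
      subst hx1
      exact ⟨⟨zero_mem_Ioo_neg hε, hKI hx2⟩, h0 _ (hKI hx2)⟩)
  obtain ⟨δ, hδ, hb⟩ := Metric.isOpen_iff.1 hu 0 (hu0 rfl)
  refine ⟨min δ ε, lt_min hδ hε, min_le_right _ _, fun t ht s hs => ?_⟩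
  have ht1 : t ∈ u := hb (by
    rw [Metric.mem_ball, Real.dist_eq, sub_zero, abs_lt]
    exact ⟨by linarith [ht.1, min_le_left δ ε], by linarith [ht.2, min_le_left δ ε]⟩)
  by_cases hsK : s ∈ K
  · exact (huv (mk_mem_prod ht1 (hv0 hsK))).2
  · exact h1 t ⟨by linarith [ht.1, min_le_right δ ε], by linarith [ht.2, min_le_right δ ε]⟩ s hs hsK

theorem dsFam_eq_zero_of_eventually {c : ℝ} (h : ∀ᶠ u in nhds s, f t u = c) : dsFam f t s = 0 := by
  unfold dsFam
  rw [Filter.EventuallyEq.deriv_eq (f := fun _ => c) h]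
  exact deriv_const s c

/-- A change of the spinor frame that moves the point `(0 : 1)` of the projective line to
`(τ : 1)`. -/
theorem exists_gauge (hI : IsOpen I) {κ : ℝ → ℝ} (hκ : ContDiffOn ℝ (⊤ : ℕ∞) κ I)
    {τ : ℝ → ℝ → ℝ} (hτ : SmoothFamily ε I τ)
    (hJ : ∀ t ∈ Ioo (-ε) ε, ∀ s ∈ I, 0 < 1 + dsFam τ t s - τ t s ^ 2 * κ s) :
    ∃ p r u v Q : ℝ → ℝ → ℝ,
      (SmoothFamily ε I p ∧ SmoothFamily ε I r ∧ SmoothFamily ε I u ∧ SmoothFamily ε I v ∧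
        SmoothFamily ε I Q) ∧
      (∀ t ∈ Ioo (-ε) ε, ∀ s ∈ I, p t s = τ t s * r t s ∧ u t s * r t s - v t s * p t s = 1 ∧
        HasDerivAt (p t) (u t s - r t s) s ∧ HasDerivAt (r t) (v t s - κ s * p t s) s ∧
        HasDerivAt (u t) (Q t s * p t s - v t s) s ∧
        HasDerivAt (v t) (Q t s * r t s - κ s * u t s) s) ∧
      (∀ t s, (∀ᶠ x in nhds s, τ t x = 0) →
        p t s = 0 ∧ r t s = 1 ∧ u t s = 1 ∧ v t s = 0 ∧ Q t s = κ s) := by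
  have hκ' : SmoothFamily ε I (fun _ s => κ s) := SmoothFamily.of_right hκ
  -- In a frame with columns G₀, G₁ the new second column is y = r (τ G₀ + G₁), and the new first
  -- column has to be y'. Since det(y', y) = r² J, the determinant is 1 for r = 1 / √J.
  set J : ℝ → ℝ → ℝ := fun t s => 1 + dsFam τ t s - τ t s ^ 2 * κ s with hJdef
  have sJ : SmoothFamily ε I J := by
    have := ((SmoothFamily.const (ε := ε) (I := I) 1).add (hτ.dsFam hI)).sub ((hτ.mul hτ).mul hκ')
    simpa only [hJdef, sq] using this
  set r : ℝ → ℝ → ℝ := fun t s => 1 / √(J t s) with hr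
  have sr : SmoothFamily ε I r := (SmoothFamily.const 1).div (sJ.sqrt hJ)
    fun t ht s hs => (Real.sqrt_pos.2 (hJ t ht s hs)).ne'
  set p : ℝ → ℝ → ℝ := fun t s => τ t s * r t s with hp
  have sp : SmoothFamily ε I p := hτ.mul sr
  set u : ℝ → ℝ → ℝ := fun t s => r t s + dsFam p t s with hu
  have su : SmoothFamily ε I u := sr.add (sp.dsFam hI)
  set v : ℝ → ℝ → ℝ := fun t s => κ s * p t s + dsFam r t s with hv
  have sv : SmoothFamily ε I v := (hκ'.mul sp).add (sr.dsFam hI)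
  set Q : ℝ → ℝ → ℝ := fun t s => u t s * (κ s * u t s + dsFam v t s)
    - v t s * (v t s + dsFam u t s) with hQ
  have sQ : SmoothFamily ε I Q := (su.mul ((hκ'.mul su).add (sv.dsFam hI))).sub
    (sv.mul (sv.add (su.dsFam hI)))
  have hdet : ∀ t ∈ Ioo (-ε) ε, ∀ s ∈ I, u t s * r t s - v t s * p t s = 1 := by
    intro t ht s hs
    have hr2 : r t s ^ 2 * J t s = 1 := by
      have h1 := hJ t ht s hs
      have h2 : √(J t s) ^ 2 = J t s := Real.sq_sqrt h1.le
      have h3 : J t s ≠ 0 := h1.ne'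
      simp only [hr]
      rw [div_pow, h2, one_pow, one_div, inv_mul_cancel₀ h3]
    have hdp : dsFam p t s = dsFam τ t s * r t s + τ t s * dsFam r t s :=
      ((hτ.hasDerivAt_dsFam hI ht hs).fun_mul (sr.hasDerivAt_dsFam hI ht hs)).deriv
    simp only [hu, hv, hdp]
    simp only [hp]
    simp only [hJdef] at hr2
    linear_combination hr2
  refine ⟨p, r, u, v, Q, ⟨sp, sr, su, sv, sQ⟩, fun t ht s hs => ?_, fun t s h0 => ?_⟩
  · have dp := sp.hasDerivAt_dsFam hI ht hs
    have dr := sr.hasDerivAt_dsFam hI ht hs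
    have du := su.hasDerivAt_dsFam hI ht hs
    have dv := sv.hasDerivAt_dsFam hI ht hs
    have h1 := hdet t ht s hs
    have e1 : dsFam p t s = u t s - r t s := by simp only [hu]; ring
    have e2 : dsFam r t s = v t s - κ s * p t s := by simp only [hv]; ring
    -- The determinant of (y', y) is constant, so y'' is a multiple of y; the factor is Q.
    have h2 : dsFam u t s * r t s + u t s * dsFam r t s
        - (dsFam v t s * p t s + v t s * dsFam p t s) = 0 := by
      have hd := (du.fun_mul dr).fun_sub (dv.fun_mul dp)
      refine hd.unique ((hasDerivAt_const s (1 : ℝ)).congr_of_eventuallyEq ?_)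
      filter_upwards [hI.mem_nhds hs] with x hx using hdet t ht x hx
    rw [e1, e2] at h2
    refine ⟨rfl, h1, e1 ▸ dp, e2 ▸ dr, du.congr_deriv ?_, dv.congr_deriv ?_⟩
    · simp only [hQ]
      generalize dsFam u t s = u' at *
      generalize dsFam v t s = v' at *
      generalize p t s = p at *
      generalize r t s = r at *
      generalize u t s = u at *
      generalize v t s = v at *
      linear_combination -(v + u') * h1 + u * h2
    · simp only [hQ]
      generalize dsFam u t s = u' at *
      generalize dsFam v t s = v' at *
      generalize p t s = p at *
      generalize r t s = r at *
      generalize u t s = u at *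
      generalize v t s = v at *
      linear_combination -(κ s * u + v') * h1 + v * h2
  · have ev := h0.eventually_nhds
    have er : ∀ᶠ x in nhds s, r t x = 1 := by
      filter_upwards [ev] with x hx
      simp only [hr, hJdef, hx.self_of_nhds, dsFam_eq_zero_of_eventually hx]
      simp
    have ep : ∀ᶠ x in nhds s, p t x = 0 := by
      filter_upwards [ev] with x hx
      simp only [hp, hx.self_of_nhds, zero_mul]
    have eu : ∀ᶠ x in nhds s, u t x = 1 := by
      filter_upwards [er, ep.eventually_nhds] with x h1 h2
      simp only [hu, h1, dsFam_eq_zero_of_eventually h2, add_zero]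
    have ev' : ∀ᶠ x in nhds s, v t x = 0 := by
      filter_upwards [er.eventually_nhds, ep] with x h1 h2
      simp only [hv, h2, dsFam_eq_zero_of_eventually h1, add_zero, mul_zero]
    refine ⟨ep.self_of_nhds, er.self_of_nhds, eu.self_of_nhds, ev'.self_of_nhds, ?_⟩
    simp only [hQ, eu.self_of_nhds, ev'.self_of_nhds, dsFam_eq_zero_of_eventually eu,
      dsFam_eq_zero_of_eventually ev']
    ring

end families

/-! ### Variations with prescribed infinitesimal motion -/

section variation
variable {I : Set ℝ} {ε : ℝ}

open Classical in
/-- A matrix of determinant one as an element of `SL(2, ℝ)`. -/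
noncomputable def toSL (M : Matrix (Fin 2) (Fin 2) ℝ) : SL2R := if h : M.det = 1 then ⟨M, h⟩ else 1

theorem coe_toSL {M : Matrix (Fin 2) (Fin 2) ℝ} (h : M.det = 1) : (toSL M).1 = M := by
  have : toSL M = ⟨M, h⟩ := dif_pos h
  rw [this]

theorem toSL_coe (A : SL2R) : toSL A.1 = A := Subtype.ext (coe_toSL A.2)

/-- A new arc element ρ² ds is compensated by scaling the second column by ρ and the first by 1 / ρ.
The multiple ρ' / ρ² of the old second column added to the first restores the shape (0, 1; q, 0). -/
theorem hasDerivAt_regauge {x y ρ β : ℝ → ℝ} {ρ' β' Q s : ℝ} (hx : HasDerivAt x (Q * y s) s)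
    (hy : HasDerivAt y (x s) s) (hρ : HasDerivAt ρ ρ' s) (hβ : HasDerivAt β β' s)
    (h : β s = ρ' / (ρ s * ρ s)) (h0 : ρ s ≠ 0) :
    HasDerivAt (fun s => x s / ρ s + y s * β s)
      (ρ s * ρ s * ((Q / ρ s + β') / (ρ s * (ρ s * ρ s))) * (ρ s * y s)) s ∧
    HasDerivAt (fun s => ρ s * y s) (ρ s * ρ s * (x s / ρ s + y s * β s)) s := by
  constructor
  · refine ((hx.fun_div hρ h0).fun_add (hy.fun_mul hβ)).congr_deriv ?_
    rw [h]
    field_simp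
    ring
  · refine (hρ.fun_mul hy).congr_deriv ?_
    rw [h]
    field_simp
    ring

theorem gauge_apply (M : Matrix (Fin 2) (Fin 2) ℝ) (u p v r ρ β : ℝ) (i : Fin 2) :
    (M * !![u, p; v, r] * !![1 / ρ, 0; β, ρ]) i 0 =
      (M i 0 * u + M i 1 * v) / ρ + (M i 0 * p + M i 1 * r) * β ∧
    (M * !![u, p; v, r] * !![1 / ρ, 0; β, ρ]) i 1 = ρ * (M i 0 * p + M i 1 * r) := by
  constructor <;> simp [Matrix.mul_apply, Fin.sum_univ_two] <;> ring

/-- A family of solutions of `V' = V ω (0, 1; q, 0)`, obtained from a solution `G` of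
`G' = G (0, 1; κ, 0)` by a change of frame. -/
theorem isFrameFamily_gauge (hI : IsOpen I) {κ : ℝ → ℝ} {G : ℝ → SL2R}
    (hG : IsFrameSolution I κ G) {p r u v Q ρ β : ℝ → ℝ → ℝ}
    (sp : SmoothFamily ε I p) (sr : SmoothFamily ε I r) (su : SmoothFamily ε I u)
    (sv : SmoothFamily ε I v) (sQ : SmoothFamily ε I Q) (sρ : SmoothFamily ε I ρ)
    (hgauge : ∀ t ∈ Ioo (-ε) ε, ∀ s ∈ I, u t s * r t s - v t s * p t s = 1 ∧
        HasDerivAt (p t) (u t s - r t s) s ∧ HasDerivAt (r t) (v t s - κ s * p t s) s ∧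
        HasDerivAt (u t) (Q t s * p t s - v t s) s ∧
        HasDerivAt (v t) (Q t s * r t s - κ s * u t s) s)
    (hρ : ∀ t ∈ Ioo (-ε) ε, ∀ s ∈ I, ρ t s ≠ 0)
    (hβ : β = fun t s => dsFam ρ t s / (ρ t s * ρ t s)) :
    IsFrameFamily ε I (fun t s => toSL ((G s).1 * !![u t s, p t s; v t s, r t s] *
        !![1 / ρ t s, 0; β t s, ρ t s]))
      (fun t s => (Q t s / ρ t s + dsFam β t s) / (ρ t s * (ρ t s * ρ t s)))
      (fun t s => ρ t s * ρ t s) ∧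
    ∀ t ∈ Ioo (-ε) ε, ∀ s ∈ I, (toSL ((G s).1 * !![u t s, p t s; v t s, r t s] *
        !![1 / ρ t s, 0; β t s, ρ t s])).1 = (G s).1 * !![u t s, p t s; v t s, r t s] *
        !![1 / ρ t s, 0; β t s, ρ t s] := by
  have sβ : SmoothFamily ε I β := by
    rw [hβ]
    exact (sρ.dsFam hI).div (sρ.mul sρ) fun t ht s hs => mul_ne_zero (hρ t ht s hs) (hρ t ht s hs)
  have sG : ∀ i j, SmoothFamily ε I (fun _ s => (G s).1 i j) := fun i j =>
    SmoothFamily.of_right (hG.smooth i j)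
  have hcoe : ∀ t ∈ Ioo (-ε) ε, ∀ s ∈ I, (toSL ((G s).1 * !![u t s, p t s; v t s, r t s] *
        !![1 / ρ t s, 0; β t s, ρ t s])).1 = (G s).1 * !![u t s, p t s; v t s, r t s] *
        !![1 / ρ t s, 0; β t s, ρ t s] := by
    intro t ht s hs
    refine coe_toSL ?_
    have h1 := (hgauge t ht s hs).1
    have h2 := hρ t ht s hs
    rw [Matrix.det_mul, Matrix.det_mul, (G s).2, Matrix.det_fin_two_of, Matrix.det_fin_two_of]
    field_simp
    linear_combination h1
  have hx : ∀ t ∈ Ioo (-ε) ε, ∀ s ∈ I, ∀ i,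
      HasDerivAt (fun s => (G s).1 i 0 * u t s + (G s).1 i 1 * v t s)
        (Q t s * ((G s).1 i 0 * p t s + (G s).1 i 1 * r t s)) s ∧
      HasDerivAt (fun s => (G s).1 i 0 * p t s + (G s).1 i 1 * r t s)
        ((G s).1 i 0 * u t s + (G s).1 i 1 * v t s) s := by
    intro t ht s hs i
    obtain ⟨-, dp, dr, du, dv⟩ := hgauge t ht s hs
    have g0 := hG.hasDerivAt_zero s hs i
    have g1 := hG.hasDerivAt_one s hs i
    constructor
    · refine ((g0.fun_mul du).fun_add (g1.fun_mul dv)).congr_deriv ?_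
      ring
    · refine ((g0.fun_mul dp).fun_add (g1.fun_mul dr)).congr_deriv ?_
      ring
  have hreg := fun t ht s hs i => hasDerivAt_regauge
    (x := fun s => (G s).1 i 0 * u t s + (G s).1 i 1 * v t s)
    (y := fun s => (G s).1 i 0 * p t s + (G s).1 i 1 * r t s) (hx t ht s hs i).1 (hx t ht s hs i).2
    (sρ.hasDerivAt_dsFam hI ht hs) (sβ.hasDerivAt_dsFam hI ht hs)
    (congrFun (congrFun hβ t) s) (hρ t ht s hs)
  have e0 : ∀ t ∈ Ioo (-ε) ε, ∀ s ∈ I, ∀ i, (toSL ((G s).1 * !![u t s, p t s; v t s, r t s] *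
        !![1 / ρ t s, 0; β t s, ρ t s])).1 i 0 =
      ((G s).1 i 0 * u t s + (G s).1 i 1 * v t s) / ρ t s
        + ((G s).1 i 0 * p t s + (G s).1 i 1 * r t s) * β t s := fun t ht s hs i => by
    rw [hcoe t ht s hs]; exact (gauge_apply _ _ _ _ _ _ _ i).1
  have e1 : ∀ t ∈ Ioo (-ε) ε, ∀ s ∈ I, ∀ i, (toSL ((G s).1 * !![u t s, p t s; v t s, r t s] *
        !![1 / ρ t s, 0; β t s, ρ t s])).1 i 1 =
      ρ t s * ((G s).1 i 0 * p t s + (G s).1 i 1 * r t s) := fun t ht s hs i => by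
    rw [hcoe t ht s hs]; exact (gauge_apply _ _ _ _ _ _ _ i).2
  refine ⟨⟨fun i j => ?_, ?_, sρ.mul sρ, fun t ht s hs i => ?_, fun t ht s hs i => ?_⟩, hcoe⟩
  · fin_cases j
    · refine ContDiffOn.congr ?_ (fun x hx => e0 x.1 hx.1 x.2 hx.2 i)
      exact ((((sG i 0).mul su).add ((sG i 1).mul sv)).div sρ hρ).add
        ((((sG i 0).mul sp).add ((sG i 1).mul sr)).mul sβ)
    · refine ContDiffOn.congr ?_ (fun x hx => e1 x.1 hx.1 x.2 hx.2 i)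
      exact sρ.mul (((sG i 0).mul sp).add ((sG i 1).mul sr))
  · exact ((sQ.div sρ hρ).add (sβ.dsFam hI)).div (sρ.mul (sρ.mul sρ)) fun t ht s hs =>
      mul_ne_zero (hρ t ht s hs) (mul_ne_zero (hρ t ht s hs) (hρ t ht s hs))
  · refine ((hreg t ht s hs i).1.congr_of_eventuallyEq ?_).congr_deriv ?_
    · filter_upwards [hI.mem_nhds hs] with x hx using e0 t ht x hx i
    · rw [e1 t ht s hs]
  · refine ((hreg t ht s hs i).2.congr_of_eventuallyEq ?_).congr_deriv ?_
    · filter_upwards [hI.mem_nhds hs] with x hx using e1 t ht x hx i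
    · rw [e0 t ht s hs]

theorem isVariation_of_isFrameFamily {Γp Γm : ℝ → SL2R} {a b : ℝ} {Vp Vm : ℝ → ℝ → SL2R}
    {κ ω : ℝ → ℝ → ℝ} (hκ : SmoothFamily ε I κ) (hP : IsFrameFamily ε I Vp (fun t s => κ t s + 1) ω)
    (hM : IsFrameFamily ε I Vm (fun t s => κ t s - 1) ω)
    (hω : ∀ t ∈ Ioo (-ε) ε, ∀ s ∈ I, ω t s ≠ 0)
    (h0 : ∀ s ∈ I, Vp 0 s = Γp s ∧ Vm 0 s = Γm s)
    (h1 : ∀ t ∈ Ioo (-ε) ε, ∀ s ∈ I, s ∉ Icc a b → Vp t s = Γp s ∧ Vm t s = Γm s) :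
    IsVariation I Γp Γm a b ε Vp Vm κ ω := by
  have hslice : ∀ {f : ℝ → ℝ → ℝ}, SmoothFamily ε I f → ∀ t ∈ Ioo (-ε) ε,
      ContDiffOn ℝ (⊤ : ℕ∞) (f t) I := fun {f} hf t ht =>
    ContDiffOn.comp (f := fun s => (t, s)) (g := fun x : ℝ × ℝ => f x.1 x.2) hf
      (contDiff_const.prodMk contDiff_id).contDiffOn fun s hs => ⟨ht, hs⟩
  refine ⟨hP.smooth, hM.smooth, hκ, hP.smooth_ω, fun t ht => ⟨fun i j => hslice (hP.smooth i j) t ht,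
    fun i j => hslice (hM.smooth i j) t ht, hslice hκ t ht, hslice hP.smooth_ω t ht, hω t ht,
    fun _ _ => rfl, fun s hs i j => ?_, fun s hs i j => ?_⟩, h0, fun t ht s hs hab => ?_⟩
  · fin_cases j
    · refine (hP.hasDerivAt_zero t ht s hs i).congr_deriv ?_
      simp [Matrix.mul_apply, Fin.sum_univ_two]; ring
    · refine (hP.hasDerivAt_one t ht s hs i).congr_deriv ?_
      simp [Matrix.mul_apply, Fin.sum_univ_two]; ring
  · fin_cases j
    · refine (hM.hasDerivAt_zero t ht s hs i).congr_deriv ?_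
      simp [Matrix.mul_apply, Fin.sum_univ_two]; ring
    · refine (hM.hasDerivAt_one t ht s hs i).congr_deriv ?_
      simp [Matrix.mul_apply, Fin.sum_univ_two]; ring
  · obtain ⟨e1, e2⟩ := h1 t ht s hs hab
    rw [e1, e2]

/-- Γ₊ is moved by the gauge transformation with τ = t χ, while Γ₋ stays. The lower left
coefficients Q and k - 1 then no longer differ by 2, and a common change of the arc element repairs
this. Everything is unchanged where τ vanishes nearby, which gives the support and the initial
condition. -/
theorem exists_variation (hI : IsOpen I) {γ Γp Γm : ℝ → SL2R} {k : ℝ → ℝ}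
    (hγ : IsSpinorFrame I γ Γp Γm k (fun _ => 1)) {χ : ℝ → ℝ} (hχ : ContDiff ℝ (⊤ : ℕ∞) χ)
    (hχc : HasCompactSupport χ) (hχI : tsupport χ ⊆ I) {a b : ℝ} (hab : tsupport χ ⊆ Icc a b) :
    ∃ ε > 0, ∃ (Vp Vm : ℝ → ℝ → SL2R) (κ ω : ℝ → ℝ → ℝ), IsVariation I Γp Γm a b ε Vp Vm κ ω ∧
      ∀ s ∈ I, infB Vp s - infB Vm s = χ s := by
  obtain ⟨gP, gM⟩ := hγ.isFrameSolution
  have hk := hγ.smooth_k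
  have hk1 : ContDiffOn ℝ (⊤ : ℕ∞) (fun s => k s + 1) I := hk.add contDiffOn_const
  set τ : ℝ → ℝ → ℝ := fun t s => t * χ s with hτdef
  have sτ : SmoothFamily 1 I τ :=
    ContDiffOn.mul contDiff_fst.contDiffOn ((hχ.comp contDiff_snd).contDiffOn)
  have hτ0 : ∀ s, ∀ᶠ x in nhds s, τ 0 x = 0 := fun s =>
    Filter.Eventually.of_forall fun x => zero_mul _
  have hτ1 : ∀ t s, s ∉ tsupport χ → ∀ᶠ x in nhds s, τ t x = 0 := by
    intro t s hs
    filter_upwards [(isClosed_tsupport χ).isOpen_compl.mem_nhds hs] with x hx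
    simp only [hτdef, image_eq_zero_of_notMem_tsupport hx, mul_zero]
  have hJ1 : ∀ t s, (∀ᶠ x in nhds s, τ t x = 0) →
      0 < 1 + dsFam τ t s - τ t s ^ 2 * (k s + 1) := by
    intro t s h
    rw [dsFam_eq_zero_of_eventually h, h.self_of_nhds]
    norm_num
  have sJ : SmoothFamily 1 I (fun t s => 1 + dsFam τ t s - τ t s ^ 2 * (k s + 1)) := by
    have := ((SmoothFamily.const (ε := 1) (I := I) 1).add (sτ.dsFam hI)).sub ((sτ.mul sτ).mul
      (SmoothFamily.of_right hk1))
    simpa only [sq] using this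
  obtain ⟨ε₁, hε₁, hε₁', hJ⟩ := sJ.exists_pos hI one_pos hχc.isCompact hχI
    (fun s _ => hJ1 0 s (hτ0 s)) (fun t _ s _ hs => hJ1 t s (hτ1 t s hs))
  obtain ⟨p, r, u, v, Q, ⟨sp, sr, su, sv, sQ⟩, hg, hloc⟩ :=
    exists_gauge hI hk1 (sτ.mono hε₁') hJ
  set D : ℝ → ℝ → ℝ := fun t s => (Q t s - (k s - 1)) / 2 with hD
  have hk2 : ContDiffOn ℝ (⊤ : ℕ∞) (fun s => k s - 1) I := hk.sub contDiffOn_const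
  have sD : SmoothFamily ε₁ I D := (sQ.sub (SmoothFamily.of_right hk2)).div
    (SmoothFamily.const 2) fun _ _ _ _ => two_ne_zero
  have hDloc : ∀ t s, (∀ᶠ x in nhds s, τ t x = 0) → D t s = 1 := by
    intro t s h
    simp only [hD, (hloc t s h).2.2.2.2]
    ring
  obtain ⟨ε, hε, hε', hDpos⟩ := sD.exists_pos hI hε₁ hχc.isCompact hχI
    (fun s _ => by rw [hDloc 0 s (hτ0 s)]; exact one_pos)
    (fun t _ s _ hs => by rw [hDloc t s (hτ1 t s hs)]; exact one_pos)
  -- The change of arc element divides the difference Q - (k - 1) = 2 D by ρ⁴, so ρ⁴ = D brings it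
  -- back to 2.
  set ρ : ℝ → ℝ → ℝ := fun t s => √√(D t s) with hρdef
  have sρ : SmoothFamily ε I ρ := ((sD.mono hε').sqrt hDpos).sqrt fun t ht s hs =>
    Real.sqrt_pos.2 (hDpos t ht s hs)
  have hρ : ∀ t ∈ Ioo (-ε) ε, ∀ s ∈ I, ρ t s ≠ 0 := fun t ht s hs =>
    (Real.sqrt_pos.2 (Real.sqrt_pos.2 (hDpos t ht s hs))).ne'
  have hρ4 : ∀ t ∈ Ioo (-ε) ε, ∀ s ∈ I, ρ t s ^ 4 = D t s := by
    intro t ht s hs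
    have h1 := hDpos t ht s hs
    simp only [hρdef]
    rw [show ∀ x : ℝ, x ^ 4 = (x ^ 2) ^ 2 from fun x => by ring, Real.sq_sqrt (Real.sqrt_nonneg _),
      Real.sq_sqrt h1.le]
  have hρloc : ∀ t s, (∀ᶠ x in nhds s, τ t x = 0) → ρ t s = 1 := by
    intro t s h
    simp only [hρdef, hDloc t s h, Real.sqrt_one]
  obtain ⟨β, hβ⟩ : ∃ β : ℝ → ℝ → ℝ, β = fun t s => dsFam ρ t s / (ρ t s * ρ t s) := ⟨_, rfl⟩
  have hβloc : ∀ t s, (∀ᶠ x in nhds s, τ t x = 0) → β t s = 0 := by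
    intro t s h
    have : ∀ᶠ x in nhds s, ρ t x = 1 := by
      filter_upwards [h.eventually_nhds] with x hx using hρloc t x hx
    rw [hβ]
    simp only [dsFam_eq_zero_of_eventually this, zero_div]
  have hsub : ∀ t ∈ Ioo (-ε) ε, t ∈ Ioo (-ε₁) ε₁ := fun t ht =>
    ⟨by linarith [ht.1], by linarith [ht.2]⟩
  obtain ⟨fP, cP⟩ := isFrameFamily_gauge (ε := ε) hI gP (sp.mono hε') (sr.mono hε') (su.mono hε')
    (sv.mono hε') (sQ.mono hε') sρ (fun t ht s hs => (hg t (hsub t ht) s hs).2) hρ hβ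
  obtain ⟨fM, cM⟩ := isFrameFamily_gauge (ε := ε) (p := fun _ _ => 0) (r := fun _ _ => 1)
    (u := fun _ _ => 1) (v := fun _ _ => 0) (Q := fun _ s => k s - 1) hI gM (SmoothFamily.const 0)
    (SmoothFamily.const 1) (SmoothFamily.const 1) (SmoothFamily.const 0) (SmoothFamily.of_right hk2)
    sρ (fun t _ s _ => ⟨by norm_num, (hasDerivAt_const s _).congr_deriv (by ring),
      (hasDerivAt_const s _).congr_deriv (by ring), (hasDerivAt_const s _).congr_deriv (by ring),
      (hasDerivAt_const s _).congr_deriv (by ring)⟩) hρ hβ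
  set q : ℝ → ℝ → ℝ :=
    fun t s => ((k s - 1) / ρ t s + dsFam β t s) / (ρ t s * (ρ t s * ρ t s)) with hq
  have hqP : ∀ t ∈ Ioo (-ε) ε, ∀ s ∈ I,
      (Q t s / ρ t s + dsFam β t s) / (ρ t s * (ρ t s * ρ t s)) = q t s + 1 + 1 := by
    intro t ht s hs
    have h4 := hρ4 t ht s hs
    have h0 := hρ t ht s hs
    simp only [hD] at h4
    simp only [hq]
    field_simp
    linear_combination -2 * h4
  set Vp : ℝ → ℝ → SL2R := fun t s => toSL ((Γp s).1 * !![u t s, p t s; v t s, r t s] *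
        !![1 / ρ t s, 0; β t s, ρ t s]) with hVp
  set Vm : ℝ → ℝ → SL2R := fun t s => toSL ((Γm s).1 * !![1, 0; 0, 1] *
        !![1 / ρ t s, 0; β t s, ρ t s]) with hVm
  have hVloc : ∀ t s, (∀ᶠ x in nhds s, τ t x = 0) → Vp t s = Γp s ∧ Vm t s = Γm s := by
    intro t s h
    obtain ⟨h1, h2, h3, h4, -⟩ := hloc t s h
    simp only [hVp, hVm, h1, h2, h3, h4, hρloc t s h, hβloc t s h]
    rw [div_one, ← Matrix.one_fin_two, Matrix.mul_one, Matrix.mul_one, Matrix.mul_one,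
      Matrix.mul_one, toSL_coe, toSL_coe]
    exact ⟨rfl, rfl⟩
  have sκ : SmoothFamily ε I (fun t s => q t s + 1) := fM.smooth_q.add_const 1
  have fP' : IsFrameFamily ε I Vp (fun t s => q t s + 1 + 1) (fun t s => ρ t s * ρ t s) :=
    ⟨fP.smooth, sκ.add_const 1, fP.smooth_ω, fun t ht s hs i => by
      rw [← hqP t ht s hs]; exact fP.hasDerivAt_zero t ht s hs i, fP.hasDerivAt_one⟩
  have fM' : IsFrameFamily ε I Vm (fun t s => q t s + 1 - 1) (fun t s => ρ t s * ρ t s) := by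
    simpa only [add_sub_cancel_right] using fM
  refine ⟨ε, hε, Vp, Vm, fun t s => q t s + 1, fun t s => ρ t s * ρ t s,
    isVariation_of_isFrameFamily sκ fP' fM' (fun t ht s hs => mul_ne_zero (hρ t ht s hs)
      (hρ t ht s hs)) (fun s _ => hVloc 0 s (hτ0 s)) (fun t _ s _ hs =>
      hVloc t s (hτ1 t s fun hm => hs (hab hm))), fun s hs => ?_⟩
  have h0 := zero_mem_Ioo_neg hε
  obtain ⟨l1, l2, -⟩ := hloc 0 s (hτ0 s)
  have tρ := sρ.hasDerivAt_dotAt hI hε hs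
  have tr := (sr.mono hε').hasDerivAt_dotAt hI hε hs
  have tp : HasDerivAt (fun t => p t s) (χ s) 0 := by
    refine ((((hasDerivAt_id' (0 : ℝ)).mul_const (χ s)).fun_mul tr).congr_of_eventuallyEq
      ?_).congr_deriv (by rw [l2]; ring)
    filter_upwards [isOpen_Ioo.mem_nhds h0] with t ht using (hg t (hsub t ht) s hs).1
  -- `infB` is the component of the velocity of the second column along the first column of the
  -- frame. The gauge contributes χ to it; the variations of ρ and r act along the second column
  -- only.
  have dP : ∀ i, dotAt (fun t s => (Vp t s).1 i 1) s = (Γp s).1 i 0 * χ s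
      + (Γp s).1 i 1 * (dotAt ρ s + dotAt r s) := by
    intro i
    have := tρ.fun_mul ((tp.const_mul ((Γp s).1 i 0)).fun_add (tr.const_mul ((Γp s).1 i 1)))
    rw [l1, l2, hρloc 0 s (hτ0 s)] at this
    refine (this.congr_of_eventuallyEq ?_).deriv.trans (by ring)
    filter_upwards [isOpen_Ioo.mem_nhds h0] with t ht
    have := cP t ht s hs
    simp only [hVp]
    rw [this]
    exact (gauge_apply _ _ _ _ _ _ _ i).2
  have dM : ∀ i, dotAt (fun t s => (Vm t s).1 i 1) s = (Γm s).1 i 1 * dotAt ρ s := by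
    intro i
    refine ((tρ.const_mul ((Γm s).1 i 1)).congr_of_eventuallyEq ?_).deriv
    filter_upwards [isOpen_Ioo.mem_nhds h0] with t ht
    have := cM t ht s hs
    simp only [hVm]
    rw [this]
    refine (gauge_apply _ _ _ _ _ _ _ i).2.trans ?_
    ring
  have hdet := (Γp s).2
  rw [Matrix.det_fin_two] at hdet
  obtain ⟨i1, i2⟩ := hVloc 0 s (hτ0 s)
  unfold infB
  rw [dP, dP, dM, dM, i1, i2]
  linear_combination χ s * hdet

end variation

/-! ### Every extremal trajectory comes from a potential -/

section extremal
variable {I : Set ℝ} {m : ℝ} {k : ℝ → ℝ} {γ : ℝ → SL2R}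

theorem exists_Icc_subset_of_isOpen (hI : IsOpen I) {s : ℝ} (hs : s ∈ I) :
    ∃ a b, s ∈ Ioo a b ∧ Icc a b ⊆ I := by
  obtain ⟨δ, hδ, hb⟩ := Metric.isOpen_iff.1 hI s hs
  refine ⟨s - δ / 2, s + δ / 2, ⟨by linarith, by linarith⟩, fun x hx => hb ?_⟩
  rw [Metric.mem_ball, Real.dist_eq, abs_lt]
  exact ⟨by linarith [hx.1], by linarith [hx.2]⟩

/-- The Euler–Lagrange equation of an extremal trajectory. -/
theorem IsExtremalTrajectory.eulerLagrange_eq_zero (hI : IsOpen I) (hc : I.OrdConnected)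
    (h : IsExtremalTrajectory m I γ k) {s : ℝ} (hs : s ∈ I) : eulerLagrange m k s = 0 := by
  obtain ⟨Γp, Γm, hγ, hcrit⟩ := h.critical
  obtain ⟨a, b, hsab, hab⟩ := exists_Icc_subset_of_isOpen hI hs
  have hlt : a < b := hsab.1.trans hsab.2
  have ha : a ∈ I := hab (left_mem_Icc.2 hlt.le)
  have hb : b ∈ I := hab (right_mem_Icc.2 hlt.le)
  have hE : ContinuousOn (eulerLagrange m k) (Ioo a b) :=
    (contDiffOn_eulerLagrange hI m hγ.smooth_k).continuousOn.mono (Ioo_subset_Icc_self.trans hab)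
  have hae : ∀ᵐ x ∂(MeasureTheory.volume : MeasureTheory.Measure ℝ), x ∈ Ioo a b →
      eulerLagrange m k x = 0 := by
    -- The fundamental lemma of the calculus of variations: every test function χ on (a, b) is the
    -- difference of the `infB` of some variation, so its integral against the expression vanishes.
    refine isOpen_Ioo.ae_eq_zero_of_integral_contDiff_smul_eq_zero
      (hE.locallyIntegrableOn measurableSet_Ioo) fun χ hχ hχc hχU => ?_
    have hχU' : tsupport χ ⊆ Icc a b := hχU.trans Ioo_subset_Icc_self
    obtain ⟨ε, hε, Vp, Vm, κ, ω, hV, hd⟩ := exists_variation hI hγ hχ hχc (hχU'.trans hab) hχU'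
    have h1 := (hcrit a b ε Vp Vm κ ω ha hb hlt hε hV).unique
      (hV.hasDerivAt_integral (m := m) hI hc hε hγ ha hb hlt)
    rw [← intervalIntegral.integral_eq_integral_of_support_subset (a := a) (b := b)]
    · rw [h1]
      refine intervalIntegral.integral_congr fun x hx => ?_
      simp only [smul_eq_mul]
      rw [hd x (hc.uIcc_subset ha hb hx), mul_comm]
    · refine (Function.support_smul_subset_left χ _).trans ?_
      exact (subset_tsupport χ).trans (hχU.trans Ioo_subset_Ioc_self)
  exact MeasureTheory.Measure.eqOn_open_of_ae_eq (g := fun _ => (0 : ℝ))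
    ((MeasureTheory.ae_restrict_iff' measurableSet_Ioo).2 hae) isOpen_Ioo hE continuousOn_const hsab

theorem eq_of_hasDerivAt_zero (hc : I.OrdConnected) {f : ℝ → ℝ}
    (hf : ∀ s ∈ I, HasDerivAt f 0 s) {s₀ s : ℝ} (hs₀ : s₀ ∈ I) (hs : s ∈ I) : f s = f s₀ :=
  sub_eq_zero.1 (eq_zero_of_norm_deriv_le (f := fun s => f s - f s₀) (f' := fun _ => 0)
    (K := fun _ => 0) hc (fun s hs => (hf s hs).sub_const _) continuousOn_const
    (fun s _ => by simp) hs₀ (sub_self _) s hs)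

/-- The reduced curvature of an extremal trajectory is a potential. -/
theorem IsExtremalTrajectory.exists_isPotential (hI : IsOpen I) (hc : I.OrdConnected)
    (h : IsExtremalTrajectory m I γ k) :
    ∃ g₂ g₃, IsPotential I g₂ g₃ (fun s => 1 / 2 * (k s - m / 3)) := by
  obtain ⟨Γp, Γm, hγ, -⟩ := h.critical
  have hk := hγ.smooth_k
  obtain ⟨s₁, hs₁, s₂, hs₂, hne⟩ := h.nonconst
  have k0 := fun s (hs : s ∈ I) => hk.hasDerivAt_smooth hI hs
  have k1 := fun s (hs : s ∈ I) => (hk.deriv_smooth hI).hasDerivAt_smooth hI hs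
  have k2 := fun s (hs : s ∈ I) => ((hk.deriv_smooth hI).deriv_smooth hI).hasDerivAt_smooth hI hs
  set u : ℝ → ℝ := fun s => 1 / 2 * (k s - m / 3) with hu
  have u0 : ∀ s ∈ I, HasDerivAt u (1 / 2 * deriv k s) s := fun s hs =>
    ((k0 s hs).sub_const _).const_mul _
  -- The Euler–Lagrange equation says u''' = 12 u u'. It is integrated twice, here and in `hC`; the
  -- two constants are g₂ and g₃ up to normalization.
  have hA : ∀ s ∈ I, HasDerivAt (fun s => 1 / 2 * deriv (deriv k) s - 6 * u s ^ 2) 0 s := by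
    intro s hs
    refine (((k2 s hs).const_mul (1 / 2)).fun_sub (((u0 s hs).fun_pow 2).const_mul
      6)).congr_deriv ?_
    have := h.eulerLagrange_eq_zero hI hc hs
    unfold eulerLagrange at this
    simp only [hu]
    norm_num
    linear_combination -4 * this
  obtain ⟨g₂, hg₂⟩ : ∃ g₂, g₂ = -2 * (1 / 2 * deriv (deriv k) s₁ - 6 * u s₁ ^ 2) := ⟨_, rfl⟩
  have hB : ∀ s ∈ I, 1 / 2 * deriv (deriv k) s - 6 * u s ^ 2 = -g₂ / 2 := by
    intro s hs
    rw [eq_of_hasDerivAt_zero hc hA hs₁ hs, hg₂]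
    ring
  have hC : ∀ s ∈ I, HasDerivAt (fun s => (1 / 2 * deriv k s) ^ 2 - (4 * u s ^ 3 - g₂ * u s)) 0 s := by
    intro s hs
    refine ((((k1 s hs).const_mul (1 / 2)).fun_pow 2).fun_sub ((((u0 s hs).fun_pow 3).const_mul
      4).fun_sub ((u0 s hs).const_mul g₂))).congr_deriv ?_
    have := hB s hs
    norm_num
    linear_combination deriv k s * this
  refine ⟨g₂, -((1 / 2 * deriv k s₁) ^ 2 - (4 * u s₁ ^ 3 - g₂ * u s₁)),
    contDiffOn_const.mul (hk.sub contDiffOn_const), fun s hs => ?_,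
    s₁, hs₁, s₂, hs₂, fun heq => hne ?_⟩
  · rw [(u0 s hs).deriv]
    unfold cubicP
    have := eq_of_hasDerivAt_zero hc hC hs₁ hs
    linear_combination this
  · simp only [hu] at heq
    linarith

/-- A non-constant continuous function on an interval takes infinitely many values, so it avoids two
given ones somewhere. -/
theorem IsPotential.exists_base (hc : I.OrdConnected) {g₂ g₃ : ℝ} {h : ℝ → ℝ}
    (hp : IsPotential I g₂ g₃ h) (x y : ℝ) : ∃ s ∈ I, h s ≠ x ∧ h s ≠ y := by
  obtain ⟨s₁, hs₁, s₂, hs₂, hne⟩ := hp.nonconst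
  have himg : (h '' I).OrdConnected :=
    (hc.isPreconnected.image h hp.smooth.continuousOn).ordConnected
  have hsub : uIcc (h s₁) (h s₂) ⊆ h '' I :=
    himg.uIcc_subset (mem_image_of_mem h hs₁) (mem_image_of_mem h hs₂)
  have hinf : (uIcc (h s₁) (h s₂)).Infinite := Icc_infinite (by simpa using hne.symm)
  obtain ⟨z, hz, hz'⟩ := hinf.exists_notMem_finite (Set.toFinite {x, y})
  obtain ⟨s, hs, rfl⟩ := hsub hz
  simp only [mem_insert_iff, mem_singleton_iff, not_or] at hz'
  exact ⟨s, hs, hz'⟩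

/-- The spinor frames and the explicit frames solve the same linear equations, and the latter equal
1 at s₀. By uniqueness they differ by the left factors Γ₊(s₀) and Γ₋(s₀), which become A and B in
the equivalence; no shift of the parameter is needed. -/
theorem IsExtremalTrajectory.exists_explicitCurve (hI : IsOpen I) (hc : I.OrdConnected)
    (h : IsExtremalTrajectory m I γ k) :
    ∃ (g₂ g₃ : ℝ) (u : ℝ → ℝ) (s₀ : ℝ) (δ : ℝ → SL2R), IsPotential I g₂ g₃ u ∧
      s₀ ∈ I ∧ u s₀ ≠ m / 3 + 1 ∧ u s₀ ≠ m / 3 - 1 ∧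
      IsExplicitCurve m I g₂ g₃ u s₀ (fun s => toComplexMatrix (δ s)) ∧
      EquivalentCurves I I δ γ := by
  obtain ⟨g₂, g₃, hp⟩ := h.exists_isPotential hI hc
  obtain ⟨Γp, Γm, hγ, -⟩ := h.critical
  obtain ⟨s₀, hs₀, h1, h2⟩ := hp.exists_base hc (m / 3 + 1) (m / 3 - 1)
  set u : ℝ → ℝ := fun s => 1 / 2 * (k s - m / 3) with hu
  obtain ⟨Gp, hGp, bP, eP⟩ := hp.exists_realFrame hI hc hs₀ h1
  obtain ⟨Gm, hGm, bM, eM⟩ := hp.exists_realFrame hI hc hs₀ h2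
  obtain ⟨Ep, hEp, -⟩ := hp.exists_explicitFrame hI hc hs₀ h1
  obtain ⟨Em, hEm, -⟩ := hp.exists_explicitFrame hI hc hs₀ h2
  obtain ⟨gP, gM⟩ := hγ.isFrameSolution
  have kP : (fun s => 2 * u s + (m / 3 + 1)) = fun s => k s + 1 := by
    funext s; simp only [hu]; ring
  have kM : (fun s => 2 * u s + (m / 3 - 1)) = fun s => k s - 1 := by
    funext s; simp only [hu]; ring
  rw [kP] at hGp
  rw [kM] at hGm
  have hk := hγ.smooth_k.continuousOn
  have iP := gP.eqOn hc (hk.add continuousOn_const) (hGp.const_mul (Γp s₀)) hs₀ (by simp [bP])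
  have iM := gM.eqOn hc (hk.sub continuousOn_const) (hGm.const_mul (Γm s₀)) hs₀ (by simp [bM])
  refine ⟨g₂, g₃, u, s₀, fun s => Gp s * (Gm s)⁻¹, hp, hs₀, h1, h2,
    ⟨Ep, Em, hEp, hEm, fun s hs => ?_⟩, 0, Γp s₀, Γm s₀, fun s hs => ⟨by simpa using hs, ?_⟩⟩
  · rw [eP Ep hEp s hs, eM Em hEm s hs, ← toComplexMatrix_inv, ← toComplexMatrix_mul]
  · rw [hγ.proj s hs, iP hs, iM hs]
    simp only [add_zero]
    group

end extremal

/-! ### Theorem A -/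

theorem theoremA :
    -- the sigma functions exist and are unique, for all real invariants
    (∀ g₂ g₃ : ℝ, ∃! σ : ℂ → ℂ, IsWeierstrassSigma g₂ g₃ σ) ∧
    -- the frames are well defined, and explicit in terms of the Weierstrass functions
    (∀ (I : Set ℝ) (g₂ g₃ : ℝ) (h : ℝ → ℝ) (c s₀ : ℝ), IsOpen I → I.OrdConnected →
      IsPotential I g₂ g₃ h → s₀ ∈ I → h s₀ ≠ c →
      (∃ Γ, IsExplicitFrame I g₂ g₃ h c s₀ Γ) ∧
      (∀ Γ Γ', IsExplicitFrame I g₂ g₃ h c s₀ Γ → IsExplicitFrame I g₂ g₃ h c s₀ Γ' →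
        Set.EqOn Γ Γ' I) ∧
      (∀ σ, IsWeierstrassSigma g₂ g₃ σ →
        (∃ α, IsShift I h σ α) ∧
        ∀ α Γ, IsShift I h σ α → IsExplicitFrame I g₂ g₃ h c s₀ Γ →
          HasWeierstrassForm I g₂ g₃ h c s₀ σ α Γ)) ∧
    -- the explicit curve is an extremal trajectory in `SL(2, ℝ)`
    (∀ (m : ℝ) (I : Set ℝ) (g₂ g₃ : ℝ) (h : ℝ → ℝ) (s₀ : ℝ) (g : ℝ → Matrix (Fin 2) (Fin 2) ℂ),
      IsOpen I → I.OrdConnected → IsPotential I g₂ g₃ h →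
      s₀ ∈ I → h s₀ ≠ m / 3 + 1 → h s₀ ≠ m / 3 - 1 → IsExplicitCurve m I g₂ g₃ h s₀ g →
      ∃ γ : ℝ → SL2R, (∀ s ∈ I, g s = toComplexMatrix (γ s)) ∧
        IsExtremalTrajectory m I γ (fun s => 2 * h s + m / 3)) ∧
    -- every extremal trajectory is equivalent to an explicit curve
    (∀ (m : ℝ) (I' : Set ℝ) (γ' : ℝ → SL2R) (k : ℝ → ℝ), IsOpen I' → I'.OrdConnected →
      IsExtremalTrajectory m I' γ' k →
      ∃ (I : Set ℝ) (g₂ g₃ : ℝ) (h : ℝ → ℝ) (s₀ : ℝ) (γ : ℝ → SL2R),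
        IsOpen I ∧ I.OrdConnected ∧ IsPotential I g₂ g₃ h ∧
        s₀ ∈ I ∧ h s₀ ≠ m / 3 + 1 ∧ h s₀ ≠ m / 3 - 1 ∧
        IsExplicitCurve m I g₂ g₃ h s₀ (fun s => toComplexMatrix (γ s)) ∧
        EquivalentCurves I I' γ γ') := by
  refine ⟨fun g₂ g₃ => ?_,
    fun I g₂ g₃ h c s₀ hI hc hp hs₀ h0 => ⟨?_, ?_, fun σ hσ => ⟨?_, ?_⟩⟩, ?_, ?_⟩
  · obtain ⟨σ, hσ⟩ := exists_isWeierstrassSigma g₂ g₃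
    exact ⟨σ, hσ, fun τ hτ => hτ.unique hσ⟩
  · obtain ⟨Γ, hΓ, -⟩ := hp.exists_explicitFrame hI hc hs₀ h0
    exact ⟨Γ, hΓ⟩
  · exact fun Γ Γ' hΓ hΓ' => hΓ.eqOn hp hI hc hs₀ h0 hΓ'
  · exact hp.exists_isShift hI hc hσ
  · exact fun α Γ hα hΓ => hΓ.hasWeierstrassForm hσ hα hI hc hp hs₀ h0
  · exact fun m I g₂ g₃ h s₀ g hI hc hp hs₀ h1 h2 hg =>
      hg.isExtremalTrajectory hp hI hc hs₀ h1 h2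
  · intro m I γ k hI hc hγ
    obtain ⟨g₂, g₃, h, s₀, δ, H⟩ := hγ.exists_explicitCurve hI hc
    exact ⟨I, g₂, g₃, h, s₀, δ, hI, hc, H⟩
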